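/- Let $(M,g)$ be a $4$-dimensional Einstein manifold, i.e. a smooth Riemannian $4$-manifold whose Ricci tensor is a constant multiple of $g$. Let $T_1M=\{(p,u)\in TM : g_p(u,u)=1\}$ be its unit tangent bundle with the canonical contact metric structure $(\eta,\bar g,\phi,\xi)$: $\bar g$ is one quarter of the metric induced on $T_1M$ by the Sasaki metric of $TM$, and $\eta$ is the $1$-form on $T_1M$ given at $(p,u)$ by $\eta(\bar X)=\tfrac12 g_p(d\pi(\bar X),u)$, where $\pi:TM\to M$ is the projection (further, $\xi=2u^h$, $\phi X^h=X^t$ and $\phi X^t=-X^h+\tfrac12 g(X,u)\xi$, where $X^h$ is the horizontal lift of $X$ and $X^t$ the vertical lift of $X-g(X,u)u$). Then $T_1M$ is $\eta$-Einstein, that is, there are smooth functions $\alpha,\beta$ on $T_1M$ such that the Ricci tensor $\bar\rho$ of $(T_1M,\bar g)$ satisfies $\bar\rho=\alpha\,\bar g+\beta\,\eta\otimes\eta$, if and only if $(M,g)$ has constant sectional curvature $1$ or constant sectional curvature $2$. -/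

import Mathlib

open scoped Manifold ContDiff

-- Nested spaces of continuous linear maps need a deeper instance search than the default.
set_option maxSynthPendingDepth 3

noncomputable section

/-! ### Levi-Civita connection and curvature of a metric on an open subset of a vector space

A Riemannian metric on an open subset of `V` is given by a field `h : V → V →L[ℝ] V →L[ℝ] ℝ` of
bilinear forms; only its values on the open subset matter below. -/

namespace LocalGeometry

variable {V : Type*} [NormedAddCommGroup V] [NormedSpace ℝ V]

/-- The Christoffel symbols of the first kind:
`christoffelFst h x X Y Z = (∂_X h(Y,Z) + ∂_Y h(X,Z) - ∂_Z h(X,Y)) / 2` at `x`. -/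
def christoffelFst (h : V → V →L[ℝ] V →L[ℝ] ℝ) (x : V) : V →L[ℝ] V →L[ℝ] V →L[ℝ] ℝ :=
  let D : V →L[ℝ] V →L[ℝ] V →L[ℝ] ℝ := fderiv ℝ h x
  let S : (V →L[ℝ] V →L[ℝ] ℝ) →L[ℝ] V →L[ℝ] V →L[ℝ] ℝ :=
    (ContinuousLinearMap.flipₗᵢ ℝ V V ℝ).toContinuousLinearEquiv.toContinuousLinearMap
  (1 / 2 : ℝ) • (D + D.flip - S.comp D.flip)

theorem christoffelFst_apply (h : V → V →L[ℝ] V →L[ℝ] ℝ) (x X Y Z : V) :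
    christoffelFst h x X Y Z =
      (1 / 2) * (fderiv ℝ h x X Y Z + fderiv ℝ h x Y X Z - fderiv ℝ h x Z X Y) := by
  simp [christoffelFst]

/-- The Christoffel symbols of the Levi-Civita connection, `Γ_x(X, Y) = ∇_X Y` for constant vector
fields `X`, `Y`: the vector with `h_x(Γ_x(X, Y), Z) = christoffelFst h x X Y Z` for all `Z`. -/
def christoffel (h : V → V →L[ℝ] V →L[ℝ] ℝ) (x : V) : V →L[ℝ] V →L[ℝ] V :=
  (ContinuousLinearMap.compL ℝ V (V →L[ℝ] ℝ) V (h x).inverse).comp (christoffelFst h x)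

/-- The curvature tensor `R(X, Y)Z = ∇_X ∇_Y Z - ∇_Y ∇_X Z - ∇_[X,Y] Z`, written out on constant
vector fields. -/
def curvature (h : V → V →L[ℝ] V →L[ℝ] ℝ) (x X Y Z : V) : V :=
  fderiv ℝ (christoffel h) x X Y Z - fderiv ℝ (christoffel h) x Y X Z +
    christoffel h x X (christoffel h x Y Z) - christoffel h x Y (christoffel h x X Z)

/-- The Ricci tensor `ρ(Y, Z)`, the trace of `X ↦ R(X, Y)Z`. -/
def ricci (h : V → V →L[ℝ] V →L[ℝ] ℝ) (x Y Z : V) : ℝ :=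
  LinearMap.trace ℝ V
    { toFun := fun X => curvature h x X Y Z
      map_add' := fun X X' => by simp [curvature]; abel
      map_smul' := fun c X => by simp [curvature, smul_add, smul_sub] }

/-- The sectional curvature of the plane spanned by `X` and `Y`. -/
def sectionalCurvature (h : V → V →L[ℝ] V →L[ℝ] ℝ) (x X Y : V) : ℝ :=
  h x (curvature h x X Y Y) X / (h x X X * h x Y Y - h x X Y ^ 2)

/-- The pull-back of a field of bilinear forms along a map. -/
def pullback {V' : Type*} [NormedAddCommGroup V'] [NormedSpace ℝ V']
    (k : V' → V' →L[ℝ] V' →L[ℝ] ℝ) (F : V → V') (w : V) : V →L[ℝ] V →L[ℝ] ℝ :=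
  (k (F w)).bilinearComp (fderiv ℝ F w) (fderiv ℝ F w)

/-- The connection map at the tangent vector `v` at `x`, where `z = (x, v)`: it sends the velocity
`(x', v')` of a curve in the tangent bundle to the covariant derivative `v' + Γ_x(x', v)`. Its
kernel consists of the horizontal lifts `X^h = (X, -Γ_x(X, v))`; the vertical lift of `X`
is `X^v = (0, X)`. -/
def connectionMap (h : V → V →L[ℝ] V →L[ℝ] ℝ) (z : V × V) : V × V →L[ℝ] V :=
  ContinuousLinearMap.snd ℝ V V +
    ((christoffel h z.1).flip z.2).comp (ContinuousLinearMap.fst ℝ V V)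

/-- The Sasaki metric on the tangent bundle in bundle coordinates `z = (x, v)`: the metric with
`g(X^h, Y^h) = g(X^v, Y^v) = h_x(X, Y)` and `g(X^h, Y^v) = 0`. -/
def sasakiMetric (h : V → V →L[ℝ] V →L[ℝ] ℝ) (z : V × V) :
    V × V →L[ℝ] V × V →L[ℝ] ℝ :=
  (h z.1).bilinearComp (ContinuousLinearMap.fst ℝ V V) (ContinuousLinearMap.fst ℝ V V) +
    (h z.1).bilinearComp (connectionMap h z) (connectionMap h z)

/-- A quarter of the Sasaki metric. Restricted to the unit tangent bundle it is the metric of the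
standard contact metric structure. -/
def contactMetric (h : V → V →L[ℝ] V →L[ℝ] ℝ) (z : V × V) :
    V × V →L[ℝ] V × V →L[ℝ] ℝ :=
  (1 / 4 : ℝ) • sasakiMetric h z

/-- The `1`-form with `η(X^v) = 0` and `η(X^h) = h_x(X, v) / 2` at `z = (x, v)`. Restricted to the
unit tangent bundle it is the contact form of the standard contact metric structure. -/
def contactForm (h : V → V →L[ℝ] V →L[ℝ] ℝ) (z : V × V) : V × V →L[ℝ] ℝ :=
  (1 / 2 : ℝ) • ((h z.1).flip z.2).comp (ContinuousLinearMap.fst ℝ V V)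

end LocalGeometry

/-! ### Riemannian manifolds -/

section Manifold

open LocalGeometry

variable {n : ℕ} {M : Type*} [TopologicalSpace M] [ChartedSpace (EuclideanSpace ℝ (Fin n)) M]
  [IsManifold (𝓡 n) ∞ M]

/-- The differential of the inverse of the chart `φ` at the point `x` of the chart target. -/
def chartSymmDeriv (φ : OpenPartialHomeomorph M (EuclideanSpace ℝ (Fin n)))
    (x : EuclideanSpace ℝ (Fin n)) :
    EuclideanSpace ℝ (Fin n) →L[ℝ] TangentSpace (𝓡 n) (φ.symm x) :=
  mfderiv (𝓡 n) (𝓡 n) φ.symm x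

/-- The metric `g` in the chart `φ`. -/
def metricInChart
    (g : Bundle.ContMDiffRiemannianMetric (𝓡 n) ∞ (EuclideanSpace ℝ (Fin n))
      (fun p : M => TangentSpace (𝓡 n) p))
    (φ : OpenPartialHomeomorph M (EuclideanSpace ℝ (Fin n))) (x : EuclideanSpace ℝ (Fin n)) :
    EuclideanSpace ℝ (Fin n) →L[ℝ] EuclideanSpace ℝ (Fin n) →L[ℝ] ℝ :=
  let B : EuclideanSpace ℝ (Fin n) →L[ℝ] EuclideanSpace ℝ (Fin n) →L[ℝ] ℝ := g.inner (φ.symm x)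
  let A : EuclideanSpace ℝ (Fin n) →L[ℝ] EuclideanSpace ℝ (Fin n) := chartSymmDeriv φ x
  B.bilinearComp A A

theorem metricInChart_apply
    (g : Bundle.ContMDiffRiemannianMetric (𝓡 n) ∞ (EuclideanSpace ℝ (Fin n))
      (fun p : M => TangentSpace (𝓡 n) p))
    (φ : OpenPartialHomeomorph M (EuclideanSpace ℝ (Fin n)))
    (x X Y : EuclideanSpace ℝ (Fin n)) :
    metricInChart g φ x X Y =
      g.inner (φ.symm x) (chartSymmDeriv φ x X) (chartSymmDeriv φ x Y) := rfl

/-- `(M, g)` is an Einstein manifold: its Ricci tensor is a constant multiple of the metric. -/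
def IsEinstein
    (g : Bundle.ContMDiffRiemannianMetric (𝓡 n) ∞ (EuclideanSpace ℝ (Fin n))
      (fun p : M => TangentSpace (𝓡 n) p)) : Prop :=
  ∃ c : ℝ, ∀ φ ∈ IsManifold.maximalAtlas (𝓡 n) ∞ M, ∀ x ∈ φ.target,
    ∀ X Y : EuclideanSpace ℝ (Fin n),
      ricci (metricInChart g φ) x X Y = c * metricInChart g φ x X Y

/-- All sectional curvatures of `(M, g)` are equal to `k`. -/
def HasConstantSectionalCurvature
    (g : Bundle.ContMDiffRiemannianMetric (𝓡 n) ∞ (EuclideanSpace ℝ (Fin n))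
      (fun p : M => TangentSpace (𝓡 n) p)) (k : ℝ) : Prop :=
  ∀ φ ∈ IsManifold.maximalAtlas (𝓡 n) ∞ M, ∀ x ∈ φ.target,
    ∀ X Y : EuclideanSpace ℝ (Fin n), LinearIndependent ℝ ![X, Y] →
      sectionalCurvature (metricInChart g φ) x X Y = k

/-- The tangent vector of `M` with bundle coordinates `z = (x, v)` in the chart `φ`. -/
def tangentPoint (φ : OpenPartialHomeomorph M (EuclideanSpace ℝ (Fin n)))
    (z : EuclideanSpace ℝ (Fin n) × EuclideanSpace ℝ (Fin n)) : TangentBundle (𝓡 n) M :=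
  ⟨φ.symm z.1, chartSymmDeriv φ z.1 z.2⟩

/-- The unit tangent bundle `T₁M = {(p, u) | g_p(u, u) = 1}`, a hypersurface of `TM`. -/
def unitTangentBundle
    (g : Bundle.ContMDiffRiemannianMetric (𝓡 n) ∞ (EuclideanSpace ℝ (Fin n))
      (fun p : M => TangentSpace (𝓡 n) p)) : Set (TangentBundle (𝓡 n) M) :=
  {z | g.inner z.1 z.2 z.2 = 1}

/-- `F` is, in the bundle coordinates of the chart `φ`, a local parametrization of the
`(2n-1)`-dimensional hypersurface `T₁M` of `TM`: a smooth immersion into `TM` of the open set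
`W ⊆ ℝ²ⁿ⁻¹` with values in `T₁M`. -/
structure IsLocalParametrization
    (g : Bundle.ContMDiffRiemannianMetric (𝓡 n) ∞ (EuclideanSpace ℝ (Fin n))
      (fun p : M => TangentSpace (𝓡 n) p))
    (φ : OpenPartialHomeomorph M (EuclideanSpace ℝ (Fin n)))
    (W : Set (EuclideanSpace ℝ (Fin (2 * n - 1))))
    (F : EuclideanSpace ℝ (Fin (2 * n - 1)) →
      EuclideanSpace ℝ (Fin n) × EuclideanSpace ℝ (Fin n)) : Prop where
  isOpen : IsOpen W
  contDiffOn : ContDiffOn ℝ ∞ F W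
  mem_target : ∀ w ∈ W, (F w).1 ∈ φ.target
  mem_unit : ∀ w ∈ W, tangentPoint φ (F w) ∈ unitTangentBundle g
  immersion : ∀ w ∈ W, Function.Injective (fderiv ℝ F w)

/-- The unit tangent bundle of `(M, g)`, with its standard contact metric structure, is
`η`-Einstein: there are smooth functions `α`, `β` on `T₁M` such that the Ricci tensor of the
contact metric `ḡ` on `T₁M` is `α ḡ + β η ⊗ η`. Smoothness and the equation are expressed in all
local parametrizations of `T₁M`; only the values of `α` and `β` on `T₁M` matter. -/
def IsEtaEinsteinUnitTangentBundle
    (g : Bundle.ContMDiffRiemannianMetric (𝓡 n) ∞ (EuclideanSpace ℝ (Fin n))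
      (fun p : M => TangentSpace (𝓡 n) p)) : Prop :=
  ∃ α β : TangentBundle (𝓡 n) M → ℝ,
    ∀ φ ∈ IsManifold.maximalAtlas (𝓡 n) ∞ M,
    ∀ (W : Set (EuclideanSpace ℝ (Fin (2 * n - 1))))
      (F : EuclideanSpace ℝ (Fin (2 * n - 1)) →
        EuclideanSpace ℝ (Fin n) × EuclideanSpace ℝ (Fin n)),
      IsLocalParametrization g φ W F →
      ContDiffOn ℝ ∞ (fun w => α (tangentPoint φ (F w))) W ∧
      ContDiffOn ℝ ∞ (fun w => β (tangentPoint φ (F w))) W ∧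
      ∀ w ∈ W, ∀ X Y : EuclideanSpace ℝ (Fin (2 * n - 1)),
        ricci (pullback (contactMetric (metricInChart g φ)) F) w X Y =
          α (tangentPoint φ (F w)) * pullback (contactMetric (metricInChart g φ)) F w X Y +
          β (tangentPoint φ (F w)) *
            (contactForm (metricInChart g φ) (F w) (fderiv ℝ F w X) *
              contactForm (metricInChart g φ) (F w) (fderiv ℝ F w Y))

end Manifold

end

/-! ### Calculus preliminaries -/

open Filter Topology

/-! Everything is local: in a chart the manifold is an open set with a metric `h`, and T₁M is seen
through immersions `F` into the unit vectors. Tangent vectors of TM are split into horizontal and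
vertical parts. In this splitting the Sasaki metric is h ⊕ h, its Levi-Civita connection is the
explicit `sasakiForm`, and dF is a torsion-free 1-form for the pulled-back connection
(`IsUnitImmersion.isMetricConnection`). T₁M has unit normal (0, u) and second fundamental form
-h(Xᵛ, Yᵛ), so `IsMetricConnection.gauss_equation`, traced over a frame of horizontal and vertical
lifts, gives its Ricci tensor (`IsUnitImmersion.ricci_eq`).

If the base has dimension n + 1 and constant curvature k, that tensor is, up to a multiple of η ⊗ η,
nk - k²/2 times the horizontal plus n - 1 + k²/2 times the vertical part of the metric. The factors
agree exactly when (k - 1)(k - n + 1) = 0, that is for k = 1, 2 when n = 3.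

Conversely, let ρ = c h. On vertical and horizontal lifts of y ⊥ u the terms with derivatives of the
curvature vanish, and the η-Einstein equation becomes two algebraic ones
(`IsMetricOn.algebraic_of_etaEinstein`): Σ|R(u, y)eᵢ|² = a|y|² and Σ|R(u, eᵢ)y|² = (2(c - 2) -
a/2)|y|². The first is symmetric in u and y, so a does not depend on u. Summing both over an
orthogonal frame that starts with u shows that the Jacobi operator R(u, ·)u has the same norm for
all unit u (`exists_normSqCurvature_eq`).

Now dimension four enters. By the Einstein condition the curvature operator on 2-forms has block
matrix (A B; B A) and acts on the two halves of Λ² as A + B and A - B, with trace-free parts W₊ and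
W₋. The norm of the Jacobi operator is a quartic in u whose harmonic part lies in Sym⁴S₊ ⊗ Sym⁴S₋.
Among the quadratic expressions in the curvature only W₊ ⊗ W₋ is of that type, so constancy forces
W₊ = 0 or W₋ = 0 (`weyl_eq_zero_or_eq_zero`). The first equation says that the square of the other
block is scalar, and the value of the Jacobi norm excludes eigenvalues of both signs. That block is
therefore a scalar k with (k - 1)(k - 2) = 0 (`scalar_of_half_weyl_eq_zero`). -/

theorem DifferentiableAt.hasDerivAt_line {E F : Type*} [NormedAddCommGroup E] [NormedSpace ℝ E]
    [NormedAddCommGroup F] [NormedSpace ℝ F] {f : E → F} {w : E}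
    (hf : DifferentiableAt ℝ f w) (X : E) :
    HasDerivAt (fun t : ℝ => f (w + t • X)) (fderiv ℝ f w X) 0 :=
  hf.hasFDerivAt.hasLineDerivAt X

theorem ContDiffOn.contDiffAt_of_isOpen {E F : Type*} [NormedAddCommGroup E] [NormedSpace ℝ E]
    [NormedAddCommGroup F] [NormedSpace ℝ F] {f : E → F} {U : Set E} {n : WithTop ℕ∞}
    (hf : ContDiffOn ℝ n f U) (hU : IsOpen U) {x : E} (hx : x ∈ U) : ContDiffAt ℝ n f x :=
  hf.contDiffAt (hU.mem_nhds hx)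

theorem ContDiffOn.differentiableAt_of_isOpen {E F : Type*} [NormedAddCommGroup E]
    [NormedSpace ℝ E] [NormedAddCommGroup F] [NormedSpace ℝ F] {f : E → F} {U : Set E}
    (hf : ContDiffOn ℝ ∞ f U) (hU : IsOpen U) {x : E} (hx : x ∈ U) : DifferentiableAt ℝ f x :=
  (hf.contDiffAt_of_isOpen hU hx).differentiableAt (by simp)

theorem ContDiffOn.fderiv_infty {E F : Type*} [NormedAddCommGroup E] [NormedSpace ℝ E]
    [NormedAddCommGroup F] [NormedSpace ℝ F] {f : E → F} {U : Set E}
    (hf : ContDiffOn ℝ ∞ f U) (hU : IsOpen U) : ContDiffOn ℝ ∞ (fderiv ℝ f) U :=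
  hf.fderiv_of_isOpen hU (by simp)

theorem ContDiffOn.fderiv_fderiv_comm {E F : Type*} [NormedAddCommGroup E] [NormedSpace ℝ E]
    [NormedAddCommGroup F] [NormedSpace ℝ F] {f : E → F} {U : Set E}
    (hf : ContDiffOn ℝ ∞ f U) (hU : IsOpen U) {x : E} (hx : x ∈ U) (X Y : E) :
    fderiv ℝ (fderiv ℝ f) x X Y = fderiv ℝ (fderiv ℝ f) x Y X :=
  (hf.contDiffAt_of_isOpen hU hx).isSymmSndFDerivAt
    (by simp only [minSmoothness_of_isRCLikeNormedField]; exact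
      (by exact_mod_cast le_top : ((2 : ℕ∞) : WithTop ℕ∞) ≤ ((⊤ : ℕ∞) : WithTop ℕ∞))) X Y

/-! ### Levi-Civita connection and the symmetries of the curvature tensor -/

namespace LocalGeometry

variable {V : Type*} [NormedAddCommGroup V] [NormedSpace ℝ V]

/-- `h` restricts to a smooth Riemannian metric on the open set `U`. -/
structure IsMetricOn (h : V → V →L[ℝ] V →L[ℝ] ℝ) (U : Set V) : Prop where
  isOpen : IsOpen U
  smooth : ContDiffOn ℝ ∞ h U
  symm : ∀ x ∈ U, ∀ X Y, h x X Y = h x Y X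
  pos : ∀ x ∈ U, ∀ X, X ≠ 0 → 0 < h x X X

/-- The Christoffel symbols of the first kind as a continuous linear function of the first
derivatives of the metric. -/
noncomputable def christoffelFstL : (V →L[ℝ] V →L[ℝ] V →L[ℝ] ℝ) →L[ℝ] V →L[ℝ] V →L[ℝ] V →L[ℝ] ℝ :=
  let S : (V →L[ℝ] V →L[ℝ] ℝ) →L[ℝ] V →L[ℝ] V →L[ℝ] ℝ :=
    (ContinuousLinearMap.flipₗᵢ ℝ V V ℝ).toContinuousLinearEquiv.toContinuousLinearMap
  let T : (V →L[ℝ] V →L[ℝ] V →L[ℝ] ℝ) →L[ℝ] V →L[ℝ] V →L[ℝ] V →L[ℝ] ℝ :=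
    (ContinuousLinearMap.flipₗᵢ ℝ V V (V →L[ℝ] ℝ)).toContinuousLinearEquiv.toContinuousLinearMap
  (1 / 2 : ℝ) • (ContinuousLinearMap.id ℝ _ + T -
    (ContinuousLinearMap.compL ℝ V (V →L[ℝ] V →L[ℝ] ℝ) (V →L[ℝ] V →L[ℝ] ℝ) S).comp T)

theorem christoffelFst_eq (h : V → V →L[ℝ] V →L[ℝ] ℝ) :
    christoffelFst h = fun x => christoffelFstL (fderiv ℝ h x) := by
  funext x
  ext X Y Z
  simp [christoffelFst, christoffelFstL]

variable {h : V → V →L[ℝ] V →L[ℝ] ℝ} {U : Set V} {x : V}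

namespace IsMetricOn

theorem const_smul {c : ℝ} (hc : 0 < c) (H : IsMetricOn h U) : IsMetricOn (fun x => c • h x) U where
  isOpen := H.isOpen
  smooth := H.smooth.const_smul c
  symm x hx X Y := by simp [H.symm x hx X Y]
  pos x hx X hX := by simpa using mul_pos hc (H.pos x hx X hX)

theorem eq_zero (H : IsMetricOn h U) (hx : x ∈ U) {X : V} (hX : ∀ Z, h x X Z = 0) : X = 0 := by
  by_contra h0
  exact (H.pos x hx X h0).ne' (hX X)

theorem ext (H : IsMetricOn h U) (hx : x ∈ U) {X Y : V} (hXY : ∀ Z, h x X Z = h x Y Z) : X = Y :=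
  sub_eq_zero.1 (H.eq_zero hx fun Z => by simp [hXY])

theorem christoffelFst_smooth (H : IsMetricOn h U) : ContDiffOn ℝ ∞ (christoffelFst h) U := by
  rw [christoffelFst_eq]
  exact christoffelFstL.contDiff.comp_contDiffOn (H.smooth.fderiv_infty H.isOpen)

/-- A device used throughout: restrict to the line t ↦ x + tX, differentiate two expressions that
agree near t = 0, and compare by uniqueness of derivatives. -/
theorem fderiv_symm (H : IsMetricOn h U) (hx : x ∈ U) (X Y Z : V) :
    fderiv ℝ h x X Y Z = fderiv ℝ h x X Z Y := by
  have hd := (H.smooth.differentiableAt_of_isOpen H.isOpen hx).hasDerivAt_line X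
  have h1 := (hd.clm_apply (hasDerivAt_const _ Y)).clm_apply (hasDerivAt_const _ Z)
  have h2 := (hd.clm_apply (hasDerivAt_const _ Z)).clm_apply (hasDerivAt_const _ Y)
  have hU : ∀ᶠ t : ℝ in 𝓝 0, x + t • X ∈ U := by
    have : Tendsto (fun t : ℝ => x + t • X) (𝓝 0) (𝓝 x) := by
      have : Continuous fun t : ℝ => x + t • X := by fun_prop
      simpa using this.tendsto 0
    exact this (H.isOpen.mem_nhds hx)
  have h3 := h1.congr_of_eventuallyEq (hU.mono fun t ht => (H.symm _ ht Z Y))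
  simpa using h3.unique h2

variable [FiniteDimensional ℝ V]

theorem exists_equiv (H : IsMetricOn h U) (hx : x ∈ U) : ∃ e : V ≃L[ℝ] (V →L[ℝ] ℝ), ↑e = h x := by
  have hinj : Function.Injective (h x : V →ₗ[ℝ] (V →L[ℝ] ℝ)) := by
    intro X Y hXY
    exact H.ext hx fun Z => DFunLike.congr_fun hXY Z
  have hd : Module.finrank ℝ V = Module.finrank ℝ (V →L[ℝ] ℝ) := by
    rw [← LinearEquiv.finrank_eq (LinearMap.toContinuousLinearMap (𝕜 := ℝ) (E := V) (F' := ℝ))]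
    exact (Subspace.dual_finrank_eq (K := ℝ) (V := V)).symm
  exact ⟨(LinearEquiv.ofInjectiveOfFinrankEq _ hinj hd).toContinuousLinearEquiv, rfl⟩

theorem apply_christoffel (H : IsMetricOn h U) (hx : x ∈ U) (X Y Z : V) :
    h x (christoffel h x X Y) Z = christoffelFst h x X Y Z := by
  obtain ⟨e, he⟩ := H.exists_equiv hx
  have : christoffel h x X Y = e.symm (christoffelFst h x X Y) := by
    simp [christoffel, ← he]
  rw [this, ← he]
  simp

theorem christoffel_smooth (H : IsMetricOn h U) : ContDiffOn ℝ ∞ (christoffel h) U := by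
  have h1 : ContDiffOn ℝ ∞ (fun x => (h x).inverse) U := by
    intro x hx
    obtain ⟨e, he⟩ := H.exists_equiv hx
    have h2 : ContDiffAt ℝ ∞ ContinuousLinearMap.inverse (h x) := he ▸ contDiffAt_map_inverse e
    exact h2.comp_contDiffWithinAt x (H.smooth x hx)
  have h2 := (ContinuousLinearMap.compL ℝ V (V →L[ℝ] ℝ) V).contDiff.comp_contDiffOn h1
  exact h2.clm_comp H.christoffelFst_smooth

theorem christoffel_symm (H : IsMetricOn h U) (hx : x ∈ U) (X Y : V) :
    christoffel h x X Y = christoffel h x Y X := by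
  refine H.ext hx fun Z => ?_
  rw [H.apply_christoffel hx, H.apply_christoffel hx, christoffelFst_apply, christoffelFst_apply,
    H.fderiv_symm hx Z X Y]
  ring

theorem fderiv_eq (H : IsMetricOn h U) (hx : x ∈ U) (X Y Z : V) :
    fderiv ℝ h x X Y Z = h x (christoffel h x X Y) Z + h x Y (christoffel h x X Z) := by
  rw [H.symm x hx Y, H.apply_christoffel hx, H.apply_christoffel hx, christoffelFst_apply,
    christoffelFst_apply, H.fderiv_symm hx X Z Y, H.fderiv_symm hx Z X Y, H.fderiv_symm hx Y X Z]
  ring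

theorem christoffelFst_add (H : IsMetricOn h U) (hx : x ∈ U) (X Y Z : V) :
    christoffelFst h x X Y Z + christoffelFst h x X Z Y = fderiv ℝ h x X Y Z := by
  rw [H.fderiv_eq hx, H.apply_christoffel hx, H.symm x hx Y, H.apply_christoffel hx]

theorem christoffel_const_smul {c : ℝ} (hc : 0 < c) (H : IsMetricOn h U) (hx : x ∈ U) :
    christoffel (fun x => c • h x) x = christoffel h x := by
  ext X Y
  have H' := H.const_smul hc
  refine H.ext hx fun Z => ?_
  have h1 : fderiv ℝ (fun x => c • h x) x = c • fderiv ℝ h x :=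
    fderiv_fun_const_smul (H.smooth.differentiableAt_of_isOpen H.isOpen hx) c
  have h2 := H'.apply_christoffel hx X Y Z
  rw [christoffelFst_apply, h1] at h2
  rw [H.apply_christoffel hx, christoffelFst_apply]
  have h3 : c * h x (christoffel (fun x => c • h x) x X Y) Z = c * ((1 / 2) *
      (fderiv ℝ h x X Y Z + fderiv ℝ h x Y X Z - fderiv ℝ h x Z X Y)) := by
    simpa [mul_add, mul_sub, mul_left_comm] using h2
  exact mul_left_cancel₀ hc.ne' h3

omit [FiniteDimensional ℝ V] in
theorem eventually_mem (H : IsMetricOn h U) (hx : x ∈ U) (X : V) :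
    ∀ᶠ t : ℝ in 𝓝 0, x + t • X ∈ U := by
  have : Tendsto (fun t : ℝ => x + t • X) (𝓝 0) (𝓝 x) := by
    have : Continuous fun t : ℝ => x + t • X := by fun_prop
    simpa using this.tendsto 0
  exact this (H.isOpen.mem_nhds hx)

theorem curvature_const_smul {c : ℝ} (hc : 0 < c) (H : IsMetricOn h U) (hx : x ∈ U) (X Y Z : V) :
    curvature (fun x => c • h x) x X Y Z = curvature h x X Y Z := by
  have h1 : fderiv ℝ (christoffel (fun x => c • h x)) x = fderiv ℝ (christoffel h) x := by
    refine Filter.EventuallyEq.fderiv_eq ?_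
    filter_upwards [H.isOpen.mem_nhds hx] with y hy using H.christoffel_const_smul hc hy
  simp only [curvature, h1, H.christoffel_const_smul hc hx]

theorem ricci_const_smul {c : ℝ} (hc : 0 < c) (H : IsMetricOn h U) (hx : x ∈ U) (Y Z : V) :
    ricci (fun x => c • h x) x Y Z = ricci h x Y Z := by
  simp only [ricci, H.curvature_const_smul hc hx]

/-- This is h(∇_X ∇_Y Z, T) = X h(∇_Y Z, T) - h(∇_Y Z, ∇_X T): the relation between the two kinds of
Christoffel symbols is differentiated, and metric compatibility replaces the derivative of `h`. -/
theorem apply_fderiv_christoffel (H : IsMetricOn h U) (hx : x ∈ U) (X Y Z T : V) :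
    h x (fderiv ℝ (christoffel h) x X Y Z + christoffel h x X (christoffel h x Y Z)) T =
      fderiv ℝ (christoffelFst h) x X Y Z T -
        h x (christoffel h x Y Z) (christoffel h x X T) := by
  have dh := (H.smooth.differentiableAt_of_isOpen H.isOpen hx).hasDerivAt_line X
  have dG := (H.christoffel_smooth.differentiableAt_of_isOpen H.isOpen hx).hasDerivAt_line X
  have dF := (H.christoffelFst_smooth.differentiableAt_of_isOpen H.isOpen hx).hasDerivAt_line X
  have h1 := (dh.clm_apply ((dG.clm_apply (hasDerivAt_const _ Y)).clm_apply
    (hasDerivAt_const _ Z))).clm_apply (hasDerivAt_const _ T)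
  have h2 := ((dF.clm_apply (hasDerivAt_const _ Y)).clm_apply (hasDerivAt_const _ Z)).clm_apply
    (hasDerivAt_const _ T)
  have h3 := h2.congr_of_eventuallyEq
    ((H.eventually_mem hx X).mono fun t ht => H.apply_christoffel ht Y Z T)
  have h4 := h1.unique h3
  simp only [zero_smul, add_zero, map_zero, add_apply, H.fderiv_eq hx] at h4
  simp only [map_add, add_apply]
  linarith

/-- The curvature tensor in terms of the Christoffel symbols of the first kind. -/
theorem apply_curvature (H : IsMetricOn h U) (hx : x ∈ U) (X Y Z T : V) :
    h x (curvature h x X Y Z) T =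
      fderiv ℝ (christoffelFst h) x X Y Z T - fderiv ℝ (christoffelFst h) x Y X Z T -
        h x (christoffel h x Y Z) (christoffel h x X T) +
        h x (christoffel h x X Z) (christoffel h x Y T) := by
  have h1 := H.apply_fderiv_christoffel hx X Y Z T
  have h2 := H.apply_fderiv_christoffel hx Y X Z T
  simp only [curvature, map_add, map_sub, add_apply, sub_apply] at h1 h2 ⊢
  linarith

theorem fderiv_christoffelFst_add (H : IsMetricOn h U) (hx : x ∈ U) (X Y Z T : V) :
    fderiv ℝ (christoffelFst h) x X Y Z T + fderiv ℝ (christoffelFst h) x X Y T Z =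
      fderiv ℝ (fderiv ℝ h) x X Y Z T := by
  have dD := ((H.smooth.fderiv_infty H.isOpen).differentiableAt_of_isOpen
    H.isOpen hx).hasDerivAt_line X
  have dF := (H.christoffelFst_smooth.differentiableAt_of_isOpen H.isOpen hx).hasDerivAt_line X
  have h1 := ((dF.clm_apply (hasDerivAt_const _ Y)).clm_apply (hasDerivAt_const _ Z)).clm_apply
    (hasDerivAt_const _ T)
  have h2 := ((dF.clm_apply (hasDerivAt_const _ Y)).clm_apply (hasDerivAt_const _ T)).clm_apply
    (hasDerivAt_const _ Z)
  have h3 := ((dD.clm_apply (hasDerivAt_const _ Y)).clm_apply (hasDerivAt_const _ Z)).clm_apply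
    (hasDerivAt_const _ T)
  have h4 := (h1.fun_add h2).congr_of_eventuallyEq
    ((H.eventually_mem hx X).mono fun t ht => (H.christoffelFst_add ht Y Z T).symm)
  simpa using h4.unique h3

/-- The part symmetric in `Z`, `T` of the derivative of the first-kind symbols is a second
derivative of h(Z, T), and second derivatives commute. -/
theorem curvature_skew_right (H : IsMetricOn h U) (hx : x ∈ U) (X Y Z T : V) :
    h x (curvature h x X Y Z) T = - h x (curvature h x X Y T) Z := by
  rw [H.apply_curvature hx, H.apply_curvature hx, H.symm x hx (christoffel h x Y Z),
    H.symm x hx (christoffel h x X Z)]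
  have h1 := H.fderiv_christoffelFst_add hx X Y Z T
  have h2 := H.fderiv_christoffelFst_add hx Y X Z T
  rw [H.smooth.fderiv_fderiv_comm H.isOpen hx] at h1
  linarith

omit [FiniteDimensional ℝ V] in
theorem curvature_skew_left (h : V → V →L[ℝ] V →L[ℝ] ℝ) (x X Y Z : V) :
    curvature h x X Y Z = - curvature h x Y X Z := by
  simp only [curvature]
  abel

theorem fderiv_christoffel_symm (H : IsMetricOn h U) (hx : x ∈ U) (X Y Z : V) :
    fderiv ℝ (christoffel h) x X Y Z = fderiv ℝ (christoffel h) x X Z Y := by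
  have dG := (H.christoffel_smooth.differentiableAt_of_isOpen H.isOpen hx).hasDerivAt_line X
  have h1 := (dG.clm_apply (hasDerivAt_const _ Y)).clm_apply (hasDerivAt_const _ Z)
  have h2 := (dG.clm_apply (hasDerivAt_const _ Z)).clm_apply (hasDerivAt_const _ Y)
  have h3 := h1.congr_of_eventuallyEq
    ((H.eventually_mem hx X).mono fun t ht => H.christoffel_symm ht Z Y)
  simpa using h3.unique h2

theorem bianchi (H : IsMetricOn h U) (hx : x ∈ U) (X Y Z : V) :
    curvature h x X Y Z + curvature h x Y Z X + curvature h x Z X Y = 0 := by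
  simp only [curvature, H.fderiv_christoffel_symm hx X Z Y, H.fderiv_christoffel_symm hx Y Z X,
    H.fderiv_christoffel_symm hx Z Y X, H.christoffel_symm hx Y X, H.christoffel_symm hx Z X,
    H.christoffel_symm hx Z Y]
  abel

theorem curvature_pair_symm (H : IsMetricOn h U) (hx : x ∈ U) (X Y Z T : V) :
    h x (curvature h x X Y Z) T = h x (curvature h x Z T X) Y := by
  have b : ∀ X Y Z T, h x (curvature h x X Y Z) T + h x (curvature h x Y Z X) T +
      h x (curvature h x Z X Y) T = 0 := fun X Y Z T => by
    rw [← add_apply, ← map_add, ← add_apply, ← map_add, H.bianchi hx]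
    simp
  have s : ∀ X Y Z T, h x (curvature h x X Y Z) T = - h x (curvature h x Y X Z) T :=
    fun X Y Z T => by rw [curvature_skew_left]; simp
  have r := H.curvature_skew_right hx
  -- The classical octahedron argument: the four cyclic Bianchi identities are added, and skewness
  -- in both pairs cancels all but the two wanted terms.
  linarith [b X Y Z T, b Y Z T X, b Z T X Y, b T X Y Z, s X Y Z T, s Y Z X T, s Z X Y T,
    s Y Z T X, s Z T Y X, s T Y Z X, s Z T X Y, s T X Z Y, s X Z T Y, s T X Y Z, s X Y T Z,
    s Y T X Z, r X Y Z T, r Y Z X T, r Z X Y T, r Z T X Y, r T Y Z X, r T X Y Z, r X Z T Y,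
        r Y T X Z,
    r Y X Z T, r Z Y X T, r X Z Y T, r T Z X Y, r Y T Z X, r X T Y Z, r Z X T Y, r T Y X Z]

end IsMetricOn

/-- The curvature tensor as a bundled continuous trilinear map. -/
noncomputable def curvatureL (h : V → V →L[ℝ] V →L[ℝ] ℝ) (x : V) :
    V →L[ℝ] V →L[ℝ] V →L[ℝ] V :=
  let C : V →L[ℝ] V →L[ℝ] V →L[ℝ] V :=
    fderiv ℝ (christoffel h) x +
    ((ContinuousLinearMap.compL ℝ V (V →L[ℝ] V) (V →L[ℝ] V)).flip (christoffel h x)).comp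
      ((ContinuousLinearMap.compL ℝ V V V).comp (christoffel h x))
  C - C.flip

theorem curvatureL_apply (h : V → V →L[ℝ] V →L[ℝ] ℝ) (x X Y Z : V) :
    curvatureL h x X Y Z = curvature h x X Y Z := by
  simp [curvatureL, curvature]
  abel

theorem IsMetricOn.curvatureL_smooth [FiniteDimensional ℝ V] (H : IsMetricOn h U) :
    ContDiffOn ℝ ∞ (curvatureL h) U := by
  refine contDiffOn_clm_apply.2 fun X => contDiffOn_clm_apply.2 fun Y =>
    contDiffOn_clm_apply.2 fun Z => ?_
  simp only [curvatureL_apply, curvature]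
  have h1 := H.christoffel_smooth
  have h2 := h1.fderiv_infty H.isOpen
  have c : ∀ W : V, ContDiffOn ℝ ∞ (fun _ : V => W) U := fun W => contDiffOn_const
  exact (((((h2.clm_apply (c X)).clm_apply (c Y)).clm_apply (c Z)).sub
    (((h2.clm_apply (c Y)).clm_apply (c X)).clm_apply (c Z))).add
    ((h1.clm_apply (c X)).clm_apply ((h1.clm_apply (c Y)).clm_apply (c Z)))).sub
    ((h1.clm_apply (c Y)).clm_apply ((h1.clm_apply (c X)).clm_apply (c Z)))

end LocalGeometry

/-! ### Gauss equation for a torsion-free bundle-valued 1-form -/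

open Filter Topology

namespace LocalGeometry

variable {E B : Type*} [NormedAddCommGroup E] [NormedSpace ℝ E] [NormedAddCommGroup B]
  [NormedSpace ℝ B]

/-- `k` is a fibre metric and `d + θ` a connection compatible with it, both on the trivial bundle
with fibre `B` over the open set `W ⊆ E`, and `Φ` is a torsion-free `B`-valued `1`-form. -/
structure IsMetricConnection (k : E → B →L[ℝ] B →L[ℝ] ℝ) (θ : E → E →L[ℝ] B →L[ℝ] B)
    (Φ : E → E →L[ℝ] B) (W : Set E) : Prop where
  isOpen : IsOpen W
  smooth_metric : ContDiffOn ℝ ∞ k W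
  smooth_form : ContDiffOn ℝ ∞ θ W
  smooth_map : ContDiffOn ℝ ∞ Φ W
  symm : ∀ w ∈ W, ∀ s t, k w s t = k w t s
  metric : ∀ w ∈ W, ∀ X s t, fderiv ℝ k w X s t = k w (θ w X s) t + k w s (θ w X t)
  torsion : ∀ w ∈ W, ∀ X Y, fderiv ℝ Φ w X Y + θ w X (Φ w Y) = fderiv ℝ Φ w Y X + θ w Y (Φ w X)

/-- The covariant derivative of the section `Φ Y` in the direction `X`, for constant `Y`. -/
noncomputable def covDeriv (θ : E → E →L[ℝ] B →L[ℝ] B) (Φ : E → E →L[ℝ] B) (w X Y : E) : B :=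
  fderiv ℝ Φ w X Y + θ w X (Φ w Y)

/-- The curvature of the connection `d + θ`. -/
noncomputable def connectionCurvature (θ : E → E →L[ℝ] B →L[ℝ] B) (w X Y : E) (s : B) : B :=
  fderiv ℝ θ w X Y s - fderiv ℝ θ w Y X s + θ w X (θ w Y s) - θ w Y (θ w X s)

namespace IsMetricConnection

variable {k : E → B →L[ℝ] B →L[ℝ] ℝ} {θ : E → E →L[ℝ] B →L[ℝ] B} {Φ : E → E →L[ℝ] B} {W : Set E}
  {w : E}

theorem eventually_mem (D : IsMetricConnection k θ Φ W) (hw : w ∈ W) (X : E) :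
    ∀ᶠ t : ℝ in 𝓝 0, w + t • X ∈ W := by
  have : Tendsto (fun t : ℝ => w + t • X) (𝓝 0) (𝓝 w) := by
    have : Continuous fun t : ℝ => w + t • X := by fun_prop
    simpa using this.tendsto 0
  exact this (D.isOpen.mem_nhds hw)

theorem fderiv_inducedMetric (D : IsMetricConnection k θ Φ W)
    (H : IsMetricOn (fun w => (k w).bilinearComp (Φ w) (Φ w)) W) (hw : w ∈ W) (X Y Z : E) :
    fderiv ℝ (fun w => (k w).bilinearComp (Φ w) (Φ w)) w X Y Z =
      k w (covDeriv θ Φ w X Y) (Φ w Z) + k w (Φ w Y) (covDeriv θ Φ w X Z) := by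
  have dk := (D.smooth_metric.differentiableAt_of_isOpen D.isOpen hw).hasDerivAt_line X
  have dΦ := (D.smooth_map.differentiableAt_of_isOpen D.isOpen hw).hasDerivAt_line X
  have dG := (H.smooth.differentiableAt_of_isOpen D.isOpen hw).hasDerivAt_line X
  have h1 := (dk.clm_apply (dΦ.clm_apply (hasDerivAt_const _ Y))).clm_apply
    (dΦ.clm_apply (hasDerivAt_const _ Z))
  have h2 := (dG.clm_apply (hasDerivAt_const _ Y)).clm_apply (hasDerivAt_const _ Z)
  simp only [ContinuousLinearMap.bilinearComp_apply] at h2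
  have h3 := h2.unique h1
  simp only [zero_smul, add_zero, map_zero, add_apply, D.metric w hw] at h3
  rw [h3]
  simp only [covDeriv, map_add, add_apply]
  ring

theorem covDeriv_symm (D : IsMetricConnection k θ Φ W) (hw : w ∈ W) (X Y : E) :
    covDeriv θ Φ w X Y = covDeriv θ Φ w Y X := D.torsion w hw X Y

/-- Koszul's formula: compatibility turns the derivatives of the induced metric into covariant
derivatives of `Φ`, and absence of torsion makes all but one of them cancel. So the Levi-Civita
connection of the induced metric is the tangential part of the given connection. -/
theorem christoffelFst_inducedMetric (D : IsMetricConnection k θ Φ W)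
    (H : IsMetricOn (fun w => (k w).bilinearComp (Φ w) (Φ w)) W) (hw : w ∈ W) (X Y Z : E) :
    christoffelFst (fun w => (k w).bilinearComp (Φ w) (Φ w)) w X Y Z =
      k w (covDeriv θ Φ w X Y) (Φ w Z) := by
  rw [christoffelFst_apply, D.fderiv_inducedMetric H hw, D.fderiv_inducedMetric H hw,
    D.fderiv_inducedMetric H hw, D.covDeriv_symm hw Y X, D.covDeriv_symm hw Z X,
    D.covDeriv_symm hw Z Y, D.symm w hw (Φ w X), D.symm w hw (Φ w Y)]
  ring

theorem fderiv_christoffelFst_inducedMetric [FiniteDimensional ℝ E]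
    (D : IsMetricConnection k θ Φ W)
    (H : IsMetricOn (fun w => (k w).bilinearComp (Φ w) (Φ w)) W) (hw : w ∈ W) (X Y Z T : E) :
    fderiv ℝ (christoffelFst (fun w => (k w).bilinearComp (Φ w) (Φ w))) w X Y Z T =
      k w (fderiv ℝ (fderiv ℝ Φ) w X Y Z + fderiv ℝ θ w X Y (Φ w Z) + θ w Y (fderiv ℝ Φ w X Z) +
        θ w X (covDeriv θ Φ w Y Z)) (Φ w T) +
      k w (covDeriv θ Φ w Y Z) (covDeriv θ Φ w X T) := by
  have dk := (D.smooth_metric.differentiableAt_of_isOpen D.isOpen hw).hasDerivAt_line X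
  have dθ := (D.smooth_form.differentiableAt_of_isOpen D.isOpen hw).hasDerivAt_line X
  have dΦ := (D.smooth_map.differentiableAt_of_isOpen D.isOpen hw).hasDerivAt_line X
  have ddΦ := ((D.smooth_map.fderiv_infty D.isOpen).differentiableAt_of_isOpen
    D.isOpen hw).hasDerivAt_line X
  have dF := (H.christoffelFst_smooth.differentiableAt_of_isOpen D.isOpen hw).hasDerivAt_line X
  have cY := hasDerivAt_const (0 : ℝ) Y
  have cZ := hasDerivAt_const (0 : ℝ) Z
  have cT := hasDerivAt_const (0 : ℝ) T
  have h1 := (dk.clm_apply (((ddΦ.clm_apply cY).clm_apply cZ).fun_add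
    ((dθ.clm_apply cY).clm_apply (dΦ.clm_apply cZ)))).clm_apply (dΦ.clm_apply cT)
  have h2 := ((dF.clm_apply cY).clm_apply cZ).clm_apply cT
  have h3 := h1.congr_of_eventuallyEq ((D.eventually_mem hw X).mono fun t ht =>
    D.christoffelFst_inducedMetric H ht Y Z T)
  have h4 := h2.unique h3
  simp only [zero_smul, add_zero, map_zero, add_apply, D.metric w hw] at h4
  rw [h4]
  simp only [covDeriv, map_add, add_apply]
  ring

/-- The Gauss equation: if `Φ` identifies the tangent spaces with the orthogonal complement of the
unit normal field `n`, the curvature of the metric induced by `Φ` is the curvature of the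
connection corrected by the second fundamental form `b`. -/
theorem gauss_equation [FiniteDimensional ℝ E] (D : IsMetricConnection k θ Φ W)
    (H : IsMetricOn (fun w => (k w).bilinearComp (Φ w) (Φ w)) W) (hw : w ∈ W) {n : B}
    (hn : k w n n = 1) (hΦ : ∀ X, k w (Φ w X) n = 0)
    (hsurj : ∀ s, k w s n = 0 → ∃ X, Φ w X = s) (X Y Z T : E) :
    k w (Φ w (curvature (fun w => (k w).bilinearComp (Φ w) (Φ w)) w X Y Z)) (Φ w T) =
      k w (connectionCurvature θ w X Y (Φ w Z)) (Φ w T) +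
        k w (covDeriv θ Φ w Y Z) n * k w (covDeriv θ Φ w X T) n -
        k w (covDeriv θ Φ w X Z) n * k w (covDeriv θ Φ w Y T) n := by
  -- `Φ` carries the induced Levi-Civita derivative to the ambient derivative minus its normal
  -- component; that component lies in no image of `Φ`, so the projection is checked by pairing with
  -- tangent vectors.
  have key : ∀ X Y, Φ w (christoffel (fun w => (k w).bilinearComp (Φ w) (Φ w)) w X Y) =
      covDeriv θ Φ w X Y - k w (covDeriv θ Φ w X Y) n • n := by
    intro X Y
    obtain ⟨P, hP⟩ := hsurj (covDeriv θ Φ w X Y - k w (covDeriv θ Φ w X Y) n • n) (by simp [hn])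
    rw [← hP]
    congr 1
    refine H.ext hw fun Z => ?_
    rw [H.apply_christoffel hw, D.christoffelFst_inducedMetric H hw,
      ContinuousLinearMap.bilinearComp_apply, hP]
    simp [D.symm w hw n, hΦ]
  have h1 := H.apply_curvature hw X Y Z T
  simp only [ContinuousLinearMap.bilinearComp_apply] at h1
  rw [h1, D.fderiv_christoffelFst_inducedMetric H hw, D.fderiv_christoffelFst_inducedMetric H hw,
    key, key, key, key, D.smooth_map.fderiv_fderiv_comm D.isOpen hw Y X]
  simp only [map_sub, sub_apply, map_smul, smul_apply, smul_eq_mul, D.symm w hw n, hn,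
    connectionCurvature, covDeriv, map_add, add_apply]
  ring

end IsMetricConnection

end LocalGeometry

/-! ### The Sasaki connection along an immersion into the unit sphere bundle -/

open Filter Topology

theorem HasDerivAt.comp_fst {V V' : Type*} [NormedAddCommGroup V] [NormedSpace ℝ V]
    [NormedAddCommGroup V'] [NormedSpace ℝ V'] {f : ℝ → V × V'} {f' : V × V'} {t : ℝ}
    (hf : HasDerivAt f f' t) : HasDerivAt (fun s => (f s).1) f'.1 t := by
  simpa using (hf.hasFDerivAt.fst).hasDerivAt

theorem HasDerivAt.comp_snd {V V' : Type*} [NormedAddCommGroup V] [NormedSpace ℝ V]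
    [NormedAddCommGroup V'] [NormedSpace ℝ V'] {f : ℝ → V × V'} {f' : V × V'} {t : ℝ}
    (hf : HasDerivAt f f' t) : HasDerivAt (fun s => (f s).2) f'.2 t := by
  simpa using (hf.hasFDerivAt.snd).hasDerivAt

namespace LocalGeometry

variable {V : Type*} [NormedAddCommGroup V] [NormedSpace ℝ V]

/-- The covariant derivative `(∇_P R)(S, T)Z` of the curvature tensor. -/
noncomputable def covDerivCurvature (h : V → V →L[ℝ] V →L[ℝ] ℝ) (x P S T Z : V) : V :=
  fderiv ℝ (curvatureL h) x P S T Z + christoffel h x P (curvatureL h x S T Z) -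
    curvatureL h x (christoffel h x P S) T Z - curvatureL h x S (christoffel h x P T) Z -
    curvatureL h x S T (christoffel h x P Z)

/-- The fibre metric `h ⊕ h` on the sum of the horizontal and the vertical bundle. -/
noncomputable def splitMetric (h : V → V →L[ℝ] V →L[ℝ] ℝ) (x : V) :
    V × V →L[ℝ] V × V →L[ℝ] ℝ :=
  (h x).bilinearComp (ContinuousLinearMap.fst ℝ V V) (ContinuousLinearMap.fst ℝ V V) +
    (h x).bilinearComp (ContinuousLinearMap.snd ℝ V V) (ContinuousLinearMap.snd ℝ V V)

@[simp]
theorem splitMetric_apply (h : V → V →L[ℝ] V →L[ℝ] ℝ) (x : V) (s t : V × V) :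
    splitMetric h x s t = h x s.1 t.1 + h x s.2 t.2 := by
  simp [splitMetric]

/-- The Levi-Civita connection of the Sasaki metric at `z = (x, v)`, in the splitting into
horizontal and vertical part: `p` is the direction, `s` the section. -/
noncomputable def sasakiForm [FiniteDimensional ℝ V] (h : V → V →L[ℝ] V →L[ℝ] ℝ) (z : V × V) :
    V × V →L[ℝ] V × V →L[ℝ] V × V :=
  LinearMap.toContinuousLinearMap (LinearMap.toContinuousLinearMap.toLinearMap ∘ₗ
    LinearMap.mk₂ ℝ (fun p s : V × V =>
      (christoffel h z.1 p.1 s.1 + (1 / 2 : ℝ) • curvatureL h z.1 z.2 s.2 p.1 +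
          (1 / 2 : ℝ) • curvatureL h z.1 z.2 p.2 s.1,
        christoffel h z.1 p.1 s.2 - (1 / 2 : ℝ) • curvatureL h z.1 p.1 s.1 z.2))
      (fun p p' s => by ext <;> simp <;> module) (fun c p s => by ext <;> simp <;> module)
      (fun p s s' => by ext <;> simp <;> module) (fun c p s => by ext <;> simp <;> module))

theorem sasakiForm_apply [FiniteDimensional ℝ V] (h : V → V →L[ℝ] V →L[ℝ] ℝ) (z p s : V × V) :
    sasakiForm h z p s =
      (christoffel h z.1 p.1 s.1 + (1 / 2 : ℝ) • curvatureL h z.1 z.2 s.2 p.1 +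
          (1 / 2 : ℝ) • curvatureL h z.1 z.2 p.2 s.1,
        christoffel h z.1 p.1 s.2 - (1 / 2 : ℝ) • curvatureL h z.1 p.1 s.1 z.2) := rfl

variable {E : Type*} [NormedAddCommGroup E] [NormedSpace ℝ E]

/-- The differential of `F` split into its horizontal and its vertical part. -/
noncomputable def splitDeriv (h : V → V →L[ℝ] V →L[ℝ] ℝ) (F : E → V × V) (w : E) :
    E →L[ℝ] V × V :=
  ((ContinuousLinearMap.fst ℝ V V).comp (fderiv ℝ F w)).prod
    ((connectionMap h (F w)).comp (fderiv ℝ F w))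

theorem splitDeriv_apply (h : V → V →L[ℝ] V →L[ℝ] ℝ) (F : E → V × V) (w X : E) :
    splitDeriv h F w X = ((fderiv ℝ F w X).1,
      (fderiv ℝ F w X).2 + christoffel h (F w).1 (fderiv ℝ F w X).1 (F w).2) := by
  simp [splitDeriv, connectionMap]

theorem pullback_sasakiMetric (h : V → V →L[ℝ] V →L[ℝ] ℝ) (F : E → V × V) :
    pullback (sasakiMetric h) F = fun w =>
      (splitMetric h (F w).1).bilinearComp (splitDeriv h F w) (splitDeriv h F w) := by
  funext w
  ext X Y
  simp [pullback, sasakiMetric, splitDeriv]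

/-- `F` is an immersion of the open set `W` into the unit sphere bundle of the metric `h` on `U`. -/
structure IsUnitImmersion (h : V → V →L[ℝ] V →L[ℝ] ℝ) (U : Set V) (W : Set E) (F : E → V × V) :
    Prop where
  isOpen : IsOpen W
  smooth : ContDiffOn ℝ ∞ F W
  mem : ∀ w ∈ W, (F w).1 ∈ U
  unit : ∀ w ∈ W, h (F w).1 (F w).2 (F w).2 = 1
  immersion : ∀ w ∈ W, Function.Injective (fderiv ℝ F w)

namespace IsUnitImmersion

variable {h : V → V →L[ℝ] V →L[ℝ] ℝ} {U : Set V} {W : Set E} {F : E → V × V} {w : E}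

theorem eventually_mem (P : IsUnitImmersion h U W F) (hw : w ∈ W) (X : E) :
    ∀ᶠ t : ℝ in 𝓝 0, w + t • X ∈ W := by
  have : Tendsto (fun t : ℝ => w + t • X) (𝓝 0) (𝓝 w) := by
    have : Continuous fun t : ℝ => w + t • X := by fun_prop
    simpa using this.tendsto 0
  exact this (P.isOpen.mem_nhds hw)

theorem injective_splitDeriv (P : IsUnitImmersion h U W F) (hw : w ∈ W) :
    Function.Injective (splitDeriv h F w) := by
  intro X Y hXY
  apply P.immersion w hw
  simp only [splitDeriv_apply, Prod.mk.injEq] at hXY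
  refine Prod.ext hXY.1 ?_
  have := hXY.2
  rw [hXY.1] at this
  exact add_right_cancel this

theorem hasDerivAt (P : IsUnitImmersion h U W F) (hw : w ∈ W) (X : E) :
    HasDerivAt (fun t : ℝ => F (w + t • X)) (fderiv ℝ F w X) 0 :=
  (P.smooth.differentiableAt_of_isOpen P.isOpen hw).hasDerivAt_line X

theorem hasDerivAt_comp_fst (P : IsUnitImmersion h U W F) (hU : IsOpen U) (hw : w ∈ W) {G : Type*}
    [NormedAddCommGroup G] [NormedSpace ℝ G] {f : V → G} (hf : ContDiffOn ℝ ∞ f U) (X : E) :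
    HasDerivAt (fun t : ℝ => f (F (w + t • X)).1) (fderiv ℝ f (F w).1 (fderiv ℝ F w X).1) 0 := by
  have h1 := (hf.differentiableAt_of_isOpen hU (P.mem w hw)).hasFDerivAt
  exact h1.comp_hasDerivAt_of_eq 0 (P.hasDerivAt hw X).comp_fst (by simp)

theorem contDiffOn_comp_fst (P : IsUnitImmersion h U W F) {G : Type*}
    [NormedAddCommGroup G] [NormedSpace ℝ G] {f : V → G} (hf : ContDiffOn ℝ ∞ f U) :
    ContDiffOn ℝ ∞ (fun w => f (F w).1) W :=
  hf.comp P.smooth.fst P.mem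

/-- Differentiate h(u, u) = 1: the vertical part of dF is the covariant derivative of u. This makes
(0, u) a normal vector. -/
theorem metric_snd_eq_zero (P : IsUnitImmersion h U W F) (H : IsMetricOn h U)
    [FiniteDimensional ℝ V] (hw : w ∈ W) (X : E) :
    h (F w).1 (splitDeriv h F w X).2 (F w).2 = 0 := by
  have dh := P.hasDerivAt_comp_fst H.isOpen hw H.smooth X
  have dF := (P.hasDerivAt hw X).comp_snd
  have h1 := (dh.clm_apply dF).clm_apply dF
  have h2 := (hasDerivAt_const (0 : ℝ) (1 : ℝ)).congr_of_eventuallyEq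
    ((P.eventually_mem hw X).mono fun t ht => P.unit _ ht)
  have h3 := h1.unique h2
  have hx := P.mem w hw
  simp only [zero_smul, add_zero, add_apply, H.fderiv_eq hx,
    H.symm _ hx (F w).2] at h3
  rw [splitDeriv_apply, map_add, add_apply]
  linarith

theorem contDiffOn_splitDeriv [FiniteDimensional ℝ E] [FiniteDimensional ℝ V]
    (P : IsUnitImmersion h U W F)
    (H : IsMetricOn h U) : ContDiffOn ℝ ∞ (splitDeriv h F) W := by
  refine contDiffOn_clm_apply.2 fun X => ?_
  simp only [splitDeriv_apply]
  have h1 : ContDiffOn ℝ ∞ (fun w => fderiv ℝ F w X) W :=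
    (P.smooth.fderiv_infty P.isOpen).clm_apply contDiffOn_const
  exact h1.fst.prodMk (h1.snd.add
    (((P.contDiffOn_comp_fst H.christoffel_smooth).clm_apply h1.fst).clm_apply P.smooth.snd))

theorem fderiv_splitDeriv [FiniteDimensional ℝ E] [FiniteDimensional ℝ V]
    (P : IsUnitImmersion h U W F)
    (H : IsMetricOn h U) (hw : w ∈ W) (X Y : E) :
    fderiv ℝ (splitDeriv h F) w X Y = ((fderiv ℝ (fderiv ℝ F) w X Y).1,
      (fderiv ℝ (fderiv ℝ F) w X Y).2 +
        (fderiv ℝ (christoffel h) (F w).1 (fderiv ℝ F w X).1 (fderiv ℝ F w Y).1 (F w).2 +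
        christoffel h (F w).1 (fderiv ℝ (fderiv ℝ F) w X Y).1 (F w).2 +
        christoffel h (F w).1 (fderiv ℝ F w Y).1 (fderiv ℝ F w X).2)) := by
  have d1 := ((P.contDiffOn_splitDeriv H).differentiableAt_of_isOpen
    P.isOpen hw).hasDerivAt_line X
  have dG := P.hasDerivAt_comp_fst H.isOpen hw H.christoffel_smooth X
  have dF := P.hasDerivAt hw X
  have ddF := ((P.smooth.fderiv_infty P.isOpen).differentiableAt_of_isOpen
    P.isOpen hw).hasDerivAt_line X
  have cY := hasDerivAt_const (0 : ℝ) Y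
  have h1 := d1.clm_apply cY
  simp only [splitDeriv_apply] at h1
  have dd := ddF.clm_apply cY
  have h2 := HasDerivAt.prodMk dd.comp_fst
    (dd.comp_snd.fun_add ((dG.clm_apply dd.comp_fst).clm_apply dF.comp_snd))
  have h3 := h1.unique h2
  simp only [zero_smul, add_zero, map_zero, Prod.fst_zero, Prod.snd_zero, zero_apply] at h3
  exact (add_zero _).symm.trans h3

/-- The connection form on the pull-back along `F` of the sum of the horizontal and the vertical
bundle. -/
noncomputable def _root_.LocalGeometry.pullbackForm [FiniteDimensional ℝ V]
    (h : V → V →L[ℝ] V →L[ℝ] ℝ) (F : E → V × V) (w : E) : E →L[ℝ] V × V →L[ℝ] V × V :=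
  (sasakiForm h (F w)).comp (splitDeriv h F w)

theorem _root_.LocalGeometry.pullbackForm_apply [FiniteDimensional ℝ V]
    (h : V → V →L[ℝ] V →L[ℝ] ℝ) (F : E → V × V) (w X : E) (s : V × V) :
    pullbackForm h F w X s = sasakiForm h (F w) (splitDeriv h F w X) s := rfl

theorem contDiffOn_pullbackForm [FiniteDimensional ℝ E] [FiniteDimensional ℝ V]
    (P : IsUnitImmersion h U W F)
    (H : IsMetricOn h U) : ContDiffOn ℝ ∞ (pullbackForm h F) W := by
  refine contDiffOn_clm_apply.2 fun X => contDiffOn_clm_apply.2 fun s => ?_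
  simp only [pullbackForm_apply, sasakiForm_apply]
  have hΦ : ContDiffOn ℝ ∞ (fun w => splitDeriv h F w X) W :=
    (P.contDiffOn_splitDeriv H).clm_apply contDiffOn_const
  have hG := P.contDiffOn_comp_fst H.christoffel_smooth
  have hR := P.contDiffOn_comp_fst H.curvatureL_smooth
  have hu := P.smooth.snd
  have c : ∀ W' : V, ContDiffOn ℝ ∞ (fun _ : E => W') W := fun W' => contDiffOn_const
  exact ((((hG.clm_apply hΦ.fst).clm_apply (c _)).add
    ((((hR.clm_apply hu).clm_apply (c _)).clm_apply hΦ.fst).const_smul _)).add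
    ((((hR.clm_apply hu).clm_apply hΦ.snd).clm_apply (c _)).const_smul _)).prodMk
    (((hG.clm_apply hΦ.fst).clm_apply (c _)).sub
    ((((hR.clm_apply hΦ.fst).clm_apply (c _)).clm_apply hu).const_smul _))

/-- The vertical part of dF(Y) is ∇_Y u, so the left side is the commutator of covariant derivatives
applied to u. It measures the torsion of the naive connection Γ ⊕ Γ, which the term -R(p, s)u/2 in
`sasakiForm` removes. -/
theorem covDeriv_snd [FiniteDimensional ℝ E] [FiniteDimensional ℝ V] (P : IsUnitImmersion h U W F)
    (H : IsMetricOn h U) (hw : w ∈ W) (X Y : E) :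
    (fderiv ℝ (splitDeriv h F) w X Y).2 - (fderiv ℝ (splitDeriv h F) w Y X).2 +
      christoffel h (F w).1 (splitDeriv h F w X).1 (splitDeriv h F w Y).2 -
      christoffel h (F w).1 (splitDeriv h F w Y).1 (splitDeriv h F w X).2 =
    curvatureL h (F w).1 (splitDeriv h F w X).1 (splitDeriv h F w Y).1 (F w).2 := by
  simp only [P.fderiv_splitDeriv H hw, P.smooth.fderiv_fderiv_comm P.isOpen hw Y X,
    splitDeriv_apply, curvatureL_apply, curvature, map_add]
  abel

theorem isMetricConnection [FiniteDimensional ℝ E] [FiniteDimensional ℝ V]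
    (P : IsUnitImmersion h U W F) (H : IsMetricOn h U) :
    IsMetricConnection (fun w => splitMetric h (F w).1) (pullbackForm h F) (splitDeriv h F) W where
  isOpen := P.isOpen
  smooth_metric := by
    refine contDiffOn_clm_apply.2 fun s => contDiffOn_clm_apply.2 fun t => ?_
    simp only [splitMetric_apply]
    have := P.contDiffOn_comp_fst H.smooth
    exact ((this.clm_apply contDiffOn_const).clm_apply contDiffOn_const).add
      ((this.clm_apply contDiffOn_const).clm_apply contDiffOn_const)
  smooth_form := P.contDiffOn_pullbackForm H
  smooth_map := P.contDiffOn_splitDeriv H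
  symm w hw s t := by
    simp only [splitMetric_apply, H.symm _ (P.mem w hw) s.1, H.symm _ (P.mem w hw) s.2]
  metric w hw X s t := by
    have hx := P.mem w hw
    have hsm : ContDiffOn ℝ ∞ (fun w => splitMetric h (F w).1) W := by
      refine contDiffOn_clm_apply.2 fun s => contDiffOn_clm_apply.2 fun t => ?_
      simp only [splitMetric_apply]
      have := P.contDiffOn_comp_fst H.smooth
      exact ((this.clm_apply contDiffOn_const).clm_apply contDiffOn_const).add
        ((this.clm_apply contDiffOn_const).clm_apply contDiffOn_const)
    have d1 := (hsm.differentiableAt_of_isOpen P.isOpen hw).hasDerivAt_line X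
    have dh := P.hasDerivAt_comp_fst H.isOpen hw H.smooth X
    have c : ∀ s : V, HasDerivAt (fun _ : ℝ => s) 0 0 := fun s => hasDerivAt_const _ s
    have h1 := (d1.clm_apply (hasDerivAt_const _ s)).clm_apply (hasDerivAt_const _ t)
    simp only [splitMetric_apply] at h1
    have h2 := ((dh.clm_apply (c s.1)).clm_apply (c t.1)).fun_add
      ((dh.clm_apply (c s.2)).clm_apply (c t.2))
    have h3 := h1.unique h2
    simp only [zero_smul, add_zero, map_zero, H.fderiv_eq hx, Prod.fst_zero,
      Prod.snd_zero] at h3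
    have ha : (fderiv ℝ F w X).1 = (splitDeriv h F w X).1 := by rw [splitDeriv_apply]
    rw [h3, ha]
    simp only [splitMetric_apply, pullbackForm_apply, sasakiForm_apply, map_add, map_sub, add_apply,
      sub_apply, map_smul, smul_apply, smul_eq_mul, curvatureL_apply]
    linarith [H.curvature_pair_symm hx (F w).2 s.2 (splitDeriv h F w X).1 t.1,
      H.curvature_pair_symm hx (F w).2 t.2 (splitDeriv h F w X).1 s.1,
      H.curvature_skew_right hx (F w).2 (splitDeriv h F w X).2 s.1 t.1,
      H.symm _ hx s.1 (curvature h (F w).1 (F w).2 (splitDeriv h F w X).2 t.1),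
      H.symm _ hx s.1 (curvature h (F w).1 (F w).2 t.2 (splitDeriv h F w X).1),
      H.symm _ hx s.2 (curvature h (F w).1 (splitDeriv h F w X).1 t.1 (F w).2)]
  torsion w hw X Y := by
    have h1 := P.covDeriv_snd H hw X Y
    simp only [pullbackForm_apply, sasakiForm_apply]
    refine Prod.ext ?_ ?_
    · simp only [P.fderiv_splitDeriv H hw, P.smooth.fderiv_fderiv_comm P.isOpen hw Y X,
        Prod.fst_add, splitDeriv_apply, H.christoffel_symm (P.mem w hw) (fderiv ℝ F w Y).1]
      abel
    · rw [Prod.snd_add, Prod.snd_add]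
      have h2 : curvatureL h (F w).1 (splitDeriv h F w Y).1 (splitDeriv h F w X).1 (F w).2 =
        - curvatureL h (F w).1 (splitDeriv h F w X).1 (splitDeriv h F w Y).1 (F w).2 := by
        rw [curvatureL_apply, curvatureL_apply]
        exact IsMetricOn.curvature_skew_left _ _ _ _ _
      dsimp only
      rw [h2]
      linear_combination (norm := module) h1

end IsUnitImmersion

end LocalGeometry

/-! ### Second fundamental form and curvature of the Sasaki connection -/

open Filter Topology

namespace LocalGeometry

variable {V : Type*} [NormedAddCommGroup V] [NormedSpace ℝ V]
variable {E : Type*} [NormedAddCommGroup E] [NormedSpace ℝ E]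

/-- Product-rule bookkeeping, with `G₁`, `G₂`, `R₁`, `R₂` standing for derivatives of the
Christoffel symbols `G` and the curvature `R` in the directions `a`, `b`, and `m - G a u`, `n - G b
u` for the ordinary derivatives of `u`. The Christoffel terms either assemble to `R a b s` by `hR`
or complete derivatives of `R` to covariant ones; `hν` converts `q - q'`, the remaining second-order
data of the immersion. -/
theorem curvature_fst_aux (G G₁ G₂ : V →L[ℝ] V →L[ℝ] V) (R R₁ R₂ : V →L[ℝ] V →L[ℝ] V →L[ℝ] V)
    (a b m n u f q q' s t : V)
    (hR : R a b s = G₁ b s - G₂ a s + G a (G b s) - G b (G a s))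
    (hν : q - q' + G a n - G b m = R a b u) (hG : G a b = G b a) :
    G₁ b s + G f s + (1 / 2 : ℝ) • (R₁ u t b + R (m - G a u) t b + R u t f) +
          (1 / 2 : ℝ) • (R₁ u n s + R (m - G a u) n s + R u q s) -
        (G₂ a s + G f s + (1 / 2 : ℝ) • (R₂ u t a + R (n - G b u) t a + R u t f) +
          (1 / 2 : ℝ) • (R₂ u m s + R (n - G b u) m s + R u q' s)) +
        (G a (G b s + (1 / 2 : ℝ) • R u t b + (1 / 2 : ℝ) • R u n s) +
          (1 / 2 : ℝ) • R u (G b t - (1 / 2 : ℝ) • R b s u) a +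
          (1 / 2 : ℝ) • R u m (G b s + (1 / 2 : ℝ) • R u t b + (1 / 2 : ℝ) • R u n s)) -
        (G b (G a s + (1 / 2 : ℝ) • R u t a + (1 / 2 : ℝ) • R u m s) +
          (1 / 2 : ℝ) • R u (G a t - (1 / 2 : ℝ) • R a s u) b +
          (1 / 2 : ℝ) • R u n (G a s + (1 / 2 : ℝ) • R u t a + (1 / 2 : ℝ) • R u m s)) =
      R a b s + (1 / 2 : ℝ) • (R m t b - R n t a + R m n s - R n m s + R u (R a b u) s) +
        (1 / 2 : ℝ) • (R₁ u t b + G a (R u t b) - R (G a u) t b - R u (G a t) b - R u t (G a b) +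
          (R₁ u n s + G a (R u n s) - R (G a u) n s - R u (G a n) s - R u n (G a s)) -
          (R₂ u t a + G b (R u t a) - R (G b u) t a - R u (G b t) a - R u t (G b a)) -
          (R₂ u m s + G b (R u m s) - R (G b u) m s - R u (G b m) s - R u m (G b s))) -
        (1 / 4 : ℝ) • (R u (R b s u) a - R u (R a s u) b) +
        (1 / 4 : ℝ) • (R u m (R u t b + R u n s) - R u n (R u t a + R u m s)) := by
  rw [← hν, hG]
  simp only [map_add, map_sub, add_apply, sub_apply, map_smul, smul_apply]
  linear_combination (norm := module) - hR

theorem curvature_snd_aux (G G₁ G₂ : V →L[ℝ] V →L[ℝ] V) (R R₁ R₂ : V →L[ℝ] V →L[ℝ] V →L[ℝ] V)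
    (a b m n u f s t : V)
    (hR : R a b t = G₁ b t - G₂ a t + G a (G b t) - G b (G a t)) (hG : G a b = G b a) :
    G₁ b t + G f t - (1 / 2 : ℝ) • (R₁ b s u + R f s u + R b s (m - G a u)) -
        (G₂ a t + G f t - (1 / 2 : ℝ) • (R₂ a s u + R f s u + R a s (n - G b u))) +
        (G a (G b t - (1 / 2 : ℝ) • R b s u) -
          (1 / 2 : ℝ) • R a (G b s + (1 / 2 : ℝ) • R u t b + (1 / 2 : ℝ) • R u n s) u) -
        (G b (G a t - (1 / 2 : ℝ) • R a s u) -
          (1 / 2 : ℝ) • R b (G a s + (1 / 2 : ℝ) • R u t a + (1 / 2 : ℝ) • R u m s) u) =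
      R a b t - (1 / 2 : ℝ) • (R b s m - R a s n) -
        (1 / 2 : ℝ) • (R₁ b s u + G a (R b s u) - R (G a b) s u - R b (G a s) u - R b s (G a u) -
          (R₂ a s u + G b (R a s u) - R (G b a) s u - R a (G b s) u - R a s (G b u))) -
        (1 / 4 : ℝ) • (R a (R u t b + R u n s) u - R b (R u t a + R u m s) u) := by
  rw [hG]
  simp only [map_add, map_sub, add_apply, map_smul, smul_apply]
  linear_combination (norm := module) - hR

namespace IsUnitImmersion

variable {h : V → V →L[ℝ] V →L[ℝ] ℝ} {U : Set V} {W : Set E} {F : E → V × V} {w : E}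
  [FiniteDimensional ℝ E] [FiniteDimensional ℝ V]

/-- Differentiate h(∇_Y u, u) = 0 along `X`. The curvature term of the connection does not
contribute, because R(p, q)u ⊥ u. -/
theorem secondFundamentalForm (P : IsUnitImmersion h U W F) (H : IsMetricOn h U) (hw : w ∈ W)
    (X Y : E) :
    splitMetric h (F w).1 (covDeriv (pullbackForm h F) (splitDeriv h F) w X Y) (0, (F w).2) =
      - h (F w).1 (splitDeriv h F w X).2 (splitDeriv h F w Y).2 := by
  have hx := P.mem w hw
  have dh := P.hasDerivAt_comp_fst H.isOpen hw H.smooth X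
  have dF := (P.hasDerivAt hw X).comp_snd
  have dΦ := ((P.contDiffOn_splitDeriv H).differentiableAt_of_isOpen
    P.isOpen hw).hasDerivAt_line X
  have dY := (dΦ.clm_apply (hasDerivAt_const _ Y)).comp_snd
  have h1 := (dh.clm_apply dY).clm_apply dF
  have h2 := (hasDerivAt_const (0 : ℝ) (0 : ℝ)).congr_of_eventuallyEq
    ((P.eventually_mem hw X).mono fun t ht => P.metric_snd_eq_zero H ht Y)
  have h3 := h1.unique h2
  simp only [zero_smul, add_zero, map_zero, add_apply, H.fderiv_eq hx] at h3
  have h4 : (fderiv ℝ F w X).2 = (splitDeriv h F w X).2 -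
      christoffel h (F w).1 (splitDeriv h F w X).1 (F w).2 := by
    
    rw [splitDeriv_apply]; exact (add_sub_cancel_right _ _).symm
  have h5 : (fderiv ℝ F w X).1 = (splitDeriv h F w X).1 := by rw [splitDeriv_apply]
  have h6 := H.curvature_skew_right hx (splitDeriv h F w X).1 (splitDeriv h F w Y).1 (F w).2 (F w).2
  rw [h4, h5] at h3
  simp only [covDeriv, pullbackForm_apply, sasakiForm_apply, splitMetric_apply, 
    map_zero, zero_add, map_add, add_apply, map_sub, sub_apply, map_smul, smul_apply,
    curvatureL_apply, smul_eq_mul] at h3 ⊢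
  rw [H.symm _ hx (splitDeriv h F w X).2]
  linarith

theorem fderiv_pullbackForm (P : IsUnitImmersion h U W F) (H : IsMetricOn h U) (hw : w ∈ W)
    (X Y : E) (s : V × V) :
    fderiv ℝ (pullbackForm h F) w X Y s =
      let x := (F w).1
      let u := (F w).2
      let a := (fderiv ℝ F w X).1
      let u' := (fderiv ℝ F w X).2
      let Φ := splitDeriv h F w Y
      let Φ' := fderiv ℝ (splitDeriv h F) w X Y
      let Γ' := fderiv ℝ (christoffel h) x a
      let R := curvatureL h x
      let R' := fderiv ℝ (curvatureL h) x a
      (Γ' Φ.1 s.1 + christoffel h x Φ'.1 s.1 +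
          (1 / 2 : ℝ) • (R' u s.2 Φ.1 + R u' s.2 Φ.1 + R u s.2 Φ'.1) +
          (1 / 2 : ℝ) • (R' u Φ.2 s.1 + R u' Φ.2 s.1 + R u Φ'.2 s.1),
        Γ' Φ.1 s.2 + christoffel h x Φ'.1 s.2 -
          (1 / 2 : ℝ) • (R' Φ.1 s.1 u + R Φ'.1 s.1 u + R Φ.1 s.1 u')) := by
  have dG := P.hasDerivAt_comp_fst H.isOpen hw H.christoffel_smooth X
  have dR := P.hasDerivAt_comp_fst H.isOpen hw H.curvatureL_smooth X
  have du := (P.hasDerivAt hw X).comp_snd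
  have dΦ := (((P.contDiffOn_splitDeriv H).differentiableAt_of_isOpen
    P.isOpen hw).hasDerivAt_line X).clm_apply (hasDerivAt_const _ Y)
  have dθ := (((P.contDiffOn_pullbackForm H).differentiableAt_of_isOpen
    P.isOpen hw).hasDerivAt_line X)
  have h1 := (dθ.clm_apply (hasDerivAt_const _ Y)).clm_apply (hasDerivAt_const _ s)
  simp only [pullbackForm_apply, sasakiForm_apply] at h1
  have c : ∀ s : V, HasDerivAt (fun _ : ℝ => s) 0 0 := fun s => hasDerivAt_const _ s
  have h2 := HasDerivAt.prodMk
    ((((dG.clm_apply dΦ.comp_fst).clm_apply (c s.1)).fun_add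
      ((((dR.clm_apply du).clm_apply (c s.2)).clm_apply dΦ.comp_fst).fun_const_smul (1 / 2 : ℝ))).fun_add
      ((((dR.clm_apply du).clm_apply dΦ.comp_snd).clm_apply (c s.1)).fun_const_smul (1 / 2 : ℝ)))
    (((dG.clm_apply dΦ.comp_fst).clm_apply (c s.2)).fun_sub
      ((((dR.clm_apply dΦ.comp_fst).clm_apply (c s.1)).clm_apply du).fun_const_smul (1 / 2 : ℝ)))
  have h3 := h1.unique h2
  simp only [zero_smul, add_zero, map_zero, Prod.fst_zero, Prod.snd_zero, zero_apply, smul_zero,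
    sub_zero, add_apply] at h3
  refine (add_zero _).symm.trans (h3.trans ?_)
  rfl

/-- The curvature of the Sasaki connection along `F`, horizontal part. -/
theorem connectionCurvature_fst (P : IsUnitImmersion h U W F) (H : IsMetricOn h U) (hw : w ∈ W)
    (X Y : E) (s : V × V) :
    (connectionCurvature (pullbackForm h F) w X Y s).1 =
      let x := (F w).1
      let u := (F w).2
      let p := splitDeriv h F w X
      let q := splitDeriv h F w Y
      let R := curvatureL h x
      let D := covDerivCurvature h x
      R p.1 q.1 s.1 + (1 / 2 : ℝ) • (R p.2 s.2 q.1 - R q.2 s.2 p.1 + R p.2 q.2 s.1 -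
          R q.2 p.2 s.1 + R u (R p.1 q.1 u) s.1) +
        (1 / 2 : ℝ) • (D p.1 u s.2 q.1 + D p.1 u q.2 s.1 - D q.1 u s.2 p.1 - D q.1 u p.2 s.1) -
        (1 / 4 : ℝ) • (R u (R q.1 s.1 u) p.1 - R u (R p.1 s.1 u) q.1) +
        (1 / 4 : ℝ) • (R u p.2 (R u s.2 q.1 + R u q.2 s.1) -
          R u q.2 (R u s.2 p.1 + R u p.2 s.1)) := by
  have hν := P.covDeriv_snd H hw X Y
  have hf : (fderiv ℝ (splitDeriv h F) w X Y).1 = (fderiv ℝ (splitDeriv h F) w Y X).1 := by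
    simp only [P.fderiv_splitDeriv H hw, P.smooth.fderiv_fderiv_comm P.isOpen hw Y X]
  have hu : ∀ X, (fderiv ℝ F w X).2 = (splitDeriv h F w X).2 -
      christoffel h (F w).1 (splitDeriv h F w X).1 (F w).2 := fun X => by
    
    rw [splitDeriv_apply]; exact (add_sub_cancel_right _ _).symm
  have ha : ∀ X, (fderiv ℝ F w X).1 = (splitDeriv h F w X).1 := fun X => by rw [splitDeriv_apply]
  have hR : curvatureL h (F w).1 (splitDeriv h F w X).1 (splitDeriv h F w Y).1 s.1 = _ :=
    curvatureL_apply _ _ _ _ _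
  rw [curvature] at hR
  simp only [connectionCurvature, P.fderiv_pullbackForm H hw, pullbackForm_apply, sasakiForm_apply,
    covDerivCurvature, Prod.fst_sub, Prod.fst_add, hu, ha, hf]
  generalize fderiv ℝ (splitDeriv h F) w X Y = Φ' at *
  generalize fderiv ℝ (splitDeriv h F) w Y X = Ψ' at *
  exact curvature_fst_aux _ _ _ _ _ _ _ _ _ _ _ _ _ _ _ _ hR hν
    (H.christoffel_symm (P.mem w hw) _ _)

/-- The curvature of the Sasaki connection along `F`, vertical part. -/
theorem connectionCurvature_snd (P : IsUnitImmersion h U W F) (H : IsMetricOn h U) (hw : w ∈ W)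
    (X Y : E) (s : V × V) :
    (connectionCurvature (pullbackForm h F) w X Y s).2 =
      let x := (F w).1
      let u := (F w).2
      let p := splitDeriv h F w X
      let q := splitDeriv h F w Y
      let R := curvatureL h x
      let D := covDerivCurvature h x
      R p.1 q.1 s.2 - (1 / 2 : ℝ) • (R q.1 s.1 p.2 - R p.1 s.1 q.2) -
        (1 / 2 : ℝ) • (D p.1 q.1 s.1 u - D q.1 p.1 s.1 u) -
        (1 / 4 : ℝ) • (R p.1 (R u s.2 q.1 + R u q.2 s.1) u -
          R q.1 (R u s.2 p.1 + R u p.2 s.1) u) := by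
  have hf : (fderiv ℝ (splitDeriv h F) w X Y).1 = (fderiv ℝ (splitDeriv h F) w Y X).1 := by
    simp only [P.fderiv_splitDeriv H hw, P.smooth.fderiv_fderiv_comm P.isOpen hw Y X]
  have hu : ∀ X, (fderiv ℝ F w X).2 = (splitDeriv h F w X).2 -
      christoffel h (F w).1 (splitDeriv h F w X).1 (F w).2 := fun X => by
    
    rw [splitDeriv_apply]; exact (add_sub_cancel_right _ _).symm
  have ha : ∀ X, (fderiv ℝ F w X).1 = (splitDeriv h F w X).1 := fun X => by rw [splitDeriv_apply]
  have hR : curvatureL h (F w).1 (splitDeriv h F w X).1 (splitDeriv h F w Y).1 s.2 = _ :=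
    curvatureL_apply _ _ _ _ _
  rw [curvature] at hR
  have hG := H.christoffel_symm (P.mem w hw) (splitDeriv h F w X).1 (splitDeriv h F w Y).1
  simp only [connectionCurvature, P.fderiv_pullbackForm H hw, pullbackForm_apply, sasakiForm_apply,
    covDerivCurvature, Prod.snd_sub, Prod.snd_add, hu, ha, hf]
  generalize fderiv ℝ (splitDeriv h F) w X Y = Φ' at *
  generalize fderiv ℝ (splitDeriv h F) w Y X = Ψ' at *
  exact curvature_snd_aux _ _ _ _ _ _ _ _ _ _ _ _ _ _ hR hG

end IsUnitImmersion

end LocalGeometry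

/-! ### Orthonormal frames and the Ricci tensor of the unit tangent bundle -/

open Filter Topology

/-- The form `g` itself is made the inner product of `V`, so that extension of orthonormal families
applies; `V` carries no norm in the hypotheses, so none competes with it. -/
theorem exists_orthonormal_frame {V : Type*} [AddCommGroup V] [Module ℝ V] [FiniteDimensional ℝ V]
    (g : V →ₗ[ℝ] V →ₗ[ℝ] ℝ) (hs : ∀ X Y, g X Y = g Y X) (hp : ∀ X, X ≠ 0 → 0 < g X X) {n : ℕ}
    (hn : Module.finrank ℝ V = n + 1) {u : V} (hu : g u u = 1) :
    ∃ e : Fin (n + 1) → V, e 0 = u ∧ ∀ i j, g (e i) (e j) = if i = j then 1 else 0 := by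
  let core : InnerProductSpace.Core ℝ V :=
    { inner := fun X Y => g X Y
      conj_inner_symm := fun X Y => by simpa using hs Y X
      re_inner_nonneg := fun X => by
        by_cases hX : X = 0
        · simp [hX]
        · simpa using (hp X hX).le
      definite := fun X hX => by
        by_contra h0
        exact (hp X h0).ne' hX
      add_left := fun X Y Z => by simp
      smul_left := fun X Y c => by simp }
  let _ : NormedAddCommGroup V := core.toNormedAddCommGroup
  let _ : InnerProductSpace ℝ V := InnerProductSpace.ofCore core.toCore
  have hinner : ∀ X Y : V, inner ℝ X Y = g X Y := fun X Y => rfl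
  have hon : Orthonormal ℝ (Set.domRestrict {(0 : Fin (n + 1))} (fun _ => u)) := by
    rw [orthonormal_iff_ite]
    intro i j
    have : i = j := Subsingleton.elim _ _
    subst this
    simpa using (hinner u u).trans hu
  obtain ⟨b, hb⟩ := hon.exists_orthonormalBasis_extension_of_card_eq (by simp [hn])
  refine ⟨b, hb 0 rfl, fun i j => ?_⟩
  rw [← hinner]
  exact orthonormal_iff_ite.1 b.orthonormal i j

section Frame

variable {V : Type*} [NormedAddCommGroup V] [NormedSpace ℝ V] [FiniteDimensional ℝ V]
  {g : V →L[ℝ] V →L[ℝ] ℝ} {ι : Type*} [Fintype ι] [DecidableEq ι] {e : ι → V}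

theorem eq_sum_of_orthonormal_frame (he : ∀ i j, g (e i) (e j) = if i = j then 1 else 0)
    (hc : Module.finrank ℝ V = Fintype.card ι) :
    ∃ b : Module.Basis ι ℝ V, (∀ i, b i = e i) ∧ ∀ v i, b.repr v i = g v (e i) := by
  have key : ∀ (c : ι → ℝ) (i : ι), g (∑ j, c j • e j) (e i) = c i := fun c i => by
    simp [he]
  have hli : LinearIndependent ℝ e := by
    rw [Fintype.linearIndependent_iff]
    intro c h0 i
    rw [← key c i, h0]
    simp
  refine ⟨basisOfLinearIndependentOfCardEqFinrank' e hli hc.symm, by simp, fun v i => ?_⟩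
  set b := basisOfLinearIndependentOfCardEqFinrank' e hli hc.symm
  conv_rhs => rw [← b.sum_repr v]
  rw [← key (b.repr v) i]
  simp [b]

theorem parseval_of_orthonormal_frame (he : ∀ i j, g (e i) (e j) = if i = j then 1 else 0)
    (hc : Module.finrank ℝ V = Fintype.card ι) (v w : V) :
    g v w = ∑ i, g v (e i) * g w (e i) := by
  obtain ⟨b, hb, hr⟩ := eq_sum_of_orthonormal_frame he hc
  conv_lhs => rw [← b.sum_repr w]
  simp [hb, hr, mul_comm]

theorem sum_of_orthonormal_frame (he : ∀ i j, g (e i) (e j) = if i = j then 1 else 0)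
    (hc : Module.finrank ℝ V = Fintype.card ι) (v : V) :
    ∑ i, g v (e i) • e i = v := by
  obtain ⟨b, hb, hr⟩ := eq_sum_of_orthonormal_frame he hc
  conv_rhs => rw [← b.sum_repr v]
  simp [hb, hr]

theorem trace_of_orthonormal_frame (he : ∀ i j, g (e i) (e j) = if i = j then 1 else 0)
    (hc : Module.finrank ℝ V = Fintype.card ι) (f : V →ₗ[ℝ] V) :
    LinearMap.trace ℝ V f = ∑ i, g (f (e i)) (e i) := by
  obtain ⟨b, hb, hr⟩ := eq_sum_of_orthonormal_frame he hc
  rw [LinearMap.trace_eq_matrix_trace ℝ b, Matrix.trace]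
  simp [LinearMap.toMatrix_apply, hb, hr]

end Frame

namespace LocalGeometry

variable {V : Type*} [NormedAddCommGroup V] [NormedSpace ℝ V] [FiniteDimensional ℝ V]
variable {E : Type*} [NormedAddCommGroup E] [NormedSpace ℝ E] [FiniteDimensional ℝ E]
variable {h : V → V →L[ℝ] V →L[ℝ] ℝ} {U : Set V} {x : V} {W : Set E} {F : E → V × V} {w : E}

theorem ricci_eq_sum {ι : Type*} [Fintype ι] [DecidableEq ι] {e : ι → V}
    (he : ∀ i j, h x (e i) (e j) = if i = j then 1 else 0)
    (hc : Module.finrank ℝ V = Fintype.card ι) (Y Z : V) :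
    ricci h x Y Z = ∑ i, h x (curvature h x (e i) Y Z) (e i) := by
  rw [ricci, trace_of_orthonormal_frame he hc]
  rfl

theorem IsMetricOn.exists_orthonormal (H : IsMetricOn h U) (hx : x ∈ U) {n : ℕ}
    (hn : Module.finrank ℝ V = n + 1) {u : V} (hu : h x u u = 1) :
    ∃ e : Fin (n + 1) → V, e 0 = u ∧ ∀ i j, h x (e i) (e j) = if i = j then 1 else 0 :=
  exists_orthonormal_frame ((ContinuousLinearMap.coeLM ℝ).comp (h x).toLinearMap)
    (H.symm x hx) (H.pos x hx) hn hu

namespace IsUnitImmersion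

omit [FiniteDimensional ℝ E] in
-- Dimension count: the image of the injective differential lies in the hyperplane orthogonal to the
-- normal (0, u), and both have dimension 2 dim V - 1.
theorem exists_splitDeriv_eq (P : IsUnitImmersion h U W F) (H : IsMetricOn h U) (hw : w ∈ W)
    (hd : Module.finrank ℝ E + 1 = 2 * Module.finrank ℝ V) {s : V × V}
    (hs : h (F w).1 s.2 (F w).2 = 0) : ∃ X, splitDeriv h F w X = s := by
  let L : V × V →ₗ[ℝ] ℝ := ((h (F w).1).flip (F w).2).toLinearMap ∘ₗ LinearMap.snd ℝ V V
  have hL : L ≠ 0 := fun h0 => by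
    have h1 := DFunLike.congr_fun h0 (0, (F w).2)
    simp [L, P.unit w hw] at h1
  have h1 := Module.Dual.finrank_ker_add_one_of_ne_zero (f := L) hL
  have h2 : LinearMap.range (splitDeriv h F w).toLinearMap ≤ LinearMap.ker L := by
    rintro _ ⟨X, rfl⟩
    simpa [L] using P.metric_snd_eq_zero H hw X
  have h3 : Module.finrank ℝ (LinearMap.range (splitDeriv h F w).toLinearMap) =
      Module.finrank ℝ E := LinearMap.finrank_range_of_inj (P.injective_splitDeriv hw)
  have h4 : LinearMap.range (splitDeriv h F w).toLinearMap = LinearMap.ker L := by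
    apply Submodule.eq_of_le_of_finrank_eq h2
    rw [Module.finrank_prod] at h1
    omega
  have h5 : s ∈ LinearMap.range (splitDeriv h F w).toLinearMap := by
    rw [h4]
    simpa [L] using hs
  exact h5

theorem isMetricOn_induced (P : IsUnitImmersion h U W F) (H : IsMetricOn h U) :
    IsMetricOn (fun w => (splitMetric h (F w).1).bilinearComp (splitDeriv h F w)
      (splitDeriv h F w)) W where
  isOpen := P.isOpen
  smooth := by
    refine contDiffOn_clm_apply.2 fun X => contDiffOn_clm_apply.2 fun Y => ?_
    simp only [ContinuousLinearMap.bilinearComp_apply]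
    have D := P.isMetricConnection H
    exact (D.smooth_metric.clm_apply (D.smooth_map.clm_apply contDiffOn_const)).clm_apply
      (D.smooth_map.clm_apply contDiffOn_const)
  symm w hw X Y := (P.isMetricConnection H).symm w hw _ _
  pos w hw X hX := by
    rw [ContinuousLinearMap.bilinearComp_apply, splitMetric_apply]
    have h0 : splitDeriv h F w X ≠ 0 := fun h0 =>
      hX (P.injective_splitDeriv hw (h0.trans (map_zero _).symm))
    have hnn : ∀ v, 0 ≤ h (F w).1 v v := fun v => by
      by_cases hv : v = 0
      · simp [hv]
      · exact (H.pos _ (P.mem w hw) v hv).le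
    by_cases h1 : (splitDeriv h F w X).1 = 0
    · have h2 : (splitDeriv h F w X).2 ≠ 0 := fun h2 => h0 (Prod.ext h1 h2)
      exact add_pos_of_nonneg_of_pos (hnn _) (H.pos _ (P.mem w hw) _ h2)
    · exact add_pos_of_pos_of_nonneg (H.pos _ (P.mem w hw) _ h1) (hnn _)

theorem ricci_contactMetric (P : IsUnitImmersion h U W F) (H : IsMetricOn h U) (hw : w ∈ W)
    (Y Z : E) :
    ricci (pullback (contactMetric h) F) w Y Z =
      ricci (fun w => (splitMetric h (F w).1).bilinearComp (splitDeriv h F w)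
        (splitDeriv h F w)) w Y Z := by
  have h1 : pullback (contactMetric h) F = fun w => (1 / 4 : ℝ) •
      (splitMetric h (F w).1).bilinearComp (splitDeriv h F w) (splitDeriv h F w) := by
    funext w
    rw [← congrFun (pullback_sasakiMetric h F) w]
    ext X Y
    simp [pullback, contactMetric]
  rw [h1]
  exact (P.isMetricOn_induced H).ricci_const_smul (by norm_num) hw Y Z

/-- The Ricci tensor of the unit tangent bundle. -/
theorem ricci_eq (P : IsUnitImmersion h U W F) (H : IsMetricOn h U) (hw : w ∈ W) {n : ℕ}
    (hV : Module.finrank ℝ V = n + 1) (hE : Module.finrank ℝ E = 2 * n + 1)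
    {e : Fin (n + 1) → V} (he0 : e 0 = (F w).2)
    (he : ∀ i j, h (F w).1 (e i) (e j) = if i = j then 1 else 0) (Y Z : E) :
    ricci (pullback (contactMetric h) F) w Y Z =
      let x := (F w).1
      let u := (F w).2
      let p := splitDeriv h F w Y
      let q := splitDeriv h F w Z
      let R := curvature h x
      let D := covDerivCurvature h x
      ricci h x p.1 q.1 + (n - 1) * h x p.2 q.2 +
        (1 / 4) * ∑ i, h x (R u p.2 (e i)) (R u q.2 (e i)) -
        (1 / 2) * ∑ i, h x (R u (e i) p.1) (R u (e i) q.1) +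
        (1 / 2) * ∑ i, h x (D (e i) u q.2 p.1 + D (e i) u p.2 q.1 - D p.1 u q.2 (e i)) (e i) := by
  have hx := P.mem w hw
  have hcV : Module.finrank ℝ V = Fintype.card (Fin (n + 1)) := by simp [hV]
  have hd : Module.finrank ℝ E + 1 = 2 * Module.finrank ℝ V := by omega
  -- An orthonormal frame of the hypersurface: horizontal lifts of all eᵢ and vertical lifts of all
  -- except e₀ = u, which is normal.
  have hsurj : ∀ i : Fin (n + 1) ⊕ Fin n, ∃ X, splitDeriv h F w X =
      Sum.elim (fun i => (e i, 0)) (fun j => (0, e j.succ)) i := by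
    rintro (i | j)
    · exact P.exists_splitDeriv_eq H hw hd (by simp)
    · refine P.exists_splitDeriv_eq H hw hd ?_
      simp [← he0, he, Fin.succ_ne_zero]
  choose b hb using hsurj
  have hbG : ∀ i j, (splitMetric h (F w).1).bilinearComp (splitDeriv h F w) (splitDeriv h F w)
      (b i) (b j) = if i = j then 1 else 0 := by
    rintro (i | i) (j | j) <;> simp [hb, he]
  rw [P.ricci_contactMetric H hw, ricci_eq_sum (h := fun w =>
    (splitMetric h (F w).1).bilinearComp (splitDeriv h F w) (splitDeriv h F w)) hbG
    (by simp [hE]; ring)]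
  have hgauss := fun X => (P.isMetricConnection H).gauss_equation (P.isMetricOn_induced H) hw
    (n := (0, (F w).2)) (by simp [P.unit w hw]) (by simp [P.metric_snd_eq_zero H hw])
    (fun s hs => P.exists_splitDeriv_eq H hw hd (by simpa using hs)) X Y Z X
  simp only [ContinuousLinearMap.bilinearComp_apply, hgauss]
  simp only [P.secondFundamentalForm H hw,
    Fintype.sum_sum_type, splitMetric_apply, P.connectionCurvature_fst H hw,
    P.connectionCurvature_snd H hw, hb, Sum.elim_inl, Sum.elim_inr, map_zero, zero_apply,
    mul_zero, neg_zero, add_zero, zero_add, sub_zero]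
  have hp := P.metric_snd_eq_zero H hw Y
  have hq := P.metric_snd_eq_zero H hw Z
  rw [ricci_eq_sum he hcV]
  simp only [← curvatureL_apply]
  have sk : ∀ X Y Z T, h (F w).1 (curvatureL h (F w).1 X Y Z) T =
      - h (F w).1 (curvatureL h (F w).1 X Y T) Z := fun X Y Z T => by
    simpa only [curvatureL_apply] using H.curvature_skew_right hx X Y Z T
  have pr : ∀ X Y Z T, h (F w).1 (curvatureL h (F w).1 X Y Z) T =
      h (F w).1 (curvatureL h (F w).1 Z T X) Y := fun X Y Z T => by
    simpa only [curvatureL_apply] using H.curvature_pair_symm hx X Y Z T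
  have al : ∀ X Y Z, curvatureL h (F w).1 X Y Z = - curvatureL h (F w).1 Y X Z :=
    fun X Y Z => by
      simpa only [curvatureL_apply] using IsMetricOn.curvature_skew_left h (F w).1 X Y Z
  have sk0 : ∀ X Y Z, h (F w).1 (curvatureL h (F w).1 X Y Z) Z = 0 := fun X Y Z => by
    linarith [sk X Y Z Z]
  have hD0 : ∀ X Y Z, covDerivCurvature h (F w).1 0 X Y Z = 0 := fun X Y Z => by
    simp [covDerivCurvature]
  have hD1 : ∀ X Y Z, covDerivCurvature h (F w).1 X Y 0 Z = 0 := fun X Y Z => by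
    simp [covDerivCurvature]
  have hD2 : ∀ X Y Z, covDerivCurvature h (F w).1 X 0 Y Z = 0 := fun X Y Z => by
    simp [covDerivCurvature]
  generalize splitDeriv h F w Y = p at *
  generalize splitDeriv h F w Z = q at *
  generalize (F w).2 = u at *
  generalize (F w).1 = x at *
  simp only [hD0, hD1, hD2, sub_zero, zero_sub, smul_zero]
  have sy : ∀ X Y, h x X Y = h x Y X := H.symm x hx
  have hinl : ∀ v, h x (curvatureL h x u (curvatureL h x v p.1 u) q.1) v =
      - h x (curvatureL h x v p.1 u) (curvatureL h x v q.1 u) ∧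
      h x (curvatureL h x u (curvatureL h x v q.1 u) p.1) v =
      - h x (curvatureL h x v p.1 u) (curvatureL h x v q.1 u) ∧
      h x (curvatureL h x u p.2 (curvatureL h x u q.2 v)) v =
      - h x (curvatureL h x u p.2 v) (curvatureL h x u q.2 v) := fun v => by
    refine ⟨?_, ?_, sk _ _ _ _⟩
    · rw [pr, al q.1 v, sy]
      simp
    · rw [pr, al p.1 v]
      simp
  have hinr : ∀ v, h x (curvatureL h x p.1 (curvatureL h x u v q.1) u) v =
      h x (curvatureL h x u v p.1) (curvatureL h x u v q.1) := fun v => pr _ _ _ _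
  -- Both sides are expanded by Parseval into double sums of components; after exchanging the
  -- summations, pair symmetry matches them term by term. With this identity the horizontal frame
  -- contributes -3/4 and the vertical frame +1/4 of the same sum, hence the coefficient -1/2.
  have hJ : ∑ i, h x (curvatureL h x (e i) p.1 u) (curvatureL h x (e i) q.1 u) =
      ∑ i, h x (curvatureL h x u (e i) p.1) (curvatureL h x u (e i) q.1) := by
    rw [Finset.sum_congr rfl fun i _ => parseval_of_orthonormal_frame he hcV
        (curvatureL h x (e i) p.1 u) (curvatureL h x (e i) q.1 u),
      Finset.sum_congr rfl fun i _ => parseval_of_orthonormal_frame he hcV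
        (curvatureL h x u (e i) p.1) (curvatureL h x u (e i) q.1), Finset.sum_comm]
    refine Finset.sum_congr rfl fun i _ => Finset.sum_congr rfl fun j _ => ?_
    rw [pr (e j), pr (e j), sk u (e i) p.1, sk u (e i) q.1]
    ring
  -- The missing index 0 costs nothing here, as R(u, u) = 0; in `hS` it costs nothing because `p.2`
  -- is orthogonal to u.
  have hK : ∑ j : Fin n, h x (curvatureL h x u (e j.succ) p.1) (curvatureL h x u (e j.succ) q.1) =
      ∑ i, h x (curvatureL h x u (e i) p.1) (curvatureL h x u (e i) q.1) := by
    have h0 : ∀ Z, curvatureL h x u u Z = 0 := fun Z => by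
      rw [curvatureL_apply, curvature]; abel
    rw [Fin.sum_univ_succ, he0, h0]
    simp
  have hS : ∑ j : Fin n, h x p.2 (e j.succ) * h x q.2 (e j.succ) = h x p.2 q.2 := by
    rw [parseval_of_orthonormal_frame he hcV p.2 q.2, Fin.sum_univ_succ, he0, hp]
    simp
  have hself : ∀ i, h x (e i) (e i) = 1 := fun i => by simp [he]
  simp only [map_add, map_sub, map_neg, map_smul, add_apply, sub_apply, neg_apply, smul_apply,
    smul_eq_mul, (hinl _).1, (hinl _).2.1, (hinl _).2.2, hinr, sk0, hself, sy (e (Fin.succ _)) q.2,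
    Finset.sum_add_distrib, Finset.sum_sub_distrib, ← Finset.mul_sum, Finset.sum_neg_distrib]
  simp only [neg_mul_neg, mul_comm (h x q.2 _), hS, hK, hJ, Finset.sum_const, Finset.card_univ,
    Fintype.card_fin, nsmul_eq_mul]
  ring

end IsUnitImmersion

end LocalGeometry

/-! ### Spaces of constant curvature -/

open Filter Topology

namespace LocalGeometry

variable {V : Type*} [NormedAddCommGroup V] [NormedSpace ℝ V]
variable {h : V → V →L[ℝ] V →L[ℝ] ℝ} {U : Set V} {x : V}

/-- An algebraic curvature tensor with vanishing sectional curvatures vanishes. -/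
theorem eq_zero_of_sectional_eq_zero {V : Type*} [AddCommGroup V] {S : V → V → V → V → ℝ}
    (add₁ : ∀ X X' Y Z T, S (X + X') Y Z T = S X Y Z T + S X' Y Z T)
    (skew : ∀ X Y Z T, S X Y Z T = - S Y X Z T) (skew' : ∀ X Y Z T, S X Y Z T = - S X Y T Z)
    (pair : ∀ X Y Z T, S X Y Z T = S Z T X Y)
    (bianchi : ∀ X Y Z T, S X Y Z T + S Y Z X T + S Z X Y T = 0)
    (sec : ∀ X Y, S X Y Y X = 0) (X Y Z T : V) : S X Y Z T = 0 := by
  have add₂ : ∀ X Y Y' Z T, S X (Y + Y') Z T = S X Y Z T + S X Y' Z T := fun X Y Y' Z T => by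
    rw [skew, add₁, skew X Y, skew X Y']; ring
  have add₃ : ∀ X Y Z Z' T, S X Y (Z + Z') T = S X Y Z T + S X Y Z' T := fun X Y Z Z' T => by
    rw [pair, add₁, pair X Y Z, pair X Y Z']
  have add₄ : ∀ X Y Z T T', S X Y Z (T + T') = S X Y Z T + S X Y Z T' := fun X Y Z T T' => by
    rw [pair, add₂, pair X Y Z, pair X Y Z]
  have h1 : ∀ X Y Z, S X Y Z X = 0 := fun X Y Z => by
    have e1 := sec X (Y + Z)
    rw [add₂, add₃, add₃, sec, sec] at e1
    have e2 : S X Z Y X = S X Y Z X := by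
      rw [pair, skew, skew']; ring
    linarith
  -- Polarizing once more makes `S` skew in the outer slots. With the other symmetries the three
  -- Bianchi terms then coincide, and 3S = 0.
  have h2 : ∀ X Y Z T, S X Y Z T = - S T Y Z X := fun X Y Z T => by
    have e1 := h1 (X + T) Y Z
    rw [add₁, add₄, add₄, h1, h1] at e1
    linarith
  have e1 := bianchi X Y Z T
  have e2 : S Z X Y T = S X Y Z T := by
    rw [pair Z X Y T, h2 Y T Z X, skew X T Z Y, h2 T X Z Y, skew Y X Z T]
    ring
  have e3 : S Y Z X T = S Z X Y T := by
    rw [pair Y Z X T, h2 X T Y Z, skew Z T Y X, h2 T Z Y X, skew X Z Y T]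
    ring
  linarith

namespace IsMetricOn

/-- Cauchy-Schwarz: h(X, X) times the Gram determinant is the squared length of the nonzero vector
h(X, X)Y - h(X, Y)X. -/
theorem gram_pos (H : IsMetricOn h U) (hx : x ∈ U) {X Y : V} (hXY : LinearIndependent ℝ ![X, Y]) :
    0 < h x X X * h x Y Y - h x X Y ^ 2 := by
  have hX : X ≠ 0 := hXY.ne_zero 0
  have hXX := H.pos x hx X hX
  have hv : h x X X • Y - h x X Y • X ≠ 0 := fun h0 => by
    have := (LinearIndependent.pair_iff.1 hXY) (- h x X Y) (h x X X) (by
      rw [← h0]; module)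
    exact hXX.ne' this.2
  have h1 := H.pos x hx _ hv
  simp only [map_sub, map_smul, sub_apply, smul_apply, smul_eq_mul, H.symm x hx Y X] at h1
  have h2 : 0 < h x X X * (h x X X * h x Y Y - h x X Y ^ 2) := by
    calc _ < _ := h1
      _ = _ := by ring
  exact pos_of_mul_pos_right h2 hXX.le

variable [FiniteDimensional ℝ V]

/-- The difference from the model tensor is an algebraic curvature tensor with vanishing sectional
curvatures. Dependent pairs, not covered by the hypothesis, give zero by skewness. -/
theorem curvature_eq_of_sectionalCurvature (H : IsMetricOn h U) (hx : x ∈ U) {k : ℝ}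
    (hk : ∀ X Y, LinearIndependent ℝ ![X, Y] → sectionalCurvature h x X Y = k) (X Y Z : V) :
    curvature h x X Y Z = k • (h x Y Z • X - h x X Z • Y) := by
  refine H.ext hx fun T => ?_
  have sy := H.symm x hx
  have sk := H.curvature_skew_right hx
  have sl : ∀ X Y Z T, h x (curvature h x X Y Z) T = - h x (curvature h x Y X Z) T :=
    fun X Y Z T => by rw [curvature_skew_left]; simp
  have key := eq_zero_of_sectional_eq_zero (S := fun X Y Z T => h x (curvature h x X Y Z) T -
    k * (h x Y Z * h x X T - h x X Z * h x Y T))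
    (fun X X' Y Z T => by
      simp only [← curvatureL_apply, map_add, add_apply]
      ring)
    (fun X Y Z T => by rw [sl X Y Z T]; ring)
    (fun X Y Z T => by rw [sk X Y Z T]; ring)
    (fun X Y Z T => by
      rw [H.curvature_pair_symm hx X Y Z T, sy T X, sy Z Y, sy Z X, sy T Y]; ring)
    (fun X Y Z T => by
      have := congrArg (fun v => h x v T) (H.bianchi hx X Y Z)
      simp only [map_add, add_apply, map_zero, zero_apply] at this
      rw [sy Z X, sy Z Y, sy Y X]
      linarith)
    (fun X Y => by
      by_cases hX : X = 0
      · simp [hX]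
      · by_cases hXY : LinearIndependent ℝ ![X, Y]
        · have h1 := hk X Y hXY
          have h2 := H.gram_pos hx hXY
          rw [sectionalCurvature, div_eq_iff h2.ne'] at h1
          rw [h1, sy Y X]
          ring
        · rw [LinearIndependent.pair_iff' hX] at hXY
          push Not at hXY
          obtain ⟨a, rfl⟩ := hXY
          have h0 : ∀ Z, curvatureL h x X X Z = 0 := fun Z => by
            rw [curvatureL_apply, curvature]; abel
          simp only [← curvatureL_apply, map_smul, smul_apply, h0, smul_eq_mul]
          simp
          ring_nf
          simp) X Y Z T
  simp only [map_smul, map_sub, sub_apply, smul_apply, smul_eq_mul]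
  linarith

/-- The curvature is built from `h` with a constant coefficient, and `h` is parallel. This needs the
formula on all of `U`, not only at `x`. -/
theorem covDerivCurvature_eq_zero (H : IsMetricOn h U) (hx : x ∈ U) {k : ℝ}
    (hk : ∀ x ∈ U, ∀ X Y Z, curvature h x X Y Z = k • (h x Y Z • X - h x X Z • Y))
    (P S T Z : V) : covDerivCurvature h x P S T Z = 0 := by
  have dR := (H.curvatureL_smooth.differentiableAt_of_isOpen H.isOpen hx).hasDerivAt_line P
  have dh := (H.smooth.differentiableAt_of_isOpen H.isOpen hx).hasDerivAt_line P
  have c : ∀ Z : V, HasDerivAt (fun _ : ℝ => Z) 0 0 := fun Z => hasDerivAt_const _ Z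
  have h1 := ((dR.clm_apply (c S)).clm_apply (c T)).clm_apply (c Z)
  have h2 := (((((dh.clm_apply (c T)).clm_apply (c Z)).smul (c S)).fun_sub
    (((dh.clm_apply (c S)).clm_apply (c Z)).smul (c T)))).fun_const_smul k
  have h3 := h2.congr_of_eventuallyEq ((H.eventually_mem hx P).mono fun t ht =>
    (curvatureL_apply h (x + t • P) S T Z).trans (hk _ ht S T Z))
  have h4 := h1.unique h3
  simp only [zero_smul, add_zero, map_zero, smul_zero, zero_add, H.fderiv_eq hx] at h4
  rw [covDerivCurvature, h4]
  simp only [curvatureL_apply, hk x hx, map_smul, map_sub]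
  module

end IsMetricOn

variable {E : Type*} [NormedAddCommGroup E] [NormedSpace ℝ E] [FiniteDimensional ℝ E]
  [FiniteDimensional ℝ V] {W : Set E} {F : E → V × V} {w : E}

omit [FiniteDimensional ℝ E] [FiniteDimensional ℝ V] in
theorem pullback_contactMetric_apply (h : V → V →L[ℝ] V →L[ℝ] ℝ) (F : E → V × V) (w Y Z : E) :
    pullback (contactMetric h) F w Y Z =
      (1 / 4) * (h (F w).1 (splitDeriv h F w Y).1 (splitDeriv h F w Z).1 +
        h (F w).1 (splitDeriv h F w Y).2 (splitDeriv h F w Z).2) := by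
  simp [pullback, contactMetric, sasakiMetric, splitDeriv, mul_add]

omit [FiniteDimensional ℝ E] [FiniteDimensional ℝ V] in
theorem contactForm_fderiv (h : V → V →L[ℝ] V →L[ℝ] ℝ) (F : E → V × V) (w Y : E) :
    contactForm h (F w) (fderiv ℝ F w Y) =
      (1 / 2) * h (F w).1 (splitDeriv h F w Y).1 (F w).2 := by
  simp [contactForm, splitDeriv_apply]

/-- The Ricci tensor of the unit tangent bundle of a space of constant curvature. -/
theorem IsUnitImmersion.ricci_of_constant_curvature (P : IsUnitImmersion h U W F)
    (H : IsMetricOn h U) (hw : w ∈ W) {n : ℕ}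
    (hV : Module.finrank ℝ V = n + 1) (hE : Module.finrank ℝ E = 2 * n + 1) {k : ℝ}
    (hk : ∀ x ∈ U, ∀ X Y Z, curvature h x X Y Z = k • (h x Y Z • X - h x X Z • Y)) (Y Z : E) :
    ricci (pullback (contactMetric h) F) w Y Z =
      let x := (F w).1
      let u := (F w).2
      let p := splitDeriv h F w Y
      let q := splitDeriv h F w Z
      (n * k - k ^ 2 / 2) * h x p.1 q.1 + (n - 1 + k ^ 2 / 2) * h x p.2 q.2 -
        (n - 1) * k ^ 2 / 2 * (h x p.1 u * h x q.1 u) := by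
  have hx := P.mem w hw
  obtain ⟨e, he0, he⟩ := H.exists_orthonormal hx hV (P.unit w hw)
  have hcV : Module.finrank ℝ V = Fintype.card (Fin (n + 1)) := by simp [hV]
  rw [P.ricci_eq H hw hV hE he0 he]
  simp only
  rw [ricci_eq_sum he hcV]
  simp only [H.covDerivCurvature_eq_zero hx hk, hk _ hx]
  have hu := P.unit w hw
  have hp := P.metric_snd_eq_zero H hw Y
  have hq := P.metric_snd_eq_zero H hw Z
  generalize splitDeriv h F w Y = p at *
  generalize splitDeriv h F w Z = q at *
  generalize (F w).2 = u at *
  generalize (F w).1 = x at *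
  have sy : ∀ X Y, h x X Y = h x Y X := H.symm x hx
  have ps := fun v v' => (parseval_of_orthonormal_frame he hcV v v').symm
  have hself : ∀ i, h x (e i) (e i) = 1 := fun i => by simp [he]
  have s1 : ∀ i, h x (k • (h x p.1 q.1 • e i - h x (e i) q.1 • p.1)) (e i) =
      k * h x p.1 q.1 - k * (h x p.1 (e i) * h x q.1 (e i)) := fun i => by
    simp only [map_sub, map_smul, sub_apply, smul_apply, smul_eq_mul, hself, sy (e i) q.1]
    ring
  have s2 : ∀ i, h x (k • (h x p.2 (e i) • u - h x u (e i) • p.2))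
      (k • (h x q.2 (e i) • u - h x u (e i) • q.2)) =
      k ^ 2 * (h x p.2 (e i) * h x q.2 (e i)) +
        k ^ 2 * h x p.2 q.2 * (h x u (e i) * h x u (e i)) := fun i => by
    simp only [map_sub, map_smul, sub_apply, smul_apply, smul_eq_mul, hu, sy u q.2, hp, hq]
    ring
  have s3 : ∀ i, h x (k • (h x (e i) p.1 • u - h x u p.1 • e i))
      (k • (h x (e i) q.1 • u - h x u q.1 • e i)) =
      k ^ 2 * (h x p.1 (e i) * h x q.1 (e i)) -
        k ^ 2 * h x q.1 u * (h x p.1 (e i) * h x u (e i)) -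
        k ^ 2 * h x p.1 u * (h x q.1 (e i) * h x u (e i)) +
        k ^ 2 * h x p.1 u * h x q.1 u := fun i => by
    simp only [map_sub, map_smul, sub_apply, smul_apply, smul_eq_mul, hu, sy u q.1, sy u p.1,
      sy (e i) p.1, sy (e i) q.1, sy (e i) u, hself]
    ring
  simp only [s1, s2, s3, Finset.sum_add_distrib, Finset.sum_sub_distrib, ← Finset.mul_sum, ps, hu,
    sub_self, add_zero, map_zero, zero_apply, Finset.sum_const, Finset.card_univ, Fintype.card_fin,
    nsmul_eq_mul]
  push_cast
  ring

end LocalGeometry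

/-! ### From the η-Einstein condition to algebraic equations at a point -/

open Filter Topology

namespace LocalGeometry

variable {V : Type*} [NormedAddCommGroup V] [NormedSpace ℝ V] [FiniteDimensional ℝ V]
variable {h : V → V →L[ℝ] V →L[ℝ] ℝ} {U : Set V} {x : V}
variable {E : Type*} [NormedAddCommGroup E] [NormedSpace ℝ E] [FiniteDimensional ℝ E]

/-- Every unit vector lies in the image of a local parametrization of the unit sphere bundle. -/
theorem IsMetricOn.exists_isUnitImmersion (H : IsMetricOn h U) (hx : x ∈ U) {u : V}
    (hu : h x u u = 1) (hd : Module.finrank ℝ E + 1 = 2 * Module.finrank ℝ V) :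
    ∃ (W : Set E) (F : E → V × V) (w : E), IsUnitImmersion h U W F ∧ w ∈ W ∧ F w = (x, u) := by
  -- Central projection: (x', k) goes to the base point x' and the normalization of u + k, where k
  -- is orthogonal to u for the form at the fixed point `x`. Pairing with u in that form gives 1, so
  -- u + k never vanishes, whatever x' is.
  let K : Submodule ℝ V := LinearMap.ker ((h x).flip u).toLinearMap
  have hK : ∀ k : K, h x k u = 0 := fun k => k.2
  have hne : ((h x).flip u).toLinearMap ≠ 0 := fun h0 => by
    have h1 := DFunLike.congr_fun h0 u
    simp [hu] at h1
  have hKd := Module.Dual.finrank_ker_add_one_of_ne_zero hne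
  have hdim : Module.finrank ℝ E = Module.finrank ℝ (V × K) := by
    rw [Module.finrank_prod]
    change _ = _ + Module.finrank ℝ (LinearMap.ker ((h x).flip u).toLinearMap)
    omega
  let L : E ≃L[ℝ] V × K := ContinuousLinearEquiv.ofFinrankEq hdim
  let v : E → V := fun w => u + ((L w).2 : V)
  have hv : ∀ w, h x (v w) u = 1 := fun w => by simp [v, hu, hK]
  have hv0 : ∀ w, v w ≠ 0 := fun w h0 => by simpa [h0] using hv w
  let W : Set E := {w | (L w).1 ∈ U}
  have hW : IsOpen W := H.isOpen.preimage (continuous_fst.comp L.continuous)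
  have vsm : ContDiff ℝ ∞ v := by
    have : ContDiff ℝ ∞ fun w => K.subtypeL (L w).2 :=
      K.subtypeL.contDiff.comp (L.contDiff.snd)
    exact contDiff_const.add this
  let N : E → ℝ := fun w => h (L w).1 (v w) (v w)
  have Nsm : ContDiffOn ℝ ∞ N W :=
    ((H.smooth.comp (L.contDiff.fst.contDiffOn) fun w hw => hw).clm_apply vsm.contDiffOn).clm_apply
      vsm.contDiffOn
  have Npos : ∀ w ∈ W, 0 < N w := fun w hw => H.pos _ hw _ (hv0 w)
  let r : E → ℝ := fun w => (Real.sqrt (N w))⁻¹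
  have rsm : ContDiffOn ℝ ∞ r W :=
    (Nsm.sqrt fun w hw => (Npos w hw).ne').inv fun w hw => (Real.sqrt_pos.2 (Npos w hw)).ne'
  have rpos : ∀ w ∈ W, 0 < r w := fun w hw => inv_pos.2 (Real.sqrt_pos.2 (Npos w hw))
  let F : E → V × V := fun w => ((L w).1, r w • v w)
  have Fsm : ContDiffOn ℝ ∞ F W := L.contDiff.fst.contDiffOn.prodMk (rsm.smul vsm.contDiffOn)
  refine ⟨W, F, L.symm (x, 0), ⟨hW, Fsm, fun w hw => hw, fun w hw => ?_, fun w hw => ?_⟩, ?_, ?_⟩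
  · have h1 : r w * (r w * N w) = 1 := by
      have h2 := Real.mul_self_sqrt (Npos w hw).le
      have h3 := (Real.sqrt_pos.2 (Npos w hw)).ne'
      simp only [r]
      field_simp
      rw [sq, h2]
    simpa [F] using h1
  · rw [injective_iff_map_eq_zero]
    intro X hX
    have dF := (Fsm.differentiableAt_of_isOpen hW hw).hasDerivAt_line X
    rw [hX] at dF
    have dL := (L.differentiableAt (x := w)).hasDerivAt_line X
    rw [L.fderiv] at dL
    have dr := (rsm.differentiableAt_of_isOpen hW hw).hasDerivAt_line X
    have dv : HasDerivAt (fun t : ℝ => v (w + t • X)) ((L X).2 : V) 0 := by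
      have := (K.subtypeL.hasFDerivAt.comp_hasDerivAt (0 : ℝ) dL.comp_snd).const_add u
      exact this
    have h1 : (L X).1 = 0 := dL.comp_fst.unique dF.comp_fst
    have h2 := (dr.smul dv).unique dF.comp_snd
    simp only [zero_smul, add_zero, Prod.snd_zero] at h2
    -- Pairing with u isolates the derivative of the normalizing factor, since `v` pairs to 1 and
    -- its derivative to 0. That factor is thus stationary, and the derivative of `v` vanishes.
    have h3 := congrArg (fun y => h x y u) h2
    simp only [map_add, map_smul, add_apply, smul_apply, smul_eq_mul, hK, hv, mul_zero, mul_one,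
      zero_add, map_zero, zero_apply] at h3
    rw [h3, zero_smul, add_zero] at h2
    have h4 : (L X).2 = 0 := by
      have := (smul_eq_zero.1 h2).resolve_left (rpos w hw).ne'
      exact_mod_cast this
    exact L.map_eq_zero_iff.1 (Prod.ext h1 h4)
  · simpa [W] using hx
  · simp [F, r, v, N, hu]

/-- If the Ricci tensor of the unit tangent bundle is of `η`-Einstein form in all local
parametrizations, the curvature tensor satisfies algebraic equations at every unit vector. -/
theorem IsMetricOn.algebraic_of_etaEinstein (H : IsMetricOn h U) (hx : x ∈ U) {n : ℕ}
    (hV : Module.finrank ℝ V = n + 1) (hE : Module.finrank ℝ E = 2 * n + 1) {c : ℝ}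
    (hc : ∀ X Y, ricci h x X Y = c * h x X Y)
    (hη : ∀ (W : Set E) (F : E → V × V), IsUnitImmersion h U W F → ∀ w ∈ W, ∃ α β : ℝ,
      ∀ X Y, ricci (pullback (contactMetric h) F) w X Y =
        α * pullback (contactMetric h) F w X Y +
          β * (contactForm h (F w) (fderiv ℝ F w X) * contactForm h (F w) (fderiv ℝ F w Y)))
    {e : Fin (n + 1) → V} (he : ∀ i j, h x (e i) (e j) = if i = j then 1 else 0) {u : V}
    (hu : h x u u = 1) :
    ∃ a : ℝ, ∀ y, h x y u = 0 →
      ∑ i, h x (curvature h x u y (e i)) (curvature h x u y (e i)) = a * h x y y ∧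
      ∑ i, h x (curvature h x u (e i) y) (curvature h x u (e i) y) =
        (2 * (c - n + 1) - a / 2) * h x y y := by
  have hd : Module.finrank ℝ E + 1 = 2 * Module.finrank ℝ V := by omega
  obtain ⟨W, F, w, P, hw, hF⟩ := H.exists_isUnitImmersion (E := E) hx hu hd
  obtain ⟨α, β, hαβ⟩ := hη W F P w hw
  have h1 : (F w).1 = x := by rw [hF]
  have h2 : (F w).2 = u := by rw [hF]
  obtain ⟨e', he0', he'⟩ := H.exists_orthonormal hx hV hu
  have hcV : Module.finrank ℝ V = Fintype.card (Fin (n + 1)) := by simp [hV]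
  -- Σ|T eᵢ|² is the trace of T*T, so the given frame may be exchanged for one starting with u, as
  -- the Ricci formula requires.
  have hsum : ∀ T : V →L[ℝ] V, ∑ i, h x (T (e i)) (T (e i)) = ∑ i, h x (T (e' i)) (T (e' i)) := by
    intro T
    obtain ⟨eq, heq⟩ := H.exists_equiv hx
    let S : V →ₗ[ℝ] V :=
      ((eq.symm : (V →L[ℝ] ℝ) →L[ℝ] V).comp ((h x).bilinearComp T T)).toLinearMap
    have hS : ∀ v, h x (S v) v = h x (T v) (T v) := fun v => by
      simp only [S, ← heq]
      simp
    rw [← Finset.sum_congr rfl fun i _ => hS (e i), ← Finset.sum_congr rfl fun i _ => hS (e' i),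
      ← trace_of_orthonormal_frame he hcV, ← trace_of_orthonormal_frame he' hcV]
  have hA : ∀ y, ∑ i, h x (curvature h x u y (e i)) (curvature h x u y (e i)) =
      ∑ i, h x (curvature h x u y (e' i)) (curvature h x u y (e' i)) := fun y => by
    simpa only [curvatureL_apply] using hsum (curvatureL h x u y)
  have hB : ∀ y, ∑ i, h x (curvature h x u (e i) y) (curvature h x u (e i) y) =
      ∑ i, h x (curvature h x u (e' i) y) (curvature h x u (e' i) y) := fun y => by
    simpa only [curvatureL_apply, ContinuousLinearMap.flip_apply] using
      hsum ((curvatureL h x u).flip y)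
  have hric := fun Y Z => P.ricci_eq H hw hV hE (e := e') (by rw [he0', h2])
    (by rw [h1]; exact he') Y Z
  simp only [hαβ, pullback_contactMetric_apply, contactForm_fderiv, h1, h2, hc] at hric
  have surj := fun s hs => P.exists_splitDeriv_eq H hw hd (s := s) (by rw [h1, h2]; exact hs)
  have hz : ∀ X Y, curvature h x X Y 0 = 0 := fun X Y => by rw [← curvatureL_apply, map_zero]
  have hz' : ∀ X Y, curvature h x X 0 Y = 0 := fun X Y => by
    rw [← curvatureL_apply, map_zero, zero_apply]
  -- The vertical lift of y gives α/4 = n - 1 + a/4, whence this value of a; the horizontal lift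
  -- then gives the second equation. On each, η and the terms with ∇R vanish.
  refine ⟨α - 4 * (n - 1), fun y hy => ?_⟩
  constructor
  · obtain ⟨Y, hY⟩ := surj (0, y) hy
    have h3 := hric Y Y
    simp [hY, hz, covDerivCurvature] at h3
    rw [hA]
    linarith
  · obtain ⟨Y, hY⟩ := surj (y, 0) (by simp)
    have h3 := hric Y Y
    simp [hY, hz', covDerivCurvature, hy] at h3
    rw [hB]
    linarith

end LocalGeometry

/-! ### Constant Jacobi norm kills half of the Weyl tensor -/

namespace LocalGeometry

set_option maxHeartbeats 800000 in
/-- If the Jacobi operators of an Einstein curvature tensor in dimension four, given by the blocks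
`a` and `b` of its curvature operator on two-forms, have constant norm, then the tensor product
of the self-dual and the anti-self-dual Weyl tensor vanishes. -/
theorem weyl_eq_zero_or_eq_zero {a₁₁ a₁₂ a₁₃ a₂₂ a₂₃ a₃₃ b₁₁ b₁₂ b₁₃ b₂₂ b₂₃ m : ℝ}
    (hf : ∀ x y z w : ℝ,
      (-a₁₁ * y ^ 2 - 2 * a₁₂ * y * z - 2 * a₁₃ * y * w - a₂₂ * z ^ 2 - 2 * a₂₃ * z * w -
          a₃₃ * w ^ 2) ^ 2 +
      2 * (a₁₁ * x * y + a₁₂ * x * z + a₁₃ * x * w + b₁₁ * z * w + b₁₂ * y * w - b₁₃ * y * z +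
          2 * b₂₂ * z * w - b₂₃ * z ^ 2 + b₂₃ * w ^ 2) ^ 2 +
      2 * (a₁₂ * x * y + a₂₂ * x * z + a₂₃ * x * w - 2 * b₁₁ * y * w - b₁₂ * z * w + b₁₃ * y ^ 2 -
          b₁₃ * w ^ 2 - b₂₂ * y * w + b₂₃ * y * z) ^ 2 +
      2 * (a₁₃ * x * y + a₂₃ * x * z + a₃₃ * x * w + b₁₁ * y * z - b₁₂ * y ^ 2 + b₁₂ * z ^ 2 +
          b₁₃ * z * w - b₂₂ * y * z - b₂₃ * y * w) ^ 2 +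
      (-a₁₁ * x ^ 2 - a₂₂ * w ^ 2 + 2 * a₂₃ * z * w - a₃₃ * z ^ 2 - 2 * b₁₂ * x * w +
          2 * b₁₃ * x * z) ^ 2 +
      2 * (-a₁₂ * x ^ 2 + a₁₂ * w ^ 2 - a₁₃ * z * w - a₂₃ * y * w + a₃₃ * y * z + b₁₁ * x * w -
          b₁₃ * x * y - b₂₂ * x * w + b₂₃ * x * z) ^ 2 +
      2 * (-a₁₂ * z * w - a₁₃ * x ^ 2 + a₁₃ * z ^ 2 + a₂₂ * y * w - a₂₃ * y * z - 2 * b₁₁ * x * z +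
          b₁₂ * x * y - b₂₂ * x * z - b₂₃ * x * w) ^ 2 +
      (-a₁₁ * w ^ 2 + 2 * a₁₃ * y * w - a₂₂ * x ^ 2 - a₃₃ * y ^ 2 + 2 * b₁₂ * x * w -
          2 * b₂₃ * x * y) ^ 2 +
      2 * (a₁₁ * z * w - a₁₂ * y * w - a₁₃ * y * z - a₂₃ * x ^ 2 + a₂₃ * y ^ 2 + b₁₁ * x * y -
          b₁₂ * x * z + b₁₃ * x * w + 2 * b₂₂ * x * y) ^ 2 +
      (-a₁₁ * z ^ 2 + 2 * a₁₂ * y * z - a₂₂ * y ^ 2 - a₃₃ * x ^ 2 - 2 * b₁₃ * x * z +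
          2 * b₂₃ * x * y) ^ 2 =
        m * (x ^ 2 + y ^ 2 + z ^ 2 + w ^ 2) ^ 2) :
    ((a₁₂ + b₁₂) = 0 ∧ (a₁₃ + b₁₃) = 0 ∧ (a₂₃ + b₂₃) = 0 ∧ (a₁₁ + b₁₁ - a₂₂ - b₂₂) = 0 ∧
      (a₂₂ + b₂₂ - a₃₃ + b₁₁ + b₂₂) = 0) ∨
    ((a₁₂ - b₁₂) = 0 ∧ (a₁₃ - b₁₃) = 0 ∧ (a₂₃ - b₂₃) = 0 ∧ (a₁₁ - b₁₁ - a₂₂ + b₂₂) = 0 ∧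
      (a₂₂ - b₂₂ - a₃₃ - b₁₁ - b₂₂) = 0) := by
  -- Sample values of the quartic; the names spell the evaluation point, with `m1` for -1.
  have h0010 := hf 0 0 1 0
  have h0001 := hf 0 0 0 1
  have h0100 := hf 0 1 0 0
  have h1000 := hf 1 0 0 0
  have h001m1 := hf 0 0 1 (-1)
  have h1100 := hf 1 1 0 0
  have h0101 := hf 0 1 0 1
  have h1010 := hf 1 0 1 0
  have h0120 := hf 0 1 2 0
  have h0110 := hf 0 1 1 0
  have h01m10 := hf 0 1 (-1) 0
  have h1002 := hf 1 0 0 2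
  have h1001 := hf 1 0 0 1
  have h0011 := hf 0 0 1 1
  have h0111 := hf 0 1 1 1
  have h1011 := hf 1 0 1 1
  have h01m11 := hf 0 1 (-1) 1
  have h101m1 := hf 1 0 1 (-1)
  have h0102 := hf 0 1 0 2
  have h1020 := hf 1 0 2 0
  have h010m1 := hf 0 1 0 (-1)
  have h0012 := hf 0 0 1 2
  have h1200 := hf 1 2 0 0
  have h011m1 := hf 0 1 1 (-1)
  have h1101 := hf 1 1 0 1
  have h1111 := hf 1 1 1 1
  ring_nf at h0010 h0001 h0100 h1000 h001m1 h1100 h0101 h1010 h0120 h0110 h01m10 h1002 h1001 h0011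
             h0111 h1011 h01m11 h101m1 h0102 h1020 h010m1 h0012 h1200 h011m1 h1101 h1111
  -- Each product of an entry of W₊ with an entry of W₋ is a component of the harmonic part of the
  -- quartic, so it is a linear combination of sample values in which the right-hand sides cancel.
  -- The five blocks treat the five entries of W₊, and `q` runs over the five entries of W₋.
  have p12 : ∀ q, q = (a₁₂ - b₁₂) ∨ q = (a₁₃ - b₁₃) ∨ q = (a₂₃ - b₂₃) ∨
      q = (a₁₁ - b₁₁ - a₂₂ + b₂₂) ∨ q = (a₂₂ - b₂₂ - a₃₃ - b₁₁ - b₂₂) → (a₁₂ + b₁₂) * q = 0 := by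
    rintro q (rfl | rfl | rfl | rfl | rfl)
    · linear_combination
        -(1 / 4) * h0010 + (1 / 4) * h0001 - (1 / 4) * h0100 + (1 / 4) * h1000
    · linear_combination
        (1 / 4) * h0001 + (1 / 4) * h0010 - (1 / 4) * h1000 - (1 / 4) * h0100 + (1 / 8) * h001m1 -
        (1 / 8) * h1100
    · linear_combination
        -(1 / 4) * h0001 - (1 / 4) * h0100 + (1 / 4) * h0010 + (1 / 4) * h1000 - (1 / 8) * h0101 +
        (1 / 8) * h1010
    · linear_combination
        -(1 / 24) * h0120 + (7 / 12) * h0001 + (5 / 12) * h0010 - (5 / 24) * h0100 -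
        (1 / 24) * h1000 + (1 / 6) * h0110 - (1 / 24) * h01m10 - (1 / 24) * h1002 +
        (5 / 24) * h1001
    · linear_combination
        -(5 / 12) * h0001 - (1 / 12) * h0010 + (11 / 48) * h0100 - (5 / 48) * h1000 -
        (1 / 16) * h0011 + (1 / 16) * h001m1 - (1 / 12) * h0110 + (1 / 12) * h01m10 +
        (1 / 48) * h0120 - (1 / 16) * h0111 - (1 / 16) * h1011 - (1 / 6) * h1001 +
        (1 / 48) * h1002 + (1 / 16) * h01m11 + (1 / 16) * h101m1
  have p13 : ∀ q, q = (a₁₂ - b₁₂) ∨ q = (a₁₃ - b₁₃) ∨ q = (a₂₃ - b₂₃) ∨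
      q = (a₁₁ - b₁₁ - a₂₂ + b₂₂) ∨ q = (a₂₂ - b₂₂ - a₃₃ - b₁₁ - b₂₂) → (a₁₃ + b₁₃) * q = 0 := by
    rintro q (rfl | rfl | rfl | rfl | rfl)
    · linear_combination
        -(1 / 8) * h0011 - (1 / 4) * h0001 - (1 / 4) * h0010 + (1 / 4) * h1000 + (1 / 4) * h0100 +
        (1 / 8) * h1100
    · linear_combination
        -(1 / 4) * h0100 - (1 / 4) * h0001 + (1 / 4) * h0010 + (1 / 4) * h1000
    · linear_combination
        (1 / 8) * h01m10 - (1 / 4) * h0001 + (1 / 4) * h0010 + (1 / 4) * h0100 - (1 / 4) * h1000 -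
        (1 / 8) * h1001
    · linear_combination
        -(1 / 48) * h0102 + (1 / 6) * h0001 - (1 / 6) * h0010 - (37 / 48) * h0100 +
        (37 / 48) * h1000 + (1 / 24) * h0101 + (1 / 48) * h1020 - (1 / 24) * h1010 -
        (1 / 16) * h01m11 - (1 / 16) * h0111 + (1 / 16) * h101m1 + (1 / 16) * h1011
    · linear_combination
        (1 / 16) * h01m11 + (5 / 12) * h0001 - (5 / 12) * h0010 + (35 / 48) * h0100 -
        (35 / 48) * h1000 + (1 / 6) * h0101 - (1 / 48) * h0102 + (1 / 16) * h0111 -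
        (1 / 16) * h101m1 - (1 / 6) * h1010 + (1 / 48) * h1020 - (1 / 16) * h1011
  have p23 : ∀ q, q = (a₁₂ - b₁₂) ∨ q = (a₁₃ - b₁₃) ∨ q = (a₂₃ - b₂₃) ∨
      q = (a₁₁ - b₁₁ - a₂₂ + b₂₂) ∨ q = (a₂₂ - b₂₂ - a₃₃ - b₁₁ - b₂₂) → (a₂₃ + b₂₃) * q = 0 := by
    rintro q (rfl | rfl | rfl | rfl | rfl)
    · linear_combination
        (1 / 8) * h010m1 + (1 / 4) * h0001 + (1 / 4) * h0100 - (1 / 4) * h0010 - (1 / 4) * h1000 -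
        (1 / 8) * h1010
    · linear_combination
        (1 / 4) * h0001 - (1 / 4) * h0010 - (1 / 4) * h0100 + (1 / 4) * h1000 - (1 / 8) * h0110 +
        (1 / 8) * h1001
    · linear_combination
        (1 / 4) * h1000 - (1 / 4) * h0001 + (1 / 4) * h0100 - (1 / 4) * h0010
    · linear_combination
        (1 / 48) * h0012 - (1 / 12) * h0001 - (43 / 48) * h0010 + (49 / 48) * h1000 -
        (5 / 12) * h0100 - (1 / 48) * h0011 - (5 / 48) * h001m1 + (1 / 48) * h1200 -
        (1 / 24) * h1100 + (1 / 16) * h0111 + (1 / 16) * h0101 - (1 / 16) * h010m1 -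
        (1 / 16) * h0110 - (1 / 16) * h01m10 - (1 / 8) * h011m1 - (1 / 16) * h01m11 +
        (1 / 8) * h1101 + (1 / 8) * h1001 + (1 / 16) * h1011 - (1 / 16) * h101m1
    · linear_combination
        -(1 / 24) * h0012 + (5 / 12) * h0001 - (5 / 24) * h0010 - (1 / 24) * h1000 +
        (7 / 12) * h0100 + (1 / 6) * h0011 - (1 / 24) * h001m1 - (1 / 24) * h1200 +
        (5 / 24) * h1100
  have pd12 : ∀ q, q = (a₁₂ - b₁₂) ∨ q = (a₁₃ - b₁₃) ∨ q = (a₂₃ - b₂₃) ∨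
      q = (a₁₁ - b₁₁ - a₂₂ + b₂₂) ∨ q = (a₂₂ - b₂₂ - a₃₃ - b₁₁ - b₂₂) → (a₁₁ + b₁₁ - a₂₂ - b₂₂) * q = 0 := by
    rintro q (rfl | rfl | rfl | rfl | rfl)
    · linear_combination
        -(1 / 24) * h0120 - (7 / 12) * h0001 + (7 / 12) * h0010 - (1 / 24) * h0100 +
        (1 / 24) * h1000 + (5 / 24) * h0110 + (1 / 24) * h1002 - (5 / 24) * h1001
    · linear_combination
        -(1 / 48) * h0102 + (1 / 12) * h0001 - (1 / 12) * h0010 + (19 / 48) * h0100 -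
        (37 / 48) * h1000 + (1 / 8) * h001m1 + (1 / 8) * h0011 + (5 / 24) * h0101 +
        (1 / 6) * h010m1 - (1 / 48) * h1020 + (1 / 24) * h1010 - (1 / 16) * h01m11 +
        (1 / 8) * h0110 + (1 / 8) * h01m10 - (1 / 16) * h0111 - (1 / 16) * h101m1 -
        (1 / 16) * h1011
    · linear_combination
        (1 / 48) * h0012 - (2 / 3) * h0001 + (37 / 48) * h0010 - (49 / 48) * h1000 +
        (1 / 6) * h0100 + (1 / 48) * h0011 + (3 / 16) * h001m1 - (1 / 48) * h1200 +
        (1 / 24) * h1100 - (1 / 16) * h0111 + (1 / 16) * h0101 + (3 / 16) * h010m1 +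
        (3 / 16) * h0110 + (3 / 16) * h01m10 - (1 / 16) * h01m11 - (1 / 8) * h1101 -
        (1 / 8) * h1001 - (1 / 16) * h1011 + (1 / 16) * h101m1
    · linear_combination
        h0001 + h1000 - (1 / 4) * h0110 - (1 / 4) * h01m10
    · linear_combination
        (1 / 2) * h001m1 + h0010 - (3) * h1000 + (1 / 4) * h0011 + (1 / 4) * h010m1 +
        (1 / 4) * h0110 + (1 / 2) * h01m10 - (1 / 8) * h1111 - (1 / 4) * h1001 - (1 / 4) * h1010 -
        (1 / 4) * h1100
  have pd23 : ∀ q, q = (a₁₂ - b₁₂) ∨ q = (a₁₃ - b₁₃) ∨ q = (a₂₃ - b₂₃) ∨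
      q = (a₁₁ - b₁₁ - a₂₂ + b₂₂) ∨ q = (a₂₂ - b₂₂ - a₃₃ - b₁₁ - b₂₂) → (a₂₂ + b₂₂ - a₃₃ + b₁₁ + b₂₂) * q = 0 := by
    rintro q (rfl | rfl | rfl | rfl | rfl)
    · linear_combination
        -(1 / 8) * h011m1 + (1 / 6) * h0001 - (2 / 3) * h0010 - (17 / 48) * h0100 +
        (5 / 48) * h1000 + (3 / 16) * h0011 + (1 / 16) * h001m1 + (1 / 8) * h0101 +
        (1 / 8) * h010m1 - (1 / 24) * h0110 + (1 / 8) * h01m10 + (1 / 48) * h0120 -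
        (1 / 16) * h0111 + (1 / 16) * h1011 + (1 / 6) * h1001 - (1 / 48) * h1002 -
        (1 / 16) * h01m11 - (1 / 16) * h101m1
    · linear_combination
        (1 / 16) * h01m11 + (1 / 3) * h0001 + (2 / 3) * h0010 - (29 / 48) * h0100 +
        (35 / 48) * h1000 - (1 / 8) * h0011 - (1 / 8) * h001m1 - (1 / 24) * h0101 -
        (5 / 24) * h010m1 - (1 / 8) * h0110 - (1 / 8) * h01m10 - (1 / 48) * h0102 +
        (1 / 16) * h0111 + (1 / 16) * h101m1 + (1 / 6) * h1010 - (1 / 48) * h1020 +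
        (1 / 16) * h1011
    · linear_combination
        -(1 / 24) * h0012 + (7 / 12) * h0001 - (1 / 24) * h0010 + (1 / 24) * h1000 -
        (7 / 12) * h0100 + (5 / 24) * h0011 + (1 / 24) * h1200 - (5 / 24) * h1100
    · linear_combination
        -(1 / 4) * h001m1 - h0001 + 2 * h1000 - h0100 - (1 / 4) * h0101 - (1 / 2) * h010m1 -
        (1 / 4) * h01m10 + (1 / 8) * h1111 + (1 / 4) * h1001 + (1 / 4) * h1010 + (1 / 4) * h1100
    · linear_combination
        -(1 / 4) * h001m1 + h1000 + h0100 - (1 / 4) * h0011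
  -- A tensor product of two vectors vanishes only if one of them does.
  by_contra hcon
  simp only [not_or] at hcon
  obtain ⟨hP, hQ⟩ := hcon
  have key : ∀ q, q = (a₁₂ - b₁₂) ∨ q = (a₁₃ - b₁₃) ∨ q = (a₂₃ - b₂₃) ∨
      q = (a₁₁ - b₁₁ - a₂₂ + b₂₂) ∨ q = (a₂₂ - b₂₂ - a₃₃ - b₁₁ - b₂₂) → q = 0 := by
    intro q hq
    by_contra hq0
    exact hP ⟨(mul_eq_zero.1 (p12 q hq)).resolve_right hq0,
      (mul_eq_zero.1 (p13 q hq)).resolve_right hq0, (mul_eq_zero.1 (p23 q hq)).resolve_right hq0,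
      (mul_eq_zero.1 (pd12 q hq)).resolve_right hq0, (mul_eq_zero.1 (pd23 q hq)).resolve_right hq0⟩
  exact hQ ⟨key _ (by simp), key _ (by simp), key _ (by simp), key _ (by simp), key _ (by simp)⟩

end LocalGeometry

/-! ### The remaining block of the curvature operator -/

namespace LocalGeometry

/-- The curvature components `a`, `b` of an Einstein curvature tensor in dimension four, one half of
whose Weyl tensor vanishes, are those of constant curvature `1` or `2` as soon as they satisfy the
`η`-Einstein equations. -/
theorem scalar_of_half_weyl_eq_zero {a₁₁ a₁₂ a₁₃ a₂₂ a₂₃ a₃₃ b₁₁ b₁₂ b₁₃ b₂₂ b₂₃ a t : ℝ}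
    (ht : a₁₁ + a₂₂ + a₃₃ = t)
    (h12 : a₁₂ - b₁₂ = 0) (h13 : a₁₃ - b₁₃ = 0) (h23 : a₂₃ - b₂₃ = 0)
    (hd12 : a₁₁ - b₁₁ - a₂₂ + b₂₂ = 0) (hd23 : a₂₂ - b₂₂ - a₃₃ - b₁₁ - b₂₂ = 0)
    (e11 : 2 * (a₁₁ ^ 2 + a₁₂ ^ 2 + a₁₃ ^ 2 + b₁₁ ^ 2 + b₁₂ ^ 2 + b₁₃ ^ 2) = a)
    (e22 : 2 * (a₁₂ ^ 2 + a₂₂ ^ 2 + a₂₃ ^ 2 + b₁₂ ^ 2 + b₂₂ ^ 2 + b₂₃ ^ 2) = a)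
    (e33 : 2 * (a₁₃ ^ 2 + a₂₃ ^ 2 + a₃₃ ^ 2 + b₁₃ ^ 2 + b₂₃ ^ 2 + (b₁₁ + b₂₂) ^ 2) = a)
    (e12 : a₁₁ * a₁₂ + a₁₂ * a₂₂ + a₁₃ * a₂₃ + b₁₁ * b₁₂ + b₁₂ * b₂₂ + b₁₃ * b₂₃ = 0)
    (e13 : a₁₁ * a₁₃ + a₁₂ * a₂₃ + a₁₃ * a₃₃ + b₁₁ * b₁₃ + b₁₂ * b₂₃ - b₁₃ * (b₁₁ + b₂₂) = 0)
    (e23 : a₁₂ * a₁₃ + a₂₂ * a₂₃ + a₂₃ * a₃₃ + b₁₂ * b₁₃ + b₂₂ * b₂₃ - b₂₃ * (b₁₁ + b₂₂) = 0)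
    (hJ : a₁₁ ^ 2 + a₂₂ ^ 2 + a₃₃ ^ 2 + 2 * (a₁₂ ^ 2 + a₁₃ ^ 2 + a₂₃ ^ 2) =
      9 / 2 * a - 6 * (t - 2)) :
    ∃ k : ℝ, (k = 1 ∨ k = 2) ∧ t = 3 * k ∧ a₁₁ = k ∧ a₂₂ = k ∧ a₃₃ = k ∧ a₁₂ = 0 ∧ a₁₃ = 0 ∧
      a₂₃ = 0 := by
  obtain rfl : b₁₂ = a₁₂ := by linarith
  obtain rfl : b₁₃ = a₁₃ := by linarith
  obtain rfl : b₂₃ = a₂₃ := by linarith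
  obtain rfl : b₁₁ = a₁₁ - t / 3 := by linarith
  obtain rfl : b₂₂ = a₂₂ - t / 3 := by linarith
  -- `n = 2 a - t / 3` is the remaining block of the curvature operator
  obtain ⟨n₁, hn₁⟩ : ∃ n, n = 2 * a₁₁ - t / 3 := ⟨_, rfl⟩
  obtain ⟨n₂, hn₂⟩ : ∃ n, n = 2 * a₂₂ - t / 3 := ⟨_, rfl⟩
  obtain ⟨n₃, hn₃⟩ : ∃ n, n = 2 * a₃₃ - t / 3 := ⟨_, rfl⟩
  obtain rfl : a₁₁ = (n₁ + t / 3) / 2 := by linarith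
  obtain rfl : a₂₂ = (n₂ + t / 3) / 2 := by linarith
  obtain rfl : a₃₃ = (n₃ + t / 3) / 2 := by linarith
  obtain rfl : t = n₁ + n₂ + n₃ := by linarith
  obtain ⟨c, hc⟩ : ∃ c, c = a - (n₁ + n₂ + n₃) ^ 2 / 9 := ⟨_, rfl⟩
  obtain rfl : a = c + (n₁ + n₂ + n₃) ^ 2 / 9 := by linarith
  -- Let N be the symmetric matrix with diagonal n₁, n₂, n₃ and off-diagonal entries 2b₁₂, 2b₁₃,
  -- 2b₂₃. As A - B is the scalar t/3, the equations 2(A² + B²) = a become N² = c with c = a - t²/9,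
  -- and tr N = t.
  have f11 : n₁ ^ 2 + 4 * b₁₂ ^ 2 + 4 * b₁₃ ^ 2 = c := by linear_combination e11
  have f22 : 4 * b₁₂ ^ 2 + n₂ ^ 2 + 4 * b₂₃ ^ 2 = c := by linear_combination e22
  have f33 : 4 * b₁₃ ^ 2 + 4 * b₂₃ ^ 2 + n₃ ^ 2 = c := by linear_combination e33
  have f12 : b₁₂ * (n₁ + n₂) + 2 * b₁₃ * b₂₃ = 0 := by linear_combination e12
  have f13 : b₁₃ * (n₁ + n₃) + 2 * b₁₂ * b₂₃ = 0 := by linear_combination e13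
  have f23 : b₂₃ * (n₂ + n₃) + 2 * b₁₂ * b₁₃ = 0 := by linear_combination e23
  have hJ' : 15 * c + (n₁ + n₂ + n₃) ^ 2 - 24 * (n₁ + n₂ + n₃) + 48 = 0 := by
    linear_combination -4 * hJ + f11 + f22 + f33
  -- Eigenvalues ±√c of both signs would give t² = c; then `hJ'` would read 16(t - 3/4)² + 39 = 0.
  have hne : (n₁ + n₂ + n₃) ^ 2 - c ≠ 0 := fun h0 => by
    nlinarith [sq_nonneg (n₁ + n₂ + n₃ - 3 / 4)]
  -- Cayley-Hamilton with N² = c says that (t² - c)N is scalar: its off-diagonal entries vanish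
  -- here, its diagonal differences in `k1` and `k2`.
  have g12 : ((n₁ + n₂ + n₃) ^ 2 - c) * b₁₂ = 0 := by
    linear_combination -(2 * n₁ * f12 + 2 * b₁₂ * f22 + 4 * b₁₃ * f23) + 2 * (n₁ + n₂ + n₃) * f12 +
      b₁₂ * (f11 + f22 + f33)
  have g13 : ((n₁ + n₂ + n₃) ^ 2 - c) * b₁₃ = 0 := by
    linear_combination -(2 * n₁ * f13 + 4 * b₁₂ * f23 + 2 * b₁₃ * f33) + 2 * (n₁ + n₂ + n₃) * f13 +
      b₁₃ * (f11 + f22 + f33)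
  have g23 : ((n₁ + n₂ + n₃) ^ 2 - c) * b₂₃ = 0 := by
    linear_combination -(4 * b₁₂ * f13 + 2 * n₂ * f23 + 2 * b₂₃ * f33) + 2 * (n₁ + n₂ + n₃) * f23 +
      b₂₃ * (f11 + f22 + f33)
  obtain rfl := (mul_eq_zero.1 g12).resolve_left hne
  obtain rfl := (mul_eq_zero.1 g13).resolve_left hne
  obtain rfl := (mul_eq_zero.1 g23).resolve_left hne
  have k1 : ((n₁ + n₂ + n₃) ^ 2 - c) * (n₁ - n₂) = 0 := by
    linear_combination -2 * (n₁ * f11 - n₂ * f22) + 2 * (n₁ + n₂ + n₃) * (f11 - f22) +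
      (n₁ - n₂) * (f11 + f22 + f33)
  have k2 : ((n₁ + n₂ + n₃) ^ 2 - c) * (n₂ - n₃) = 0 := by
    linear_combination -2 * (n₂ * f22 - n₃ * f33) + 2 * (n₁ + n₂ + n₃) * (f22 - f33) +
      (n₂ - n₃) * (f11 + f22 + f33)
  obtain rfl := sub_eq_zero.1 ((mul_eq_zero.1 k1).resolve_left hne)
  obtain rfl := sub_eq_zero.1 ((mul_eq_zero.1 k2).resolve_left hne)
  -- For N = n₁ one has t = 3n₁ and c = n₁², and `hJ'` is 24 times this equation.
  have hk : (n₁ - 1) * (n₁ - 2) = 0 := by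
    linear_combination hJ' / 24 + 15 / 24 * f11
  refine ⟨n₁, ?_, by ring, by ring, by ring, by ring, rfl, rfl, rfl⟩
  rcases mul_eq_zero.1 hk with hk | hk
  · exact Or.inl (by linarith)
  · exact Or.inr (by linarith)

end LocalGeometry

/-! ### Curvature components in an orthonormal frame -/

namespace LocalGeometry

/-- Squared norm of the curvature operator `R(u, y)`, in components. -/
noncomputable def normSqCurvature (r : Fin 4 → Fin 4 → Fin 4 → Fin 4 → ℝ) (u y : Fin 4 → ℝ) : ℝ :=
  ∑ k, ∑ l, (∑ j, y j * ∑ i, u i * r i j k l) ^ 2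

/-- Squared norm of the operator `X ↦ R(u, X)y`, in components. -/
noncomputable def normSqJacobi (r : Fin 4 → Fin 4 → Fin 4 → Fin 4 → ℝ) (u y : Fin 4 → ℝ) : ℝ :=
  ∑ j, ∑ l, (∑ k, y k * ∑ i, u i * r i j k l) ^ 2

/-- Euler's four-square identity: the four vectors `u`, `iu`, `ju`, `ku` form an orthogonal frame
of vectors of the same norm. -/
theorem sum_quaternion_frame (u v : Fin 4 → ℝ) :
    (∑ j, u j * v j) ^ 2 + (∑ j, ![-u 1, u 0, -u 3, u 2] j * v j) ^ 2 +
      (∑ j, ![-u 2, u 3, u 0, -u 1] j * v j) ^ 2 + (∑ j, ![-u 3, -u 2, u 1, u 0] j * v j) ^ 2 =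
    (∑ j, u j ^ 2) * ∑ j, v j ^ 2 := by
  simp [Fin.sum_univ_four]
  ring

variable {r : Fin 4 → Fin 4 → Fin 4 → Fin 4 → ℝ}

theorem normSqCurvature_comm (hs : ∀ i j k l, r i j k l = - r j i k l) (u y : Fin 4 → ℝ) :
    normSqCurvature r u y = normSqCurvature r y u := by
  refine Finset.sum_congr rfl fun k _ => Finset.sum_congr rfl fun l _ => ?_
  rw [← neg_sq]
  congr 1
  simp only [Finset.mul_sum]
  rw [Finset.sum_comm, ← Finset.sum_neg_distrib]
  refine Finset.sum_congr rfl fun i _ => ?_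
  rw [← Finset.sum_neg_distrib]
  refine Finset.sum_congr rfl fun j _ => ?_
  rw [hs i j]
  ring

theorem normSqCurvature_self (hs : ∀ i j k l, r i j k l = - r j i k l) (u : Fin 4 → ℝ) :
    normSqCurvature r u u = 0 := by
  refine Finset.sum_eq_zero fun k _ => Finset.sum_eq_zero fun l _ => ?_
  have h1 : ∑ j, u j * ∑ i, u i * r i j k l = - ∑ j, u j * ∑ i, u i * r i j k l := by
    simp only [Finset.mul_sum]
    conv_lhs => rw [Finset.sum_comm]
    rw [← Finset.sum_neg_distrib]
    refine Finset.sum_congr rfl fun i _ => ?_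
    rw [← Finset.sum_neg_distrib]
    refine Finset.sum_congr rfl fun j _ => ?_
    rw [hs i j]
    ring
  rw [show ∑ j, u j * ∑ i, u i * r i j k l = 0 by linarith]
  simp

/-- Each side is |u|² times the full sum of squares of the components of R(u, ·)·, by the
four-square identity in the slot that is contracted with the frame. -/
theorem sum_normSq_eq (u : Fin 4 → ℝ) :
    normSqJacobi r u u + normSqJacobi r u ![-u 1, u 0, -u 3, u 2] +
      normSqJacobi r u ![-u 2, u 3, u 0, -u 1] + normSqJacobi r u ![-u 3, -u 2, u 1, u 0] =
    normSqCurvature r u u + normSqCurvature r u ![-u 1, u 0, -u 3, u 2] +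
      normSqCurvature r u ![-u 2, u 3, u 0, -u 1] +
      normSqCurvature r u ![-u 3, -u 2, u 1, u 0] := by
  simp only [normSqJacobi, normSqCurvature, ← Finset.sum_add_distrib, sum_quaternion_frame]
  simp only [← Finset.mul_sum]
  congr 1
  have h1 : ∀ j, ∑ l, ∑ k, (∑ i, u i * r i j k l) ^ 2 = ∑ k, ∑ l, (∑ i, u i * r i j k l) ^ 2 :=
    fun j => Finset.sum_comm
  simp only [h1]
  rw [Finset.sum_comm]
  exact Finset.sum_congr rfl fun k _ => Finset.sum_comm

/-- The norm of R(u, y) is symmetric in u and y, so u ↦ α(u)/|u|² agrees on orthogonal vectors,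
hence everywhere. Summing over u, iu, ju, ku then gives J(u, u) + 3(d - a/2)|u|⁴ = 3a|u|⁴ for the
Jacobi norm J. -/
theorem exists_normSqCurvature_eq (hs : ∀ i j k l, r i j k l = - r j i k l) {d : ℝ}
    (hη : ∀ u : Fin 4 → ℝ, u ≠ 0 → ∃ α, ∀ y, ∑ i, u i * y i = 0 →
      normSqCurvature r u y = α * ∑ i, y i ^ 2 ∧
      normSqJacobi r u y = (d * ∑ i, u i ^ 2 - α / 2) * ∑ i, y i ^ 2) :
    ∃ a, (∀ u y, ∑ i, u i * y i = 0 →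
      normSqCurvature r u y = a * (∑ i, u i ^ 2) * ∑ i, y i ^ 2) ∧
      ∀ u, normSqJacobi r u u = (9 / 2 * a - 3 * d) * (∑ i, u i ^ 2) ^ 2 := by
  choose! α hα using hη
  have pos : ∀ u : Fin 4 → ℝ, u ≠ 0 → ∑ i, u i ^ 2 ≠ 0 := fun u hu h0 => hu <| by
    rw [Finset.sum_eq_zero_iff_of_nonneg fun _ _ => sq_nonneg _] at h0
    funext i
    simpa using h0 i (Finset.mem_univ i)
  have hcomm : ∀ u y : Fin 4 → ℝ, u ≠ 0 → y ≠ 0 → ∑ i, u i * y i = 0 →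
      α u * ∑ i, y i ^ 2 = α y * ∑ i, u i ^ 2 := fun u y hu hy huy => by
    rw [← (hα u hu y huy).1, normSqCurvature_comm hs,
      (hα y hy u (by simpa only [mul_comm] using huy)).1]
  have he : (![1, 0, 0, 0] : Fin 4 → ℝ) ≠ 0 := fun h0 => by simpa using congrFun h0 0
  have hconst : ∀ u : Fin 4 → ℝ, u ≠ 0 → α u = α ![1, 0, 0, 0] * ∑ i, u i ^ 2 := by
    intro u hu
    -- A vector orthogonal to both u and the first basis vector links the two values of `α`.
    obtain ⟨y, hy, h0, h1⟩ : ∃ y : Fin 4 → ℝ, y ≠ 0 ∧ y 0 = 0 ∧ ∑ i, u i * y i = 0 := by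
      by_cases h2 : u 2 = 0
      · exact ⟨![0, 0, 1, 0], fun h0 => by simpa using congrFun h0 2, rfl,
          by simp [Fin.sum_univ_four, h2]⟩
      · refine ⟨![0, 0, u 3, -u 2], fun h0 => h2 (by simpa using congrFun h0 3), rfl, ?_⟩
        simp [Fin.sum_univ_four]
        ring
    have h3 := hcomm u y hu hy h1
    have h4 := hcomm ![1, 0, 0, 0] y he hy (by simp [Fin.sum_univ_four, h0])
    have h5 : ∑ i, (![1, 0, 0, 0] : Fin 4 → ℝ) i ^ 2 = 1 := by simp [Fin.sum_univ_four]
    rw [h5, mul_one] at h4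
    rw [← h4] at h3
    exact mul_right_cancel₀ (pos y hy) (by linarith)
  refine ⟨α ![1, 0, 0, 0], fun u y huy => ?_, fun u => ?_⟩
  · by_cases hu : u = 0
    · simp [hu, normSqCurvature]
    · rw [(hα u hu y huy).1, hconst u hu]
  · by_cases hu : u = 0
    · simp [hu, normSqJacobi]
    · have h1 := sum_normSq_eq (r := r) u
      have o1 : ∑ i, u i * ![-u 1, u 0, -u 3, u 2] i = 0 := by
        simp [Fin.sum_univ_four]; ring
      have o2 : ∑ i, u i * ![-u 2, u 3, u 0, -u 1] i = 0 := by
        simp [Fin.sum_univ_four]; ring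
      have o3 : ∑ i, u i * ![-u 3, -u 2, u 1, u 0] i = 0 := by
        simp [Fin.sum_univ_four]; ring
      have n1 : ∑ i, ![-u 1, u 0, -u 3, u 2] i ^ 2 = ∑ i, u i ^ 2 := by
        simp [Fin.sum_univ_four]; ring
      have n2 : ∑ i, ![-u 2, u 3, u 0, -u 1] i ^ 2 = ∑ i, u i ^ 2 := by
        simp [Fin.sum_univ_four]; ring
      have n3 : ∑ i, ![-u 3, -u 2, u 1, u 0] i ^ 2 = ∑ i, u i ^ 2 := by
        simp [Fin.sum_univ_four]; ring
      rw [(hα u hu _ o1).1, (hα u hu _ o2).1, (hα u hu _ o3).1, (hα u hu _ o1).2,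
        (hα u hu _ o2).2, (hα u hu _ o3).2, normSqCurvature_self hs, n1, n2, n3,
        hconst u hu] at h1
      linear_combination h1

/-- The curvature components of an Einstein curvature tensor in dimension four satisfying the
`η`-Einstein equations, where `a` and `b` are the blocks of the curvature operator. -/
theorem scalar_of_normSq_eq {a₁₁ a₁₂ a₁₃ a₂₂ a₂₃ a₃₃ b₁₁ b₁₂ b₁₃ b₂₂ b₂₃ a c : ℝ}
    (ht : a₁₁ + a₂₂ + a₃₃ = c)
    (f : ∀ x y z w : ℝ,
        (-a₁₁ * y ^ 2 - 2 * a₁₂ * y * z - 2 * a₁₃ * y * w - a₂₂ * z ^ 2 - 2 * a₂₃ * z * w -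
            a₃₃ * w ^ 2) ^ 2 +
        2 * (a₁₁ * x * y + a₁₂ * x * z + a₁₃ * x * w + b₁₁ * z * w + b₁₂ * y * w - b₁₃ * y * z +
            2 * b₂₂ * z * w - b₂₃ * z ^ 2 + b₂₃ * w ^ 2) ^ 2 +
        2 * (a₁₂ * x * y + a₂₂ * x * z + a₂₃ * x * w - 2 * b₁₁ * y * w - b₁₂ * z * w + b₁₃ * y ^ 2 -
            b₁₃ * w ^ 2 - b₂₂ * y * w + b₂₃ * y * z) ^ 2 +
        2 * (a₁₃ * x * y + a₂₃ * x * z + a₃₃ * x * w + b₁₁ * y * z - b₁₂ * y ^ 2 + b₁₂ * z ^ 2 +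
            b₁₃ * z * w - b₂₂ * y * z - b₂₃ * y * w) ^ 2 +
        (-a₁₁ * x ^ 2 - a₂₂ * w ^ 2 + 2 * a₂₃ * z * w - a₃₃ * z ^ 2 - 2 * b₁₂ * x * w +
            2 * b₁₃ * x * z) ^ 2 +
        2 * (-a₁₂ * x ^ 2 + a₁₂ * w ^ 2 - a₁₃ * z * w - a₂₃ * y * w + a₃₃ * y * z + b₁₁ * x * w -
            b₁₃ * x * y - b₂₂ * x * w + b₂₃ * x * z) ^ 2 +
        2 * (-a₁₂ * z * w - a₁₃ * x ^ 2 + a₁₃ * z ^ 2 + a₂₂ * y * w - a₂₃ * y * z -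
            2 * b₁₁ * x * z + b₁₂ * x * y - b₂₂ * x * z - b₂₃ * x * w) ^ 2 +
        (-a₁₁ * w ^ 2 + 2 * a₁₃ * y * w - a₂₂ * x ^ 2 - a₃₃ * y ^ 2 + 2 * b₁₂ * x * w -
            2 * b₂₃ * x * y) ^ 2 +
        2 * (a₁₁ * z * w - a₁₂ * y * w - a₁₃ * y * z - a₂₃ * x ^ 2 + a₂₃ * y ^ 2 + b₁₁ * x * y -
            b₁₂ * x * z + b₁₃ * x * w + 2 * b₂₂ * x * y) ^ 2 +
        (-a₁₁ * z ^ 2 + 2 * a₁₂ * y * z - a₂₂ * y ^ 2 - a₃₃ * x ^ 2 - 2 * b₁₃ * x * z +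
            2 * b₂₃ * x * y) ^ 2 =
          (9 / 2 * a - 6 * (c - 2)) * (x ^ 2 + y ^ 2 + z ^ 2 + w ^ 2) ^ 2)
    (g : ∀ y z w : ℝ, 2 * ((a₁₁ * y + a₁₂ * z + a₁₃ * w) ^ 2 + (a₁₂ * y + a₂₂ * z + a₂₃ * w) ^ 2 +
        (a₁₃ * y + a₂₃ * z + a₃₃ * w) ^ 2 + (b₁₁ * y + b₁₂ * z + b₁₃ * w) ^ 2 +
        (b₁₂ * y + b₂₂ * z + b₂₃ * w) ^ 2 + (b₁₃ * y + b₂₃ * z - (b₁₁ + b₂₂) * w) ^ 2) =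
        a * (y ^ 2 + z ^ 2 + w ^ 2)) :
    ∃ k : ℝ, (k = 1 ∨ k = 2) ∧ c = 3 * k ∧ a₁₁ = k ∧ a₂₂ = k ∧ a₃₃ = k ∧ a₁₂ = 0 ∧
      a₁₃ = 0 ∧ a₂₃ = 0 := by
  have e12 : a₁₁ * a₁₂ + a₁₂ * a₂₂ + a₁₃ * a₂₃ + b₁₁ * b₁₂ + b₁₂ * b₂₂ + b₁₃ * b₂₃ = 0 := by
    linear_combination (g 1 1 0 - g 1 0 0 - g 0 1 0) / 4
  have e13 : a₁₁ * a₁₃ + a₁₂ * a₂₃ + a₁₃ * a₃₃ + b₁₁ * b₁₃ + b₁₂ * b₂₃ - b₁₃ * (b₁₁ + b₂₂) = 0 := by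
    linear_combination (g 1 0 1 - g 1 0 0 - g 0 0 1) / 4
  have e23 : a₁₂ * a₁₃ + a₂₂ * a₂₃ + a₂₃ * a₃₃ + b₁₂ * b₁₃ + b₂₂ * b₂₃ - b₂₃ * (b₁₁ + b₂₂) = 0 := by
    linear_combination (g 0 1 1 - g 0 1 0 - g 0 0 1) / 4
  rcases weyl_eq_zero_or_eq_zero f with ⟨w₁, w₂, w₃, w₄, w₅⟩ | ⟨w₁, w₂, w₃, w₄, w₅⟩
  -- Reversing the orientation, that is B ↦ -B, exchanges the two Weyl halves and leaves the
  -- quadratic equations unchanged.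
  · exact scalar_of_half_weyl_eq_zero (t := c) (a := a) (b₁₁ := -b₁₁) (b₁₂ := -b₁₂)
      (b₁₃ := -b₁₃) (b₂₂ := -b₂₂) (b₂₃ := -b₂₃) ht (by linarith) (by linarith)
      (by linarith) (by linarith) (by linarith) (by linear_combination g 1 0 0)
      (by linear_combination g 0 1 0) (by linear_combination g 0 0 1)
      (by linear_combination e12) (by linear_combination e13) (by linear_combination e23)
      (by linear_combination f 1 0 0 0)
  · exact scalar_of_half_weyl_eq_zero (t := c) (a := a) ht w₁ w₂ w₃ w₄ w₅
      (by linear_combination g 1 0 0) (by linear_combination g 0 1 0)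
      (by linear_combination g 0 0 1) e12 e13 e23 (by linear_combination f 1 0 0 0)

/-- An Einstein curvature tensor in dimension four for which the unit sphere bundle satisfies the
`η`-Einstein equations is of constant curvature `1` or `2`. -/
theorem constant_curvature_of_normSq_eq {c : ℝ} (hs₁ : ∀ i j k l, r i j k l = - r j i k l)
    (hs₂ : ∀ i j k l, r i j k l = - r i j l k) (hp : ∀ i j k l, r i j k l = r k l i j)
    (hb : ∀ i j k l, r i j k l + r j k i l + r k i j l = 0)
    (hE : ∀ j k, ∑ i, r i j k i = if j = k then c else 0)
    (hη : ∀ u : Fin 4 → ℝ, u ≠ 0 → ∃ α, ∀ y, ∑ i, u i * y i = 0 →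
      normSqCurvature r u y = α * ∑ i, y i ^ 2 ∧
      normSqJacobi r u y = (2 * (c - 2) * ∑ i, u i ^ 2 - α / 2) * ∑ i, y i ^ 2) :
    ∃ k : ℝ, (k = 1 ∨ k = 2) ∧ c = 3 * k ∧
      ∀ j l, r 0 j l 0 = if j = l ∧ j ≠ 0 then k else 0 := by
  obtain ⟨a, hA, hJ⟩ := exists_normSqCurvature_eq hs₁ hη
  -- Normal form: the first pair becomes one of 01, 02, 03, 23, 31, 12 and the last pair one of the
  -- reversed 10, 20, 30, 32, 13, 21. The components are then the entries of the curvature operator,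
  -- with sectional curvatures on the diagonal.
  have z₁ : ∀ i k l, r i i k l = 0 := fun i k l => by linarith [hs₁ i i k l]
  have z₂ : ∀ i j k, r i j k k = 0 := fun i j k => by linarith [hs₂ i j k k]
  have s₁₀ : ∀ k l, r 1 0 k l = - r 0 1 k l := hs₁ 1 0
  have s₂₀ : ∀ k l, r 2 0 k l = - r 0 2 k l := hs₁ 2 0
  have s₃₀ : ∀ k l, r 3 0 k l = - r 0 3 k l := hs₁ 3 0
  have s₃₂ : ∀ k l, r 3 2 k l = - r 2 3 k l := hs₁ 3 2
  have s₁₃ : ∀ k l, r 1 3 k l = - r 3 1 k l := hs₁ 1 3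
  have s₂₁ : ∀ k l, r 2 1 k l = - r 1 2 k l := hs₁ 2 1
  have t₀₁ : ∀ k l, r k l 0 1 = - r k l 1 0 := fun k l => hs₂ k l 0 1
  have t₀₂ : ∀ k l, r k l 0 2 = - r k l 2 0 := fun k l => hs₂ k l 0 2
  have t₀₃ : ∀ k l, r k l 0 3 = - r k l 3 0 := fun k l => hs₂ k l 0 3
  have t₂₃ : ∀ k l, r k l 2 3 = - r k l 3 2 := fun k l => hs₂ k l 2 3
  have t₃₁ : ∀ k l, r k l 3 1 = - r k l 1 3 := fun k l => hs₂ k l 3 1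
  have t₁₂ : ∀ k l, r k l 1 2 = - r k l 2 1 := fun k l => hs₂ k l 1 2
  have p0102 := hp 0 1 2 0
  have p0103 := hp 0 1 3 0
  have p0123 := hp 0 1 3 2
  have p0131 := hp 0 1 1 3
  have p0112 := hp 0 1 2 1
  have p0203 := hp 0 2 3 0
  have p0223 := hp 0 2 3 2
  have p0231 := hp 0 2 1 3
  have p0212 := hp 0 2 2 1
  have p0323 := hp 0 3 3 2
  have p0331 := hp 0 3 1 3
  have p0312 := hp 0 3 2 1
  have p2331 := hp 2 3 1 3
  have p2312 := hp 2 3 2 1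
  have p3112 := hp 3 1 2 1
  have b0 := hb 0 1 3 2
  have E00 := hE 0 0
  have E01 := hE 0 1
  have E02 := hE 0 2
  have E03 := hE 0 3
  have E11 := hE 1 1
  have E12 := hE 1 2
  have E13 := hE 1 3
  have E22 := hE 2 2
  have E23 := hE 2 3
  have E33 := hE 3 3
  simp [Fin.sum_univ_four, z₁, z₂, s₁₀, s₂₀, s₃₀, s₃₂, s₁₃, s₂₁, t₀₁, t₀₂, t₀₃, t₂₃, t₃₁, t₁₂]
    at p0102 p0103 p0123 p0131 p0112 p0203 p0223 p0231 p0212 p0323 p0331 p0312 p2331 p2312 p3112 b0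
      E00 E01 E02 E03 E11 E12 E13 E22 E23 E33
  obtain ⟨a₁₁, ha11⟩ : ∃ s, r 0 1 1 0 = s := ⟨_, rfl⟩
  obtain ⟨a₁₂, ha12⟩ : ∃ s, r 0 1 2 0 = s := ⟨_, rfl⟩
  obtain ⟨a₁₃, ha13⟩ : ∃ s, r 0 1 3 0 = s := ⟨_, rfl⟩
  obtain ⟨a₂₂, ha22⟩ : ∃ s, r 0 2 2 0 = s := ⟨_, rfl⟩
  obtain ⟨a₂₃, ha23⟩ : ∃ s, r 0 2 3 0 = s := ⟨_, rfl⟩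
  obtain ⟨a₃₃, ha33⟩ : ∃ s, r 0 3 3 0 = s := ⟨_, rfl⟩
  obtain ⟨b₁₁, hb11⟩ : ∃ s, r 0 1 3 2 = s := ⟨_, rfl⟩
  obtain ⟨b₁₂, hb12⟩ : ∃ s, r 0 1 1 3 = s := ⟨_, rfl⟩
  obtain ⟨b₁₃, hb13⟩ : ∃ s, r 0 1 2 1 = s := ⟨_, rfl⟩
  obtain ⟨b₂₂, hb22⟩ : ∃ s, r 0 2 1 3 = s := ⟨_, rfl⟩
  obtain ⟨b₂₃, hb23⟩ : ∃ s, r 0 2 2 1 = s := ⟨_, rfl⟩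
  -- The Einstein equations make the lower right block equal to A and the block B symmetric; Bianchi
  -- makes B trace-free, so its last diagonal entry is `-b₁₁ - b₂₂`.
  have v0210 : r 0 2 1 0 = a₁₂ := by linarith
  have v0232 : r 0 2 3 2 = b₁₂ := by linarith
  have v0310 : r 0 3 1 0 = a₁₃ := by linarith
  have v0320 : r 0 3 2 0 = a₂₃ := by linarith
  have v0332 : r 0 3 3 2 = b₁₃ := by linarith
  have v0313 : r 0 3 1 3 = b₂₃ := by linarith
  have v0321 : r 0 3 2 1 = -b₁₁ - b₂₂ := by linarith
  have v2310 : r 2 3 1 0 = b₁₁ := by linarith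
  have v2320 : r 2 3 2 0 = b₁₂ := by linarith
  have v2330 : r 2 3 3 0 = b₁₃ := by linarith
  have v2332 : r 2 3 3 2 = a₁₁ := by linarith
  have v2313 : r 2 3 1 3 = a₁₂ := by linarith
  have v2321 : r 2 3 2 1 = a₁₃ := by linarith
  have v3110 : r 3 1 1 0 = b₁₂ := by linarith
  have v3120 : r 3 1 2 0 = b₂₂ := by linarith
  have v3130 : r 3 1 3 0 = b₂₃ := by linarith
  have v3132 : r 3 1 3 2 = a₁₂ := by linarith
  have v3113 : r 3 1 1 3 = a₂₂ := by linarith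
  have v3121 : r 3 1 2 1 = a₂₃ := by linarith
  have v1210 : r 1 2 1 0 = b₁₃ := by linarith
  have v1220 : r 1 2 2 0 = b₂₃ := by linarith
  have v1230 : r 1 2 3 0 = -b₁₁ - b₂₂ := by linarith
  have v1232 : r 1 2 3 2 = a₁₃ := by linarith
  have v1213 : r 1 2 1 3 = a₂₃ := by linarith
  have v1221 : r 1 2 2 1 = a₃₃ := by linarith
  have f : ∀ x y z w : ℝ,
      (-a₁₁ * y ^ 2 - 2 * a₁₂ * y * z - 2 * a₁₃ * y * w - a₂₂ * z ^ 2 - 2 * a₂₃ * z * w -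
          a₃₃ * w ^ 2) ^ 2 +
      2 * (a₁₁ * x * y + a₁₂ * x * z + a₁₃ * x * w + b₁₁ * z * w + b₁₂ * y * w - b₁₃ * y * z +
          2 * b₂₂ * z * w - b₂₃ * z ^ 2 + b₂₃ * w ^ 2) ^ 2 +
      2 * (a₁₂ * x * y + a₂₂ * x * z + a₂₃ * x * w - 2 * b₁₁ * y * w - b₁₂ * z * w + b₁₃ * y ^ 2 -
          b₁₃ * w ^ 2 - b₂₂ * y * w + b₂₃ * y * z) ^ 2 +
      2 * (a₁₃ * x * y + a₂₃ * x * z + a₃₃ * x * w + b₁₁ * y * z - b₁₂ * y ^ 2 + b₁₂ * z ^ 2 +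
          b₁₃ * z * w - b₂₂ * y * z - b₂₃ * y * w) ^ 2 +
      (-a₁₁ * x ^ 2 - a₂₂ * w ^ 2 + 2 * a₂₃ * z * w - a₃₃ * z ^ 2 - 2 * b₁₂ * x * w +
          2 * b₁₃ * x * z) ^ 2 +
      2 * (-a₁₂ * x ^ 2 + a₁₂ * w ^ 2 - a₁₃ * z * w - a₂₃ * y * w + a₃₃ * y * z + b₁₁ * x * w -
          b₁₃ * x * y - b₂₂ * x * w + b₂₃ * x * z) ^ 2 +
      2 * (-a₁₂ * z * w - a₁₃ * x ^ 2 + a₁₃ * z ^ 2 + a₂₂ * y * w - a₂₃ * y * z - 2 * b₁₁ * x * z +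
          b₁₂ * x * y - b₂₂ * x * z - b₂₃ * x * w) ^ 2 +
      (-a₁₁ * w ^ 2 + 2 * a₁₃ * y * w - a₂₂ * x ^ 2 - a₃₃ * y ^ 2 + 2 * b₁₂ * x * w -
          2 * b₂₃ * x * y) ^ 2 +
      2 * (a₁₁ * z * w - a₁₂ * y * w - a₁₃ * y * z - a₂₃ * x ^ 2 + a₂₃ * y ^ 2 + b₁₁ * x * y -
          b₁₂ * x * z + b₁₃ * x * w + 2 * b₂₂ * x * y) ^ 2 +
      (-a₁₁ * z ^ 2 + 2 * a₁₂ * y * z - a₂₂ * y ^ 2 - a₃₃ * x ^ 2 - 2 * b₁₃ * x * z +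
          2 * b₂₃ * x * y) ^ 2 =
        (9 / 2 * a - 6 * (c - 2)) * (x ^ 2 + y ^ 2 + z ^ 2 + w ^ 2) ^ 2 := by
    intro x y z w
    have h1 := hJ ![x, y, z, w]
    simp [normSqJacobi, Fin.sum_univ_four, z₁, z₂, s₁₀, s₂₀, s₃₀, s₃₂, s₁₃, s₂₁, t₀₁, t₀₂, t₀₃,
      t₂₃, t₃₁, t₁₂, ha11, ha12, ha13, ha22, ha23, ha33, hb11, hb12, hb13, hb22, hb23, v0210, v0232, v0310,
      v0320, v0332, v0313, v0321, v2310, v2320, v2330, v2332, v2313, v2321, v3110, v3120,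
      v3130, v3132, v3113, v3121, v1210, v1220, v1230, v1232, v1213, v1221] at h1
    linear_combination h1
  -- For u = e₀ the operator R(u, y) has components Ay and By, each occurring twice by skewness, so
  -- the equation is 2(A² + B²) = a.
  have g : ∀ y z w : ℝ, 2 * ((a₁₁ * y + a₁₂ * z + a₁₃ * w) ^ 2 + (a₁₂ * y + a₂₂ * z + a₂₃ * w) ^ 2 +
      (a₁₃ * y + a₂₃ * z + a₃₃ * w) ^ 2 + (b₁₁ * y + b₁₂ * z + b₁₃ * w) ^ 2 +
      (b₁₂ * y + b₂₂ * z + b₂₃ * w) ^ 2 + (b₁₃ * y + b₂₃ * z - (b₁₁ + b₂₂) * w) ^ 2) =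
      a * (y ^ 2 + z ^ 2 + w ^ 2) := by
    intro y z w
    have h1 := hA ![1, 0, 0, 0] ![0, y, z, w] (by simp [Fin.sum_univ_four])
    simp [normSqCurvature, Fin.sum_univ_four, z₁, z₂, t₀₁, t₀₂, t₀₃, t₂₃, t₃₁, t₁₂,
      ha11, ha12, ha13, ha22, ha23, ha33, hb11, hb12, hb13, hb22, hb23, v0210, v0232, v0310,
      v0320, v0332, v0313, v0321] at h1
    linear_combination h1
  obtain ⟨k, hk, hck, h11, h22, h33, h12, h13, h23⟩ := scalar_of_normSq_eq (by linarith) f g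
  refine ⟨k, hk, hck, fun j l => ?_⟩
  fin_cases j <;> fin_cases l <;>
    simp [z₁, z₂, ha11, ha12, ha13, ha22, ha23, ha33, v0210, v0310, v0320, h11, h22, h33, h12,
      h13, h23]

end LocalGeometry

/-! ### Sectional curvature of an Einstein metric with η-Einstein unit tangent bundle -/

namespace LocalGeometry

open Filter Topology ContinuousLinearMap

variable {V : Type*} [NormedAddCommGroup V] [NormedSpace ℝ V] [FiniteDimensional ℝ V]
  {E : Type*} [NormedAddCommGroup E] [NormedSpace ℝ E] [FiniteDimensional ℝ E]
  {h : V → V →L[ℝ] V →L[ℝ] ℝ} {U : Set V} {x : V}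

omit [FiniteDimensional ℝ V] in
theorem sum_curvature_left (h : V → V →L[ℝ] V →L[ℝ] ℝ) (x : V) (e : Fin 4 → V) (u y : Fin 4 → ℝ)
    (Z T : V) :
    h x (curvature h x (∑ i, u i • e i) (∑ j, y j • e j) Z) T =
      ∑ j, y j * ∑ i, u i * h x (curvature h x (e i) (e j) Z) T := by
  simp only [← curvatureL_apply, map_sum, map_smul, sum_apply, smul_apply, smul_eq_mul]

omit [FiniteDimensional ℝ V] in
theorem sum_curvature_right (h : V → V →L[ℝ] V →L[ℝ] ℝ) (x : V) (e : Fin 4 → V) (u y : Fin 4 → ℝ)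
    (Y T : V) :
    h x (curvature h x (∑ i, u i • e i) Y (∑ j, y j • e j)) T =
      ∑ j, y j * ∑ i, u i * h x (curvature h x (e i) Y (e j)) T := by
  simp only [← curvatureL_apply, map_sum, map_smul, sum_apply, smul_apply, smul_eq_mul]

/-- An Einstein metric in dimension four whose unit tangent bundle is `η`-Einstein over `U` has
constant sectional curvature `1` or `2`. -/
theorem IsMetricOn.sectionalCurvature_of_etaEinstein (H : IsMetricOn h U) (hx : x ∈ U)
    (hV : Module.finrank ℝ V = 4) (hE : Module.finrank ℝ E = 7) {c : ℝ}
    (hc : ∀ X Y, ricci h x X Y = c * h x X Y)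
    (hη : ∀ (W : Set E) (F : E → V × V), IsUnitImmersion h U W F → ∀ w ∈ W, ∃ α β : ℝ,
      ∀ X Y, ricci (pullback (contactMetric h) F) w X Y =
        α * pullback (contactMetric h) F w X Y +
          β * (contactForm h (F w) (fderiv ℝ F w X) * contactForm h (F w) (fderiv ℝ F w Y)))
    {X Y : V} (hXY : LinearIndependent ℝ ![X, Y]) :
    ∃ k : ℝ, (k = 1 ∨ k = 2) ∧ c = 3 * k ∧ sectionalCurvature h x X Y = k := by
  have hX0 : X ≠ 0 := hXY.ne_zero 0
  have hXX := H.pos x hx X hX0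
  obtain ⟨s, hs0, hs⟩ : ∃ s : ℝ, 0 < s ∧ h x X X = s ^ 2 :=
    ⟨√(h x X X), Real.sqrt_pos.2 hXX, (Real.sq_sqrt hXX.le).symm⟩
  have hu : h x (s⁻¹ • X) (s⁻¹ • X) = 1 := by
    simp only [map_smul, smul_apply, smul_eq_mul, hs]; field_simp
  -- With e₀ along `X`, only curvatures of planes containing e₀ are needed at the end.
  obtain ⟨e, he0, he⟩ := H.exists_orthonormal hx (n := 3) hV hu
  have hcV : Module.finrank ℝ V = Fintype.card (Fin (3 + 1)) := by simp [hV]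
  have hinner : ∀ u y : Fin 4 → ℝ, h x (∑ i, u i • e i) (∑ i, y i • e i) = ∑ i, u i * y i := by
    intro u y
    simp [map_sum, sum_apply, he, mul_comm]
  have hpars : ∀ v w : V, h x v w = ∑ i : Fin 4, h x v (e i) * h x w (e i) :=
    parseval_of_orthonormal_frame he hcV
  obtain ⟨k, hk, hck, hr⟩ := constant_curvature_of_normSq_eq (c := c)
    (r := fun i j k l => h x (curvature h x (e i) (e j) (e k)) (e l))
    (fun i j k l => by rw [curvature_skew_left]; simp)
    (fun i j k l => H.curvature_skew_right hx _ _ _ _)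
    (fun i j k l => H.curvature_pair_symm hx _ _ _ _)
    (fun i j k l => by
      have := H.bianchi hx (e i) (e j) (e k)
      rw [← add_apply, ← add_apply, ← map_add, ← map_add, this]; simp)
    (fun j k => by
      rw [← ricci_eq_sum he hcV, hc, he]; simp)
    (fun u hu0 => by
      have hpos : 0 < ∑ i, u i ^ 2 := by
        obtain ⟨i, hi⟩ := Function.ne_iff.1 hu0
        exact Finset.sum_pos' (fun _ _ => sq_nonneg _) ⟨i, Finset.mem_univ _, by
          have : u i ≠ 0 := hi
          positivity⟩
      obtain ⟨t, ht0, ht⟩ : ∃ t : ℝ, 0 < t ∧ ∑ i, u i ^ 2 = t ^ 2 :=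
        ⟨√(∑ i, u i ^ 2), Real.sqrt_pos.2 hpos, (Real.sq_sqrt hpos.le).symm⟩
      have huv : h x (∑ i, (t⁻¹ * u i) • e i) (∑ i, (t⁻¹ * u i) • e i) = 1 := by
        rw [hinner]
        have : ∀ i, t⁻¹ * u i * (t⁻¹ * u i) = (t ^ 2)⁻¹ * u i ^ 2 := fun i => by
          field_simp
        simp only [this, ← Finset.mul_sum, ht]
        field_simp
      obtain ⟨a, ha⟩ := H.algebraic_of_etaEinstein hx (n := 3) hV hE hc hη he huv
      -- The equations hold for the unit vector u/t; both norms are quadratic in u, so passing to u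
      -- multiplies them by t².
      refine ⟨a * t ^ 2, fun y huy => ?_⟩
      obtain ⟨h1, h2⟩ := ha (∑ i, y i • e i) (by
        rw [hinner]
        have : ∀ i, y i * (t⁻¹ * u i) = t⁻¹ * (u i * y i) := fun i => by ring
        simp only [this, ← Finset.mul_sum, huy, mul_zero])
      rw [hinner] at h1 h2
      have hm : ∀ (R : V), h x R R = ∑ l, h x R (e l) ^ 2 := fun R => by
        rw [hpars]; exact Finset.sum_congr rfl fun _ _ => (sq _).symm
      have hsc : ∀ (f : Fin 4 → ℝ), ∑ i, t⁻¹ * u i * f i = t⁻¹ * ∑ i, u i * f i := fun f => by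
        simp only [mul_assoc, ← Finset.mul_sum]
      have hsc' : ∀ (f : Fin 4 → ℝ), ∑ i, y i * (t⁻¹ * f i) = t⁻¹ * ∑ i, y i * f i := fun f => by
        simp only [Finset.mul_sum]
        exact Finset.sum_congr rfl fun _ _ => by ring
      simp only [hm, sum_curvature_left, sum_curvature_right, hsc, hsc', mul_pow,
        ← Finset.mul_sum, ← sq] at h1 h2
      have hy2 : ∀ S A : ℝ, t⁻¹ ^ 2 * S = A → S = t ^ 2 * A := fun S A hS => by
        rw [← hS]; field_simp
      refine ⟨?_, ?_⟩
      · rw [normSqCurvature, hy2 _ _ h1]; ring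
      · rw [normSqJacobi, hy2 _ _ h2, ht]; push_cast; ring)
  refine ⟨k, hk, hck, ?_⟩
  have hX : X = s • e 0 := by rw [he0, smul_smul, mul_inv_cancel₀ hs0.ne', one_smul]
  have hYsum : ∑ i : Fin 4, h x Y (e i) • e i = Y := sum_of_orthonormal_frame he hcV Y
  obtain ⟨y, hy⟩ : ∃ y : Fin 4 → ℝ, ∀ i, h x Y (e i) = y i := ⟨_, fun _ => rfl⟩
  simp only [hy] at hYsum
  have hYY : h x Y Y = ∑ i, y i ^ 2 := by
    rw [hpars]; simp only [hy, ← sq]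
  have hXYi : h x X Y = s * y 0 := by
    rw [hX, map_smul, smul_apply, H.symm x hx, hy]; rfl
  have hnum : h x (curvature h x X Y Y) X = s ^ 2 * (k * (y 1 ^ 2 + y 2 ^ 2 + y 3 ^ 2)) := by
    have h1 : h x (curvature h x X Y Y) X =
        s ^ 2 * h x (curvature h x (e 0) Y Y) (e 0) := by
      rw [hX]
      simp only [← curvatureL_apply, map_smul, smul_apply, smul_eq_mul]
      ring
    rw [h1, ← hYsum]
    congr 1
    simp only [← curvatureL_apply, map_sum, map_smul, sum_apply, smul_apply, smul_eq_mul]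
    simp only [curvatureL_apply, hr, Fin.sum_univ_four]
    simp
    ring
  have hg := H.gram_pos hx hXY
  rw [sectionalCurvature, div_eq_iff hg.ne', hnum, hs, hYY, hXYi, Fin.sum_univ_four]
  ring

end LocalGeometry

/-! ### Passage to the manifold -/

section Manifold

open LocalGeometry Bundle

variable {n : ℕ} {M : Type*} [TopologicalSpace M] [ChartedSpace (EuclideanSpace ℝ (Fin n)) M]
  [IsManifold (𝓡 n) ∞ M]
  (g : Bundle.ContMDiffRiemannianMetric (𝓡 n) ∞ (EuclideanSpace ℝ (Fin n))
      (fun p : M => TangentSpace (𝓡 n) p))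
  {φ : OpenPartialHomeomorph M (EuclideanSpace ℝ (Fin n))}

/-- The coordinate vector fields of a chart are smooth. -/
theorem contMDiffAt_chartSymmDeriv (hφ : φ ∈ IsManifold.maximalAtlas (𝓡 n) ∞ M)
    {x : EuclideanSpace ℝ (Fin n)} (hx : x ∈ φ.target) (X : EuclideanSpace ℝ (Fin n)) :
    ContMDiffAt (𝓡 n) (𝓡 n).tangent ∞
      (fun y => (⟨φ.symm y, chartSymmDeriv φ y X⟩ : TangentBundle (𝓡 n) M)) x := by
  have hs := contMDiffAt_symm_of_mem_maximalAtlas hφ hx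
  have h1 := hs.mfderiv_const (m := ∞) le_rfl
  have hv : ContMDiffAt (𝓡 n) (𝓡 n).tangent ∞
      (fun y => (⟨y, X⟩ : TangentBundle (𝓡 n) (EuclideanSpace ℝ (Fin n)))) x := by
    exact contMDiffAt_vectorSpace_iff_contDiffAt.2 contDiffAt_const
  exact h1.clm_apply_of_inCoordinates hv hs

/-- A Riemannian metric read in a chart is a metric on the chart target. -/
theorem isMetricOn_metricInChart (hφ : φ ∈ IsManifold.maximalAtlas (𝓡 n) ∞ M) :
    IsMetricOn (metricInChart g φ) φ.target where
  isOpen := φ.open_target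
  smooth := by
    refine contDiffOn_clm_apply.2 fun X => contDiffOn_clm_apply.2 fun Y => ?_
    intro x hx
    have hs := contMDiffAt_symm_of_mem_maximalAtlas hφ hx
    have hX := contMDiffAt_chartSymmDeriv hφ hx X
    have hY := contMDiffAt_chartSymmDeriv hφ hx Y
    have h1 := (g.contMDiff (φ.symm x)).comp x hs
    have h2 : ContMDiffAt (𝓡 n) ((𝓡 n).prod 𝓘(ℝ)) ∞
        (fun y => TotalSpace.mk' ℝ (E := Bundle.Trivial M ℝ) (φ.symm y)
          (g.inner (φ.symm y) (chartSymmDeriv φ y X) (chartSymmDeriv φ y Y))) x :=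
      ContMDiffAt.clm_bundle_apply₂ (F₁ := EuclideanSpace ℝ (Fin n))
        (F₂ := EuclideanSpace ℝ (Fin n)) h1 hX hY
    have h3 := (contMDiffAt_totalSpace.1 h2).2
    exact (contMDiffAt_iff_contDiffAt.1 h3).contDiffWithinAt
  symm x _ X Y := g.symm _ _ _
  pos x hx X hX := by
    rw [metricInChart_apply]
    refine g.pos (φ.symm x) (chartSymmDeriv φ x X) fun h0 => hX ?_
    have hd : φ.symm.MDifferentiable (𝓡 n) (𝓡 n) :=
      ⟨(contMDiffOn_symm_of_mem_maximalAtlas hφ).mdifferentiableOn (by simp),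
        (contMDiffOn_of_mem_maximalAtlas hφ).mdifferentiableOn (by simp)⟩
    exact hd.mfderiv_injective hx (h0.trans (map_zero _).symm)

theorem isLocalParametrization_iff
    {W : Set (EuclideanSpace ℝ (Fin (2 * n - 1)))}
    {F : EuclideanSpace ℝ (Fin (2 * n - 1)) →
      EuclideanSpace ℝ (Fin n) × EuclideanSpace ℝ (Fin n)} :
    IsLocalParametrization g φ W F ↔ IsUnitImmersion (metricInChart g φ) φ.target W F :=
  ⟨fun P => ⟨P.isOpen, P.contDiffOn, P.mem_target, P.mem_unit, P.immersion⟩,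
    fun P => ⟨P.isOpen, P.smooth, P.mem, P.unit, P.immersion⟩⟩

end Manifold

open LocalGeometry in
/-- The unit tangent bundle of a `4`-manifold of constant curvature `1` or `2` is `η`-Einstein. -/
theorem isEtaEinsteinUnitTangentBundle_of_constant {M : Type*} [TopologicalSpace M]
    [ChartedSpace (EuclideanSpace ℝ (Fin 4)) M] [IsManifold (𝓡 4) ∞ M]
    (g : Bundle.ContMDiffRiemannianMetric (𝓡 4) ∞ (EuclideanSpace ℝ (Fin 4))
      (fun p : M => TangentSpace (𝓡 4) p)) {k : ℝ} (hk : k = 1 ∨ k = 2)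
    (hg : HasConstantSectionalCurvature g k) : IsEtaEinsteinUnitTangentBundle g := by
  -- The factors 4 undo the quarters in the metric and in η ⊗ η. The first difference in β compares
  -- the horizontal and vertical factors; it equals -(k - 1)(k - 2), hence vanishes, and β = -4k².
  refine ⟨fun _ => 4 * (2 + k ^ 2 / 2), fun _ => 4 * (3 * k - k ^ 2 / 2 - (2 + k ^ 2 / 2) - k ^ 2),
    fun φ hφ W F P => ⟨contDiffOn_const, contDiffOn_const, fun w hw X Y => ?_⟩⟩
  have H := isMetricOn_metricInChart g hφ
  have P' := (isLocalParametrization_iff g).1 P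
  rw [P'.ricci_of_constant_curvature H hw (n := 3) (by simp) (by simp)
    (fun x hx => H.curvature_eq_of_sectionalCurvature hx (hg φ hφ x hx)),
    pullback_contactMetric_apply, contactForm_fderiv, contactForm_fderiv]
  rcases hk with rfl | rfl
  · norm_num
    ring
  · norm_num
    ring

open LocalGeometry in
theorem theorem3 {M : Type*} [TopologicalSpace M] [T2Space M] [SecondCountableTopology M]
    [ChartedSpace (EuclideanSpace ℝ (Fin 4)) M] [IsManifold (𝓡 4) ∞ M]
    (g : Bundle.ContMDiffRiemannianMetric (𝓡 4) ∞ (EuclideanSpace ℝ (Fin 4))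
      (fun p : M => TangentSpace (𝓡 4) p))
    (hg : IsEinstein g) :
    IsEtaEinsteinUnitTangentBundle g ↔
      HasConstantSectionalCurvature g 1 ∨ HasConstantSectionalCurvature g 2 := by
  constructor
  · rintro ⟨α, β, hη⟩
    obtain ⟨c, hc⟩ := hg
    have key : ∀ φ ∈ IsManifold.maximalAtlas (𝓡 4) ∞ M, ∀ x ∈ φ.target,
        ∀ X Y : EuclideanSpace ℝ (Fin 4), LinearIndependent ℝ ![X, Y] →
        ∃ k : ℝ, (k = 1 ∨ k = 2) ∧ c = 3 * k ∧
          sectionalCurvature (metricInChart g φ) x X Y = k := fun φ hφ x hx X Y hXY =>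
      (isMetricOn_metricInChart g hφ).sectionalCurvature_of_etaEinstein
        (E := EuclideanSpace ℝ (Fin (2 * 4 - 1))) hx (by simp) (by simp) (hc φ hφ x hx)
        (fun W F P w hw => ⟨_, _, (hη φ hφ W F ((isLocalParametrization_iff g).2 P)).2.2 w hw⟩) hXY
    -- A priori k depends on the point and the plane, but c = 3k with the global Einstein constant
    -- c, so c alone decides between 1 and 2 and connectedness of `M` is not needed.
    by_cases h3 : c = 3
    · refine Or.inl fun φ hφ x hx X Y hXY => ?_
      obtain ⟨k, -, hck, hs⟩ := key φ hφ x hx X Y hXY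
      rw [hs]
      linarith
    · refine Or.inr fun φ hφ x hx X Y hXY => ?_
      obtain ⟨k, rfl | rfl, hck, hs⟩ := key φ hφ x hx X Y hXY
      · exact absurd (by linarith) h3
      · exact hs
  · rintro (h1 | h2)
    · exact isEtaEinsteinUnitTangentBundle_of_constant g (Or.inl rfl) h1
    · exact isEtaEinsteinUnitTangentBundle_of_constant g (Or.inr rfl) h2
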